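/- Let $u_0,u_b:(0,\infty)\to\mathbb R$ be bounded measurable functions with $u_b>0$ almost everywhere, and let $\rho_0,\rho_b:(0,\infty)\to\mathbb R$ be measurable, positive almost everywhere, and (essentially) bounded on $(0,R]$ for every $R>0$. For $y,\tau,x\ge 0$, $t>0$ put $$F(y,x,t)=\int_0^y[t u_0(\eta)+\eta-x]\rho_0(\eta)\,d\eta,\qquad G(\tau,x,t)=\int_0^\tau[x-u_b(\eta)(t-\eta)]\rho_b(\eta)u_b(\eta)\,d\eta,$$ $F(x,t)=\min_{y\ge0}F(y,x,t)$, $G(x,t)=\min_{\tau\ge0}G(\tau,x,t)$. Let $y_*(x,t)\le y^*(x,t)$ be the smallest and largest minimizers of $F(\cdot,x,t)$ on $[0,\infty)$, and $\tau_*(x,t)\le\tau^*(x,t)$ the smallest and largest minimizers of $G(\cdot,x,t)$ on $[0,\infty)$. At a point $(x,t)$ with $x,t>0$ (omitting the arguments $(x,t)$ of $F,G,y_*,y^*,\tau_*,\tau^*$) define $$u(x,t)=\begin{cases}\dfrac{x-y_*}{t}& F<G,\ y_*=y^*,\\[1ex] \dfrac{\int_{y_*}^{y^*}\rho_0u_0}{\int_{y_*}^{y^*}\rho_0}&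 F<G,\ y_*<y^*,\\[1ex] \dfrac{x}{t-\tau_*}& F>G,\ \tau_*=\tau^*,\\[1ex] \dfrac{\int_{\tau_*}^{\tau^*}\rho_bu_b^2}{\int_{\tau_*}^{\tau^*}\rho_bu_b}& F>G,\ \tau_*<\tau^*,\\[1ex] \dfrac{\int_0^{\tau^*}\rho_bu_b^2+\int_0^{y^*}\rho_0u_0}{\int_0^{\tau^*}\rho_bu_b+\int_0^{y^*}\rho_0}& F=G,\ (y^*,\tau^*)\ne(0,0),\\[1ex] \dfrac xt& F=G,\ y^*=\tau^*=0.\end{cases}$$ For $x=0$, $t>0$ let $u(0,t)=u_b(t)$ if $F(0,t)>G(0,t)$, $u(0,t)=0$ if $F(0,t)<G(0,t)$, and use the last two formulas if $F(0,t)=G(0,t)$. For $x,t>0$ let $$m=\begin{cases}\int_0^{y_*}\rho_0\,d\eta& F\le G,\\ -\int_0^{\tau_*}\rho_bu_b\,d\eta& F>G,\end{cases}\qquad q=\begin{cases}\int_0^{y_*}\rho_0u_0\,d\eta& F\le G,\\ -\int_0^{\tau_*}\rho_bu_b^2\,d\eta& F>G,\end{cases}$$ $$E=\begin{cases}\frac12\int_0^{y_*}\rho_0(\eta)u_0(\eta)\,u(X(\eta,t),t)\,d\eta&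 F\le G,\\ -\frac12\int_0^{\tau_*}\rho_b(\eta)u_b(\eta)^2\,u(Y(\eta,t),t)\,d\eta& F>G,\end{cases}$$ where $X(\eta,t)=\inf\{x>0: F(x,t)\le G(x,t),\ y_*(x,t)>\eta\}$ and $Y(\eta,t)=\sup\{x\ge0: F(x,t)\ge G(x,t),\ \tau_*(x,t)>\eta\}$ (with $Y=0$ if this set is empty) are the generalized characteristics issuing from $(\eta,0)$ and $(0,\eta)$. Then the following hold. 1. $u$, $m$, $q$, $E$ are Borel measurable on $(0,\infty)^2$ and bounded on its compact subsets. For every $t>0$ the functions $m(\cdot,t)$, $q(\cdot,t)$, $E(\cdot,t)$ are of locally bounded variation on $(0,\infty)$, and the Lebesgue–Stieltjes measure $dm=m(dx,t)$ is a positive Radon measure on $(0,\infty)$. 2. $(u,m)$ is a global generalized solution of the mass/momentum system: for all $\varphi,\psi\in C_c^\infty((0,\infty)^2)$, $$\iint\varphi_t\,m\,dx\,dt-\iint\varphi\,u\,dm\,dt=0,\qquad \iint(\psi_tu+\psi_xu^2)\,dm\,dt=0,$$ all integrals being absolutely convergent as iterated integrals (first in $dm$ for almost every fixed $t$, then in $dt$).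 3. $m,q,E$ are global weak solutions of $m_t+q_x=0$, $q_t+(2E)_x=0$ on $(0,\infty)^2$: for all $\varphi\in C_c^\infty((0,\infty)^2)$, $\iint(\varphi_tm+\varphi_xq)\,dx\,dt=0$ and $\iint(\varphi_tq+2\varphi_xE)\,dx\,dt=0$. 4. For every $t>0$, the Lebesgue–Stieltjes measures on $(0,\infty)$ satisfy $dq=u\,dm$ and $dE=\tfrac12u^2\,dm$, with $u(\cdot,t)$ and $u(\cdot,t)^2$ locally integrable with respect to $dm$. -/

import Mathlib

open Set Filter MeasureTheory Function TopologicalSpace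
open scoped ContDiff

noncomputable section

namespace PressurelessGas

/-! ### The quadrant, test functions, Lebesgue-Stieltjes measures, solution concepts -/

/-- The open quarter plane `{(x, t) : x > 0, t > 0}`. -/
def quadrant : Opens (ℝ × ℝ) :=
  ⟨Ioi 0 ×ˢ Ioi 0, isOpen_Ioi.prod isOpen_Ioi⟩

/-- Smooth real functions whose support is a compact subset of the open quarter plane. -/
abbrev Test : Type := TestFunction quadrant ℝ ⊤

/-- The partial derivative with respect to the first variable (space). -/
def Test.dx (φ : Test) (p : ℝ × ℝ) : ℝ := fderiv ℝ φ p (1, 0)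

/-- The partial derivative with respect to the second variable (time). -/
def Test.dt (φ : Test) (p : ℝ × ℝ) : ℝ := fderiv ℝ φ p (0, 1)

/-- `f`, a function of `(x, t)`, is (Borel) measurable on the open quarter plane and bounded on
each of its compact subsets. -/
structure IsLocallyBoundedMeasurable (f : ℝ → ℝ → ℝ) : Prop where
  measurable : Measurable fun p : quadrant => f p.1.1 p.1.2
  bounded : ∀ K : Set (ℝ × ℝ), IsCompact K → K ⊆ quadrant → ∃ C : ℝ, ∀ p ∈ K, |f p.1 p.2| ≤ C

/-- `dg = w dν` on `(0, ∞)`: the function `g` is of locally bounded variation on `(0, ∞)`, and its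
Lebesgue-Stieltjes measure, which gives mass `g(b+) - g(a-)` to `[a, b]`, has the locally
`ν`-integrable density `w` with respect to `ν`. -/
structure HasStieltjesDensity (g w : ℝ → ℝ) (ν : Measure ℝ) : Prop where
  boundedVariation : LocallyBoundedVariationOn g (Ioi 0)
  integrableOn : ∀ a b : ℝ, 0 < a → a ≤ b → IntegrableOn w (Icc a b) ν
  integral_eq : ∀ a b : ℝ, 0 < a → a ≤ b → ∫ x in Icc a b, w x ∂ν = rightLim g b - leftLim g a

/-- `ν` is a positive Radon measure on `(0, ∞)` (seen as a measure on `ℝ` that vanishes on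
`(-∞, 0]`) and it is the Lebesgue-Stieltjes measure `dg` of `g` on `(0, ∞)`. For a given `g` there
is at most one such `ν`. -/
structure IsStieltjesMeasure (g : ℝ → ℝ) (ν : Measure ℝ) : Prop where
  density_one : HasStieltjesDensity g (fun _ => 1) ν
  null_Iic : ν (Iic 0) = 0

/-- `w_t + f_x = 0` in the sense of distributions on the open quarter plane. -/
structure IsWeakSolution (w f : ℝ → ℝ → ℝ) : Prop where
  density_locallyBounded : IsLocallyBoundedMeasurable w
  flux_locallyBounded : IsLocallyBoundedMeasurable f
  weak : ∀ φ : Test,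
    ∫ p in (quadrant : Set (ℝ × ℝ)), (φ.dt p * w p.1 p.2 + φ.dx p * f p.1 p.2) = 0

/-- `(u, m)` is a global generalized solution of the mass/momentum system
`∬ φ_t m dx dt - ∬ φ u dm dt = 0`, `∬ (ψ_t u + ψ_x u²) dm dt = 0` on the open quarter plane.
Here `ρ t` is the Lebesgue-Stieltjes measure `dm` of `m(·, t)` for almost all `t`. -/
structure IsGeneralizedSolution (u m : ℝ → ℝ → ℝ) (ρ : ℝ → Measure ℝ) : Prop where
  velocity_locallyBounded : IsLocallyBoundedMeasurable u
  mass_locallyBounded : IsLocallyBoundedMeasurable m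
  stieltjes : ∀ᵐ t : ℝ, 0 < t → IsStieltjesMeasure (fun x => m x t) (ρ t)
  integrable_mass : ∀ φ : Test,
    (∀ᵐ t : ℝ, 0 < t → Integrable (fun x => φ (x, t) * u x t) (ρ t)) ∧
    IntegrableOn (fun t => ∫ x, φ (x, t) * u x t ∂ρ t) (Ioi 0)
  weak_mass : ∀ φ : Test,
    (∫ p in (quadrant : Set (ℝ × ℝ)), φ.dt p * m p.1 p.2)
      - ∫ t in Ioi (0 : ℝ), ∫ x, φ (x, t) * u x t ∂ρ t = 0
  integrable_momentum : ∀ ψ : Test,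
    (∀ᵐ t : ℝ, 0 < t →
      Integrable (fun x => ψ.dt (x, t) * u x t + ψ.dx (x, t) * u x t ^ 2) (ρ t)) ∧
    IntegrableOn (fun t => ∫ x, (ψ.dt (x, t) * u x t + ψ.dx (x, t) * u x t ^ 2) ∂ρ t) (Ioi 0)
  weak_momentum : ∀ ψ : Test,
    ∫ t in Ioi (0 : ℝ), ∫ x, (ψ.dt (x, t) * u x t + ψ.dx (x, t) * u x t ^ 2) ∂ρ t = 0

/-! ### The data, the potentials and their minimizers -/

/-- Initial density and velocity (functions of `x > 0`) and boundary density and velocity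
(functions of `t > 0`); only the values at positive arguments matter. -/
structure GasData where
  rho0 : ℝ → ℝ
  u0 : ℝ → ℝ
  rhoB : ℝ → ℝ
  uB : ℝ → ℝ

/-- A measurable function on `(0, ∞)` (up to null sets) that is essentially bounded. -/
def IsBoundedData (f : ℝ → ℝ) : Prop :=
  AEMeasurable f (volume.restrict (Ioi 0)) ∧ ∃ C : ℝ, ∀ᵐ s : ℝ, 0 < s → |f s| ≤ C

/-- A measurable function on `(0, ∞)` (up to null sets) that is essentially bounded on each
`(0, R]`. -/
def IsLocallyBoundedData (f : ℝ → ℝ) : Prop :=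
  AEMeasurable f (volume.restrict (Ioi 0)) ∧
    ∀ R : ℝ, ∃ C : ℝ, ∀ᵐ s : ℝ, 0 < s → s ≤ R → |f s| ≤ C

/-- The velocities are bounded and measurable, the boundary velocity is positive; the densities
are locally bounded, measurable and positive. -/
structure GasData.Admissible (d : GasData) : Prop where
  u0_bounded : IsBoundedData d.u0
  uB_bounded : IsBoundedData d.uB
  uB_pos : ∀ᵐ s : ℝ, 0 < s → 0 < d.uB s
  rho0_bounded : IsLocallyBoundedData d.rho0
  rho0_pos : ∀ᵐ s : ℝ, 0 < s → 0 < d.rho0 s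
  rhoB_bounded : IsLocallyBoundedData d.rhoB
  rhoB_pos : ∀ᵐ s : ℝ, 0 < s → 0 < d.rhoB s

namespace GasData

variable (d : GasData)

/-- The initial potential `F(y, x, t)`. -/
def potF (y x t : ℝ) : ℝ := ∫ η in (0 : ℝ)..y, (t * d.u0 η + η - x) * d.rho0 η

/-- The boundary potential `G(τ, x, t)`. -/
def potG (τ x t : ℝ) : ℝ := ∫ η in (0 : ℝ)..τ, (x - d.uB η * (t - η)) * d.rhoB η * d.uB η

/-- `F(x, t) = min_{y ≥ 0} F(y, x, t)`. -/
def minF (x t : ℝ) : ℝ := sInf ((fun y => d.potF y x t) '' Ici 0)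

/-- `G(x, t) = min_{τ ≥ 0} G(τ, x, t)`. -/
def minG (x t : ℝ) : ℝ := sInf ((fun τ => d.potG τ x t) '' Ici 0)

/-- The set of minimizers `y ≥ 0` of `F(y, x, t)`. -/
def argminF (x t : ℝ) : Set ℝ := {y | 0 ≤ y ∧ ∀ z, 0 ≤ z → d.potF y x t ≤ d.potF z x t}

/-- The set of minimizers `τ ≥ 0` of `G(τ, x, t)`. -/
def argminG (x t : ℝ) : Set ℝ := {τ | 0 ≤ τ ∧ ∀ z, 0 ≤ z → d.potG τ x t ≤ d.potG z x t}

/-- The leftmost minimizer `y_*(x, t)` of the initial potential. -/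
def yLow (x t : ℝ) : ℝ := sInf (d.argminF x t)

/-- The rightmost minimizer `y^*(x, t)` of the initial potential. -/
def yUp (x t : ℝ) : ℝ := sSup (d.argminF x t)

/-- The lowermost minimizer `τ_*(x, t)` of the boundary potential. -/
def tauLow (x t : ℝ) : ℝ := sInf (d.argminG x t)

/-- The uppermost minimizer `τ^*(x, t)` of the boundary potential. -/
def tauUp (x t : ℝ) : ℝ := sSup (d.argminG x t)

/-! ### Velocity, mass, characteristics, momentum and energy -/

open Classical in
/-- The velocity `u(x, t)` for `x ≥ 0`, `t > 0`. -/
def velocity (x t : ℝ) : ℝ :=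
  if x = 0 ∧ d.minG x t < d.minF x t then d.uB t
  else if x = 0 ∧ d.minF x t < d.minG x t then 0
  else if d.minF x t < d.minG x t then
    if d.yLow x t = d.yUp x t then (x - d.yLow x t) / t
    else (∫ η in (d.yLow x t)..(d.yUp x t), d.rho0 η * d.u0 η) /
      ∫ η in (d.yLow x t)..(d.yUp x t), d.rho0 η
  else if d.minG x t < d.minF x t then
    if d.tauLow x t = d.tauUp x t then x / (t - d.tauLow x t)
    else (∫ η in (d.tauLow x t)..(d.tauUp x t), d.rhoB η * d.uB η ^ 2) /
      ∫ η in (d.tauLow x t)..(d.tauUp x t), d.rhoB η * d.uB η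
  else if d.yUp x t = 0 ∧ d.tauUp x t = 0 then x / t
  else ((∫ η in (0 : ℝ)..(d.tauUp x t), d.rhoB η * d.uB η ^ 2) +
        ∫ η in (0 : ℝ)..(d.yUp x t), d.rho0 η * d.u0 η) /
      ((∫ η in (0 : ℝ)..(d.tauUp x t), d.rhoB η * d.uB η) +
        ∫ η in (0 : ℝ)..(d.yUp x t), d.rho0 η)

open Classical in
/-- The mass potential `m(x, t)` for `x ≥ 0`, `t > 0`. -/
def mass (x t : ℝ) : ℝ :=
  if d.minF x t ≤ d.minG x t ∧ 0 < x then ∫ η in (0 : ℝ)..(d.yLow x t), d.rho0 η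
  else -∫ η in (0 : ℝ)..(d.tauLow x t), d.rhoB η * d.uB η

/-- The generalized characteristic `X(η, t)`, `t > 0`, that starts at the point `(η, 0)` of the
`x`-axis. -/
def charX (η t : ℝ) : ℝ := sInf {x | 0 < x ∧ d.minF x t ≤ d.minG x t ∧ η < d.yLow x t}

/-- The generalized characteristic `Y(η, t)`, `t > 0`, that starts at the point `(0, η)` of the
`t`-axis; it is `0` when the set is empty, which is the convention `sSup ∅ = 0`. -/
def charY (η t : ℝ) : ℝ := sSup {x | 0 ≤ x ∧ d.minG x t ≤ d.minF x t ∧ η < d.tauLow x t}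

open Classical in
/-- The momentum potential `q(x, t)` for `x, t > 0`. -/
def momentum (x t : ℝ) : ℝ :=
  if d.minF x t ≤ d.minG x t then ∫ η in (0 : ℝ)..(d.yLow x t), d.rho0 η * d.u0 η
  else -∫ η in (0 : ℝ)..(d.tauLow x t), d.rhoB η * d.uB η ^ 2

open Classical in
/-- The energy potential `E(x, t)` for `x, t > 0`. -/
def energy (x t : ℝ) : ℝ :=
  if d.minF x t ≤ d.minG x t then
    (1 / 2) * ∫ η in (0 : ℝ)..(d.yLow x t), d.rho0 η * d.u0 η * d.velocity (d.charX η t) t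
  else
    -((1 / 2) * ∫ η in (0 : ℝ)..(d.tauLow x t),
      d.rhoB η * d.uB η ^ 2 * d.velocity (d.charY η t) t)

end GasData

end PressurelessGas

end

/-! ### Both data as one line of particles; the common potential and its minimizers. -/

noncomputable section

namespace PressurelessGas

open scoped Topology

/-! The two kinds of data merge into one. A particle emitted from the boundary at time `τ` gets the
label `s = -τ`, the velocity `u_b(τ)` and the label density `ρ_b u_b`, the mass entering per unit
time. Its free flight is `(t + s) * vel s`, whereas an initial particle flies along `t * vel s + s`.
If `μ` denotes the mass measure on labels, then `F` and `G` are the restrictions to the two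
half-lines of `pot σ x t = ∫_0^σ (free position - x) dμ`. Comparing `F` with `G` only decides on
which half-line the global minimizers lie, and `u`, `m`, `q` become single expressions in global
minimizers (`velocity_eq`, `mass_eq`, `momentum_eq`).

Comparing minimality at two points shows that minimizers increase along space-like directions
(`argmin_mono`). Hence the region where the selected minimizer exceeds `s` is, up to its boundary,
the right side of a curve `t ↦ char s t`, Lipschitz in `t` and monotone in `s`. Two facts about
these curves carry the proof.

(i) While positive, `char s` has slope `u(char s t, t)` for almost every `t` (`ae_deriv_char`). At a
point with one minimizer the slope is squeezed between velocities of rays. At a shock all labels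
strictly between the extreme minimizers share one slope `c`; one-sided minimality forces `mom - c *
mass` to agree at the two extremes, so `c` is the mean velocity.

(ii) At fixed `t`, `u(char s t, t)` is the conditional mean of `vel` given `char s t`
(`integral_vel_sub_u`). On a shock this is the definition of `u`; elsewhere the first-order
condition says that the free flight ends at the given point (`ae_vel_eq_ray`).

The measure `dm` is the push-forward of `μ` under `s ↦ char s t`, restricted to positive positions.
Up to a constant, a primitive at the selected minimizer is `∫ 1_{s < sel} w dμ`, so Fubini reduces
the weak identities to single curves: a space derivative leaves `-φ` on the curve, a time derivative
leaves `φ * char'` (`integral_pdt_right`), and `char' = u` by (i). The mass equation then holds by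
(ii), and the momentum equation with flux `u * vel` holds identically. Since `u(char s t, t)`
depends on position only, (ii) also turns `u * vel` into `u²`, which yields the densities of `q` and
`E` and the momentum equation in terms of `dm`. -/

/-- Both data on one line: positive points are initial positions, negative points are boundary
times with reversed sign. -/
structure LineGas where
  dens : ℝ → ℝ
  vel : ℝ → ℝ
  speed : ℝ
  measurable_dens : Measurable dens
  measurable_vel : Measurable vel
  dens_pos : ∀ s, 0 < dens s
  dens_loc : LocallyIntegrable dens volume
  abs_vel_le : ∀ s, |vel s| ≤ speed
  vel_pos : ∀ s, s ≤ 0 → 0 < vel s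

namespace LineGas

variable (g : LineGas)

/-- The mass measure of the particles. -/
def mu : Measure ℝ := volume.withDensity fun s => ((g.dens s).toNNReal : ENNReal)

/-- The primitive of `w` with respect to the mass measure. -/
def prim (w : ℝ → ℝ) (σ : ℝ) : ℝ := ∫ s in (0 : ℝ)..σ, w s ∂g.mu

/-- The offset in the free flight `t * vel s + offset s` of the particle `s`. -/
def offset (s : ℝ) : ℝ := if 0 < s then s else s * g.vel s

/-- The position at time `t` of the free particle `s` relative to `x`. -/
def kern (x t s : ℝ) : ℝ := t * g.vel s + g.offset s - x

/-- The common potential. -/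
def pot (σ x t : ℝ) : ℝ := g.prim (g.kern x t) σ

/-- The minimizers of the potential over `C`. -/
def argmin (C : Set ℝ) (x t : ℝ) : Set ℝ := {σ | σ ∈ C ∧ ∀ z ∈ C, g.pot σ x t ≤ g.pot z x t}

lemma speed_pos : 0 < g.speed :=
  (g.vel_pos 0 le_rfl).trans_le ((le_abs_self _).trans (g.abs_vel_le 0))

lemma vel_le (s : ℝ) : g.vel s ≤ g.speed := (le_abs_self _).trans (g.abs_vel_le s)

lemma measurable_toNNReal : Measurable fun s => (g.dens s).toNNReal :=
  g.measurable_dens.real_toNNReal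

instance : SigmaFinite g.mu := by
  unfold mu
  exact SigmaFinite.withDensity _

instance : NullSingletonClass g.mu := by
  unfold mu
  infer_instance

lemma mu_ac : g.mu ≪ volume := withDensity_absolutelyContinuous _ _

/-- Positivity of the density at every label makes nonempty open intervals have positive mass; all
strict monotonicity below rests on this. -/
lemma ac_mu : volume ≪ g.mu := by
  refine withDensity_absolutelyContinuous' (g.measurable_toNNReal.coe_nnreal_ennreal).aemeasurable
    (Eventually.of_forall fun s => ?_)
  have := g.dens_pos s
  simpa using this

lemma integral_mu (w : ℝ → ℝ) (A : Set ℝ) (hA : MeasurableSet A) :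
    ∫ s in A, w s ∂g.mu = ∫ s in A, g.dens s * w s := by
  unfold mu
  rw [setIntegral_withDensity_eq_setIntegral_smul g.measurable_toNNReal _ hA]
  refine integral_congr_ae (Eventually.of_forall fun s => ?_)
  simp only [NNReal.smul_def, Real.coe_toNNReal _ (g.dens_pos s).le, smul_eq_mul]

lemma intervalIntegral_mu (w : ℝ → ℝ) (a b : ℝ) :
    ∫ s in a..b, w s ∂g.mu = ∫ s in a..b, g.dens s * w s := by
  simp only [intervalIntegral, g.integral_mu _ _ measurableSet_Ioc]

instance : IsLocallyFiniteMeasure g.mu := by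
  refine ⟨fun x => ?_⟩
  refine ⟨Icc (x - 1) (x + 1), Icc_mem_nhds (by linarith) (by linarith), ?_⟩
  unfold mu
  rw [withDensity_apply _ measurableSet_Icc]
  have h := (g.dens_loc.integrableOn_isCompact (isCompact_Icc (a := x - 1) (b := x + 1)))
  refine lt_of_le_of_lt (lintegral_mono fun s => ?_) h.2
  simp [enorm, Real.toNNReal_le_iff_le_coe, le_abs_self]

lemma intervalIntegrable_of_bound {w : ℝ → ℝ} (hw : Measurable w) {a b C : ℝ}
    (h : ∀ s ∈ uIcc a b, |w s| ≤ C) : IntervalIntegrable w g.mu a b := by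
  rw [intervalIntegrable_iff]
  refine Measure.integrableOn_of_bounded (M := C) ?_ hw.aestronglyMeasurable ?_
  · exact ((measure_mono uIoc_subset_uIcc).trans_lt (isCompact_uIcc.measure_lt_top)).ne
  · refine (ae_restrict_iff' measurableSet_uIoc).2 (Eventually.of_forall fun s hs => ?_)
    exact h s (uIoc_subset_uIcc hs)

lemma intervalIntegrable_bdd {w : ℝ → ℝ} (hw : Measurable w) {C : ℝ} (h : ∀ s, |w s| ≤ C)
    (a b : ℝ) : IntervalIntegrable w g.mu a b :=
  g.intervalIntegrable_of_bound hw fun s _ => h s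

lemma intervalIntegrable_vel (a b : ℝ) : IntervalIntegrable g.vel g.mu a b :=
  g.intervalIntegrable_bdd g.measurable_vel g.abs_vel_le a b

lemma measurable_offset : Measurable g.offset :=
  Measurable.ite measurableSet_Ioi measurable_id (measurable_id.mul g.measurable_vel)

lemma abs_offset_le (s : ℝ) : |g.offset s| ≤ (1 + g.speed) * |s| := by
  have h := g.speed_pos
  unfold offset
  split_ifs
  · nlinarith [abs_nonneg s]
  · rw [abs_mul]
    nlinarith [abs_nonneg s, g.abs_vel_le s]

lemma intervalIntegrable_offset (a b : ℝ) : IntervalIntegrable g.offset g.mu a b := by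
  refine g.intervalIntegrable_of_bound g.measurable_offset
    (C := (1 + g.speed) * max |a| |b|) fun s hs => (g.abs_offset_le s).trans ?_
  have h := g.speed_pos
  gcongr
  rw [mem_uIcc] at hs
  rcases hs with hs | hs
  · exact abs_le_max_abs_abs hs.1 hs.2
  · rw [max_comm]; exact abs_le_max_abs_abs hs.1 hs.2

lemma intervalIntegrable_const (c a b : ℝ) : IntervalIntegrable (fun _ => c) g.mu a b :=
  g.intervalIntegrable_bdd measurable_const (C := |c|) (fun _ => le_rfl) a b

lemma intervalIntegrable_kern (x t a b : ℝ) : IntervalIntegrable (g.kern x t) g.mu a b :=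
  (((g.intervalIntegrable_vel a b).const_mul t).add (g.intervalIntegrable_offset a b)).sub
    (g.intervalIntegrable_const x a b)

lemma prim_sub {w : ℝ → ℝ} (hw : ∀ a b, IntervalIntegrable w g.mu a b) (a b : ℝ) :
    g.prim w b - g.prim w a = ∫ s in a..b, w s ∂g.mu :=
  intervalIntegral.integral_interval_sub_left (hw 0 b) (hw 0 a)

lemma continuous_prim {w : ℝ → ℝ} (hw : ∀ a b, IntervalIntegrable w g.mu a b) :
    Continuous (g.prim w) := intervalIntegral.continuous_primitive hw 0

/-- The mass coordinate. -/
def mass (σ : ℝ) : ℝ := g.prim (fun _ => 1) σ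

/-- The momentum coordinate. -/
def mom (σ : ℝ) : ℝ := g.prim g.vel σ

lemma pot_sub (a b x t : ℝ) : g.pot b x t - g.pot a x t = ∫ s in a..b, g.kern x t s ∂g.mu :=
  g.prim_sub (g.intervalIntegrable_kern x t) a b

lemma pot_eq (σ x t : ℝ) : g.pot σ x t = t * g.mom σ + g.prim g.offset σ - x * g.mass σ := by
  unfold pot mom mass prim kern
  rw [intervalIntegral.integral_sub (((g.intervalIntegrable_vel 0 σ).const_mul t).add
    (g.intervalIntegrable_offset 0 σ)) (g.intervalIntegrable_const x 0 σ),
    intervalIntegral.integral_add ((g.intervalIntegrable_vel 0 σ).const_mul t)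
    (g.intervalIntegrable_offset 0 σ), intervalIntegral.integral_const_mul]
  have : ∫ s in (0 : ℝ)..σ, x ∂g.mu = x * ∫ s in (0 : ℝ)..σ, 1 ∂g.mu := by
    rw [← intervalIntegral.integral_const_mul]; simp
  rw [this]

lemma continuous_mass : Continuous g.mass := g.continuous_prim (g.intervalIntegrable_const 1)

lemma continuous_mom : Continuous g.mom := g.continuous_prim g.intervalIntegrable_vel

lemma continuous_pot : Continuous fun p : ℝ × ℝ × ℝ => g.pot p.1 p.2.1 p.2.2 := by
  simp only [pot_eq]
  have h1 := g.continuous_mass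
  have h2 := g.continuous_mom
  have h3 := g.continuous_prim g.intervalIntegrable_offset
  fun_prop

lemma integral_pos {w : ℝ → ℝ} {a b : ℝ} (hab : a < b) (hw : IntervalIntegrable w g.mu a b)
    (h : ∀ s ∈ Ioo a b, 0 < w s) : 0 < ∫ s in a..b, w s ∂g.mu := by
  rw [intervalIntegral.integral_of_le hab.le, integral_Ioc_eq_integral_Ioo,
    setIntegral_pos_iff_support_of_nonneg_ae]
  · have : support w ∩ Ioo a b = Ioo a b := inter_eq_right.2 fun s hs => (h s hs).ne'
    rw [this]
    refine pos_iff_ne_zero.2 fun h0 => ?_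
    have := g.ac_mu h0
    simp at this
    linarith
  · exact (ae_restrict_iff' measurableSet_Ioo).2 (Eventually.of_forall fun s hs => (h s hs).le)
  · exact ((intervalIntegrable_iff_integrableOn_Ioc_of_le hab.le).1 hw).mono_set Ioo_subset_Ioc_self

lemma integral_neg {w : ℝ → ℝ} {a b : ℝ} (hab : a < b) (hw : IntervalIntegrable w g.mu a b)
    (h : ∀ s ∈ Ioo a b, w s < 0) : ∫ s in a..b, w s ∂g.mu < 0 := by
  have := g.integral_pos hab hw.neg (fun s hs => neg_pos.2 (h s hs))
  simp only [Pi.neg_apply, intervalIntegral.integral_neg] at this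
  linarith

lemma mass_sub (a b : ℝ) : g.mass b - g.mass a = ∫ _ in a..b, (1 : ℝ) ∂g.mu :=
  g.prim_sub (g.intervalIntegrable_const 1) a b

lemma mom_sub (a b : ℝ) : g.mom b - g.mom a = ∫ s in a..b, g.vel s ∂g.mu :=
  g.prim_sub g.intervalIntegrable_vel a b

lemma strictMono_mass : StrictMono g.mass := fun a b hab => by
  have := g.integral_pos hab (g.intervalIntegrable_const 1 a b) (fun _ _ => one_pos)
  rw [← g.mass_sub] at this
  linarith

/-! ### Minimizers -/

/-- A particle starting this far to the right cannot have come back to `x` within time `|t|`, so the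
potential increases there. -/
lemma kern_pos {x t s : ℝ} (hx : 0 ≤ x) (h : x + g.speed * |t| < s) : 0 < g.kern x t s := by
  have h1 : 0 < s := lt_of_le_of_lt (by have := g.speed_pos; positivity) h
  simp only [kern, offset, h1, if_true]
  have : |t * g.vel s| ≤ g.speed * |t| := by
    rw [abs_mul, mul_comm]; gcongr; exact g.abs_vel_le s
  linarith [(abs_le.1 this).1]

/-- Here `t + s < 0`: the boundary particle has not been emitted yet and its extrapolated flight is
at a negative position. -/
lemma kern_neg {x t s : ℝ} (hx : 0 ≤ x) (h : s < -|t|) : g.kern x t s < 0 := by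
  have h1 : s < 0 := h.trans_le (by simp)
  simp only [kern, offset, h1.not_gt, if_false]
  have h2 := g.vel_pos s h1.le
  have h3 : t + s < 0 := by linarith [le_abs_self t]
  nlinarith

/-- The potential is strictly monotone beyond both cutoffs. The set `C` is kept general so as to
cover the whole line and both half-lines; order-connectedness keeps the cutoffs inside `C` when
compared with a minimizer. -/
lemma argmin_bound {C : Set ℝ} (hC : C.OrdConnected) (h0 : 0 ∈ C) {x t σ : ℝ} (hx : 0 ≤ x)
    (hσ : σ ∈ g.argmin C x t) : -|t| ≤ σ ∧ σ ≤ x + g.speed * |t| := by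
  have hR : 0 ≤ x + g.speed * |t| := by have := g.speed_pos; positivity
  constructor
  · by_contra! h
    have h1 := hσ.2 (-|t|) (hC.out hσ.1 h0 ⟨h.le, by simp⟩)
    have h2 := g.integral_neg h (g.intervalIntegrable_kern x t _ _)
      (fun s hs => g.kern_neg hx hs.2)
    rw [← g.pot_sub] at h2
    linarith
  · by_contra! h
    have h1 := hσ.2 (x + g.speed * |t|) (hC.out h0 hσ.1 ⟨hR, h.le⟩)
    have h2 := g.integral_pos h (g.intervalIntegrable_kern x t _ _)
      (fun s hs => g.kern_pos hx hs.1)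
    rw [← g.pot_sub] at h2
    linarith

lemma argmin_nonempty {C : Set ℝ} (hC : C.OrdConnected) (hCc : IsClosed C) (h0 : 0 ∈ C)
    {x t : ℝ} (hx : 0 ≤ x) : (g.argmin C x t).Nonempty := by
  have hR : 0 ≤ x + g.speed * |t| := by have := g.speed_pos; positivity
  have hcont : Continuous fun σ => g.pot σ x t :=
    g.continuous_pot.comp (continuous_id.prodMk (continuous_const (y := (x, t))))
  obtain ⟨σ, hσ, hmin⟩ := ((isCompact_Icc (a := -|t|) (b := x + g.speed * |t|)).inter_right
    hCc).exists_isMinOn ⟨0, ⟨by simp, hR⟩, h0⟩ hcont.continuousOn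
  refine ⟨σ, hσ.2, fun z hz => ?_⟩
  rcases lt_or_ge z (-|t|) with h | h
  · refine (hmin ⟨⟨le_rfl, by linarith [abs_nonneg t]⟩,
      hC.out hz h0 ⟨h.le, by simp⟩⟩).trans ?_
    have h2 := g.integral_neg h (g.intervalIntegrable_kern x t _ _)
      (fun s hs => g.kern_neg hx hs.2)
    rw [← g.pot_sub] at h2
    linarith
  rcases lt_or_ge (x + g.speed * |t|) z with h' | h'
  · refine (hmin ⟨⟨by linarith [abs_nonneg t], le_rfl⟩, hC.out h0 hz ⟨hR, h'.le⟩⟩).trans ?_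
    have h2 := g.integral_pos h' (g.intervalIntegrable_kern x t _ _)
      (fun s hs => g.kern_pos hx hs.1)
    rw [← g.pot_sub] at h2
    linarith
  · exact hmin ⟨⟨h, h'⟩, hz⟩

/-- The graph of the minimizers is closed. -/
lemma argmin_of_tendsto {C : Set ℝ} (hCc : IsClosed C) {ι : Type*} {l : Filter ι} [l.NeBot]
    {xs ts σs : ι → ℝ} {x t σ : ℝ} (hx : Tendsto xs l (𝓝 x)) (ht : Tendsto ts l (𝓝 t))
    (hσ : Tendsto σs l (𝓝 σ)) (h : ∀ᶠ i in l, σs i ∈ g.argmin C (xs i) (ts i)) :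
    σ ∈ g.argmin C x t := by
  refine ⟨hCc.mem_of_tendsto hσ (h.mono fun i hi => hi.1), fun z hz => ?_⟩
  refine le_of_tendsto_of_tendsto
    ((g.continuous_pot.tendsto (σ, x, t)).comp (hσ.prodMk_nhds (hx.prodMk_nhds ht)))
    ((g.continuous_pot.tendsto (z, x, t)).comp
      (tendsto_const_nhds.prodMk_nhds (hx.prodMk_nhds ht))) (h.mono fun i hi => hi.2 z hz)

/-- Minimizers along a convergent sequence subconverge to a minimizer. -/
lemma exists_subseq_argmin {C : Set ℝ} (hC : C.OrdConnected) (hCc : IsClosed C) (h0 : 0 ∈ C)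
    {xs ts σs : ℕ → ℝ} {x t : ℝ} (hx : Tendsto xs atTop (𝓝 x)) (ht : Tendsto ts atTop (𝓝 t))
    (hx0 : ∀ n, 0 ≤ xs n) (h : ∀ n, σs n ∈ g.argmin C (xs n) (ts n)) :
    ∃ σ ∈ g.argmin C x t, ∃ k : ℕ → ℕ, StrictMono k ∧ Tendsto (σs ∘ k) atTop (𝓝 σ) := by
  obtain ⟨R, hR⟩ := (hx.add ((ht.abs).const_mul g.speed)).bddAbove_range
  obtain ⟨T, hT⟩ := ht.abs.bddAbove_range
  have hmem : ∀ n, σs n ∈ Icc (-T) R := fun n => by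
    have h1 := g.argmin_bound hC h0 (hx0 n) (h n)
    have h2 := hR (mem_range_self n)
    have h3 := hT (mem_range_self n)
    exact ⟨by linarith, by linarith⟩
  obtain ⟨σ, -, k, hk, hlim⟩ := isCompact_Icc.tendsto_subseq hmem
  exact ⟨σ, g.argmin_of_tendsto hCc (hx.comp hk.tendsto_atTop) (ht.comp hk.tendsto_atTop) hlim
    (Eventually.of_forall fun n => h (k n)), k, hk, hlim⟩

lemma isCompact_argmin {C : Set ℝ} (hC : C.OrdConnected) (hCc : IsClosed C) (h0 : 0 ∈ C)
    {x t : ℝ} (hx : 0 ≤ x) : IsCompact (g.argmin C x t) := by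
  refine isCompact_Icc.of_isClosed_subset ?_
    (fun σ hσ => mem_Icc.2 (g.argmin_bound hC h0 hx hσ))
  refine IsSeqClosed.isClosed fun σs σ h hlim => ?_
  exact g.argmin_of_tendsto hCc tendsto_const_nhds tendsto_const_nhds hlim
    (Eventually.of_forall h)

/-- Closedness by compactness of minimizers. With `D` a closed half-line this is a level set of the
extreme minimizers, which makes them Borel functions of the point. -/
lemma isClosed_exists_le {C : Set ℝ} (hC : C.OrdConnected) (hCc : IsClosed C) (h0 : 0 ∈ C)
    {D : Set ℝ} (hD : IsClosed D) :
    IsClosed {p : ℝ × ℝ | 0 ≤ p.1 ∧ ∃ σ ∈ g.argmin C p.1 p.2, σ ∈ D} := by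
  refine IsSeqClosed.isClosed fun ps p h hlim => ?_
  choose h1 σs h2 h3 using h
  have hx := (continuous_fst.tendsto p).comp hlim
  have ht := (continuous_snd.tendsto p).comp hlim
  obtain ⟨σ, hσ, k, hk, hlim'⟩ := g.exists_subseq_argmin hC hCc h0 hx ht h1 h2
  exact ⟨ge_of_tendsto' hx h1, σ, hσ, hD.mem_of_tendsto hlim'
    (Eventually.of_forall fun n => h3 (k n))⟩

lemma sInf_argmin_mem {C : Set ℝ} (hC : C.OrdConnected) (hCc : IsClosed C) (h0 : 0 ∈ C)
    {x t : ℝ} (hx : 0 ≤ x) : sInf (g.argmin C x t) ∈ g.argmin C x t :=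
  (g.isCompact_argmin hC hCc h0 hx).sInf_mem (g.argmin_nonempty hC hCc h0 hx)

lemma sSup_argmin_mem {C : Set ℝ} (hC : C.OrdConnected) (hCc : IsClosed C) (h0 : 0 ∈ C)
    {x t : ℝ} (hx : 0 ≤ x) : sSup (g.argmin C x t) ∈ g.argmin C x t :=
  (g.isCompact_argmin hC hCc h0 hx).sSup_mem (g.argmin_nonempty hC hCc h0 hx)

lemma measurable_sInf_argmin {C : Set ℝ} (hC : C.OrdConnected) (hCc : IsClosed C) (h0 : 0 ∈ C) :
    Measurable fun p : ℝ × ℝ => if 0 ≤ p.1 then sInf (g.argmin C p.1 p.2) else 0 := by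
  have hS : MeasurableSet {p : ℝ × ℝ | 0 ≤ p.1} :=
    (isClosed_le continuous_const continuous_fst).measurableSet
  refine measurable_of_Iic fun c => ?_
  have h := (g.isClosed_exists_le hC hCc h0 (isClosed_Iic (a := c))).measurableSet
  have : (fun p : ℝ × ℝ => if 0 ≤ p.1 then sInf (g.argmin C p.1 p.2) else 0) ⁻¹' Iic c =
      {p : ℝ × ℝ | 0 ≤ p.1 ∧ ∃ σ ∈ g.argmin C p.1 p.2, σ ∈ Iic c} ∪
        ({p : ℝ × ℝ | 0 ≤ p.1}ᶜ ∩ {_p | 0 ≤ c}) := by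
    ext p
    by_cases hp : 0 ≤ p.1
    · simp only [mem_preimage, hp, if_true, mem_Iic, mem_union, mem_ofPred_eq, true_and,
        mem_inter_iff, mem_compl_iff, not_true, false_and, or_false]
      exact ⟨fun h => ⟨_, g.sInf_argmin_mem hC hCc h0 hp, h⟩, fun ⟨σ, hσ, hc⟩ =>
        (csInf_le (g.isCompact_argmin hC hCc h0 hp).bddBelow hσ).trans hc⟩
    · simp [hp]
  rw [this]
  exact h.union (hS.compl.inter (MeasurableSet.const _))

lemma measurable_sSup_argmin {C : Set ℝ} (hC : C.OrdConnected) (hCc : IsClosed C) (h0 : 0 ∈ C) :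
    Measurable fun p : ℝ × ℝ => if 0 ≤ p.1 then sSup (g.argmin C p.1 p.2) else 0 := by
  have hS : MeasurableSet {p : ℝ × ℝ | 0 ≤ p.1} :=
    (isClosed_le continuous_const continuous_fst).measurableSet
  refine measurable_of_Ici fun c => ?_
  have h := (g.isClosed_exists_le hC hCc h0 (isClosed_Ici (a := c))).measurableSet
  have : (fun p : ℝ × ℝ => if 0 ≤ p.1 then sSup (g.argmin C p.1 p.2) else 0) ⁻¹' Ici c =
      {p : ℝ × ℝ | 0 ≤ p.1 ∧ ∃ σ ∈ g.argmin C p.1 p.2, σ ∈ Ici c} ∪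
        ({p : ℝ × ℝ | 0 ≤ p.1}ᶜ ∩ {_p | c ≤ 0}) := by
    ext p
    by_cases hp : 0 ≤ p.1
    · simp only [mem_preimage, hp, if_true, mem_Ici, mem_union, mem_ofPred_eq, true_and,
        mem_inter_iff, mem_compl_iff, not_true, false_and, or_false]
      exact ⟨fun h => ⟨_, g.sSup_argmin_mem hC hCc h0 hp, h⟩, fun ⟨σ, hσ, hc⟩ =>
        hc.trans (le_csSup (g.isCompact_argmin hC hCc h0 hp).bddAbove hσ)⟩
    · simp [hp]
  rw [this]
  exact h.union (hS.compl.inter (MeasurableSet.const _))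

end LineGas

end PressurelessGas

end

/-! ### Finite speed of propagation and generalized characteristics. -/

noncomputable section

namespace PressurelessGas

open scoped Topology

namespace LineGas

variable (g : LineGas)

/-- The leftmost global minimizer. -/
def lo (x t : ℝ) : ℝ := sInf (g.argmin univ x t)

/-- The rightmost global minimizer. -/
def hi (x t : ℝ) : ℝ := sSup (g.argmin univ x t)

/-- The velocity of the straight ray from the source of `s` to the point `(x, t)`. -/
def ray (x t s : ℝ) : ℝ := if 0 ≤ s then (x - s) / t else x / (t + s)

/-- The velocity of the gas in terms of the global minimizers. -/
def velo (x t : ℝ) : ℝ :=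
  if g.lo x t < g.hi x t then
    (g.mom (g.hi x t) - g.mom (g.lo x t)) / (g.mass (g.hi x t) - g.mass (g.lo x t))
  else ray x t (g.lo x t)

lemma lo_mem {x t : ℝ} (hx : 0 ≤ x) : g.lo x t ∈ g.argmin univ x t :=
  g.sInf_argmin_mem ordConnected_univ isClosed_univ trivial hx

lemma hi_mem {x t : ℝ} (hx : 0 ≤ x) : g.hi x t ∈ g.argmin univ x t :=
  g.sSup_argmin_mem ordConnected_univ isClosed_univ trivial hx

lemma lo_le {x t σ : ℝ} (hx : 0 ≤ x) (h : σ ∈ g.argmin univ x t) : g.lo x t ≤ σ :=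
  csInf_le (g.isCompact_argmin ordConnected_univ isClosed_univ trivial hx).bddBelow h

lemma le_hi {x t σ : ℝ} (hx : 0 ≤ x) (h : σ ∈ g.argmin univ x t) : σ ≤ g.hi x t :=
  le_csSup (g.isCompact_argmin ordConnected_univ isClosed_univ trivial hx).bddAbove h

lemma lo_le_hi {x t : ℝ} (hx : 0 ≤ x) : g.lo x t ≤ g.hi x t := g.lo_le hx (g.hi_mem hx)

/-- Minimizers move to the right along space-like directions. -/
lemma argmin_mono {x t x' t' σ σ' : ℝ} (hσ : σ ∈ g.argmin univ x t)
    (hσ' : σ' ∈ g.argmin univ x' t') (h : g.speed * |t' - t| < x' - x) : σ ≤ σ' := by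
  by_contra! hlt
  have h1 := hσ.2 σ' trivial
  have h2 := hσ'.2 σ trivial
  simp only [pot_eq] at h1 h2
  -- The sum of the two minimality inequalities makes this integral nonnegative, while the
  -- space-like condition makes its integrand negative.
  have h3 : ∫ s in σ'..σ, ((t' - t) * g.vel s - (x' - x) * 1) ∂g.mu < 0 := by
    refine g.integral_neg hlt (((g.intervalIntegrable_vel _ _).const_mul _).sub
      ((g.intervalIntegrable_const 1 _ _).const_mul _)) fun s _ => ?_
    have : |(t' - t) * g.vel s| ≤ g.speed * |t' - t| := by
      rw [abs_mul, mul_comm]; gcongr; exact g.abs_vel_le s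
    linarith [le_abs_self ((t' - t) * g.vel s)]
  rw [intervalIntegral.integral_sub ((g.intervalIntegrable_vel _ _).const_mul _)
      ((g.intervalIntegrable_const 1 _ _).const_mul _), intervalIntegral.integral_const_mul,
      intervalIntegral.integral_const_mul, ← g.mass_sub, ← g.mom_sub] at h3
  linarith

lemma argmin_mono_left {x t x' σ σ' : ℝ} (hσ : σ ∈ g.argmin univ x t)
    (hσ' : σ' ∈ g.argmin univ x' t) (h : x < x') : σ ≤ σ' :=
  g.argmin_mono hσ hσ' (by simpa using h)

/-- Every free flight from a label below the cutoff ends to the left of `x`, so the potential still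
decreases there. -/
lemma sub_le_argmin {x t σ : ℝ} (hx : 0 ≤ x - g.speed * |t|) (hσ : σ ∈ g.argmin univ x t) :
    x - g.speed * |t| ≤ σ := by
  by_contra! h
  have h2 := g.integral_neg h (g.intervalIntegrable_kern x t _ _) (fun s hs => by
    have h1 : |t * g.vel s| ≤ g.speed * |t| := by
      rw [abs_mul, mul_comm]; gcongr; exact g.abs_vel_le s
    have h3 := le_abs_self (t * g.vel s)
    have h4 := hs.2
    simp only [kern, offset]
    split_ifs with h0
    · linarith
    · have := g.vel_pos s (not_lt.1 h0)
      rcases (not_lt.1 h0).lt_or_eq with h5 | h5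
      · nlinarith
      · subst h5; nlinarith)
  rw [← g.pot_sub] at h2
  linarith [hσ.2 (x - g.speed * |t|) trivial]

lemma argmin_le_add {x t σ : ℝ} (hx : 0 ≤ x) (hσ : σ ∈ g.argmin univ x t) :
    σ ≤ x + g.speed * |t| := (g.argmin_bound ordConnected_univ trivial hx hσ).2

/-- A boundary particle has travelled at most `speed * (t + σ)`. If that fell short of `x`, it would
also fall short for labels slightly larger than `σ`, and the potential would decrease to the right
of `σ`. -/
lemma le_speed_mul {x t σ : ℝ} (hx : 0 < x) (hσ : σ ∈ g.argmin univ x t) (h0 : σ < 0) :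
    x ≤ g.speed * (t + σ) := by
  by_contra! h
  have hL := g.speed_pos
  -- The cutoff is the right end of the boundary labels that cannot reach `x` by time `t`.
  have he : σ < min 0 (x / g.speed - t) := lt_min h0 (by
    rw [lt_sub_iff_add_lt, lt_div_iff₀ hL]; linarith)
  have h2 := g.integral_neg he (g.intervalIntegrable_kern x t _ _) (fun s hs => by
    obtain ⟨h3, h4⟩ := lt_min_iff.1 hs.2
    rw [lt_sub_iff_add_lt, lt_div_iff₀ hL] at h4
    simp only [kern, offset, h3.not_gt, if_false]
    have h5 := g.vel_pos s h3.le
    have h6 := g.vel_le s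
    rcases le_or_gt 0 (t + s) with h7 | h7 <;> nlinarith)
  rw [← g.pot_sub] at h2
  linarith [hσ.2 (min 0 (x / g.speed - t)) trivial]

lemma add_pos_of_argmin {x t σ : ℝ} (hx : 0 < x) (ht : 0 < t) (hσ : σ ∈ g.argmin univ x t) :
    0 < t + σ := by
  rcases lt_or_ge σ 0 with h | h
  · have := g.le_speed_mul hx hσ h
    have hL := g.speed_pos
    by_contra! h'
    nlinarith
  · linarith

lemma abs_ray_le {x t σ : ℝ} (hx : 0 < x) (ht : 0 < t) (hσ : σ ∈ g.argmin univ x t) :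
    |ray x t σ| ≤ g.speed := by
  have hL := g.speed_pos
  unfold ray
  split_ifs with h
  · rw [abs_div, abs_of_pos ht, div_le_iff₀ ht, abs_le]
    have h1 := g.argmin_le_add hx.le hσ
    rw [abs_of_pos ht] at h1
    refine ⟨by linarith, ?_⟩
    by_contra! h2
    have h3 := g.sub_le_argmin (by rw [abs_of_pos ht]; linarith) hσ
    rw [abs_of_pos ht] at h3
    linarith
  · have h1 := g.add_pos_of_argmin hx ht hσ
    rw [abs_of_pos (by positivity), div_le_iff₀ h1]
    exact g.le_speed_mul hx hσ (not_le.1 h)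

lemma abs_mom_sub_le {a b : ℝ} (hab : a ≤ b) :
    |g.mom b - g.mom a| ≤ g.speed * (g.mass b - g.mass a) := by
  rw [mass_sub, mom_sub, ← intervalIntegral.integral_const_mul]
  refine (intervalIntegral.abs_integral_le_integral_abs hab).trans ?_
  refine intervalIntegral.integral_mono_on hab (g.intervalIntegrable_vel a b).abs
    ((g.intervalIntegrable_const 1 a b).const_mul _) fun s _ => ?_
  simpa using g.abs_vel_le s

lemma abs_slope_le {a b : ℝ} (hab : a ≤ b) :
    |(g.mom b - g.mom a) / (g.mass b - g.mass a)| ≤ g.speed := by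
  rcases hab.lt_or_eq with h | rfl
  · have := sub_pos.2 (g.strictMono_mass h)
    rw [abs_div, abs_of_pos this, div_le_iff₀ this]
    exact g.abs_mom_sub_le hab
  · simpa using g.speed_pos.le

lemma abs_velo_le {x t : ℝ} (hx : 0 < x) (ht : 0 < t) : |g.velo x t| ≤ g.speed := by
  unfold velo
  split_ifs with h
  · exact g.abs_slope_le h.le
  · exact g.abs_ray_le hx ht (g.lo_mem hx.le)

end LineGas

/-- A gas on the line with a measurable selection of minimizers and a bounded Borel velocity that
is the prescribed one in the open quadrant. -/
structure Flow extends LineGas where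
  sel : ℝ → ℝ → ℝ
  sel_mem : ∀ x t, 0 < x → sel x t ∈ toLineGas.argmin univ x t
  measurable_sel : Measurable (uncurry sel)
  u : ℝ → ℝ → ℝ
  measurable_u : Measurable (uncurry u)
  abs_u_le : ∀ x t, |u x t| ≤ speed
  u_eq : ∀ x t, 0 < x → 0 < t → u x t = toLineGas.velo x t

namespace Flow

variable (g : Flow)

/-- The generalized characteristics. -/
def char (s t : ℝ) : ℝ := sInf {x | 0 < x ∧ s < g.sel x t}

lemma char_set_nonempty (s t : ℝ) : {x | 0 < x ∧ s < g.sel x t}.Nonempty := by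
  have hL := g.speed_pos
  have h1 : 0 ≤ g.speed * |t| := by positivity
  have h0 : 0 < |s| + 1 + g.speed * |t| := by positivity
  refine ⟨|s| + 1 + g.speed * |t|, h0, ?_⟩
  have := g.sub_le_argmin (x := |s| + 1 + g.speed * |t|) (t := t)
    (by simp; positivity) (g.sel_mem _ t h0)
  linarith [le_abs_self s]

lemma char_set_bddBelow (s t : ℝ) : BddBelow {x | 0 < x ∧ s < g.sel x t} :=
  ⟨0, fun _ hx => hx.1.le⟩

lemma char_nonneg (s t : ℝ) : 0 ≤ g.char s t := Real.sInf_nonneg fun _ hx => hx.1.le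

/-- With `le_of_lt_char`: the characteristic separates points all of whose minimizers exceed `s`
from points where none does. Monotonicity at fixed time passes from the selected minimizer to all
minimizers, so the curve does not depend on the selection. -/
lemma lt_of_char_lt {s t x σ : ℝ} (h : g.char s t < x) (hσ : σ ∈ g.argmin univ x t) : s < σ := by
  obtain ⟨y, ⟨hy, hs⟩, hyx⟩ := (csInf_lt_iff (g.char_set_bddBelow s t)
    (g.char_set_nonempty s t)).1 h
  exact hs.trans_le (g.argmin_mono_left (g.sel_mem y t hy) hσ hyx)

lemma le_of_lt_char {s t x σ : ℝ} (hx : 0 ≤ x) (h : x < g.char s t)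
    (hσ : σ ∈ g.argmin univ x t) : σ ≤ s := by
  obtain ⟨y, hxy, hy⟩ := exists_between h
  have : y ∉ {x | 0 < x ∧ s < g.sel x t} := notMem_of_lt_csInf hy (g.char_set_bddBelow s t)
  have hy0 : 0 < y := hx.trans_lt hxy
  have h1 : g.sel y t ≤ s := not_lt.1 fun h => this ⟨hy0, h⟩
  exact (g.argmin_mono_left hσ (g.sel_mem y t hy0) hxy).trans h1

lemma char_mono (t : ℝ) : Monotone fun s => g.char s t := fun s s' h =>
  csInf_le_csInf (g.char_set_bddBelow s t) (g.char_set_nonempty s' t)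
    fun _ hx => ⟨hx.1, h.trans_lt hx.2⟩

/-- Step slightly to the right of the characteristic, then move space-like to time `t'`: minimizers
do not decrease, so they still exceed `s`. Half of `ε` pays for each of the two strict inequalities.
-/
lemma char_le_add (s t t' : ℝ) : g.char s t' ≤ g.char s t + g.speed * |t' - t| := by
  have hL := g.speed_pos
  refine le_of_forall_pos_le_add fun ε hε => ?_
  have h0 := g.char_nonneg s t
  have hx : 0 < g.char s t + ε / 2 := by positivity
  have h1 := g.lt_of_char_lt (by linarith : g.char s t < g.char s t + ε / 2) (g.sel_mem _ t hx)
  have hx' : 0 < g.char s t + g.speed * |t' - t| + ε := by positivity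
  refine csInf_le (g.char_set_bddBelow s t') ⟨hx', h1.trans_le ?_⟩
  exact g.argmin_mono (g.sel_mem _ t hx) (g.sel_mem _ t' hx') (by linarith)

lemma lipschitz_char (s : ℝ) : LipschitzWith (Real.toNNReal g.speed) (g.char s) := by
  refine LipschitzWith.of_dist_le_mul fun t t' => ?_
  rw [Real.coe_toNNReal _ g.speed_pos.le, Real.dist_eq, Real.dist_eq, abs_le]
  have h1 := g.char_le_add s t t'
  have h2 := g.char_le_add s t' t
  rw [abs_sub_comm] at h1
  exact ⟨by linarith, by linarith⟩

lemma continuous_char (s : ℝ) : Continuous (g.char s) := (g.lipschitz_char s).continuous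

/-- Joint measurability follows from continuity in time together with monotonicity in the label. -/
lemma measurable_char : Measurable fun p : ℝ × ℝ => g.char p.1 p.2 := by
  have : Measurable (uncurry fun t s => g.char s t) :=
    measurable_uncurry_of_continuous_of_measurable (u := fun t s => g.char s t)
      g.continuous_char fun t => (g.char_mono t).measurable
  exact this.comp measurable_swap

/-- The boundary case `a = char s t` is the point: minimizers at positions increasing to `a` are at
most `s` and subconverge to a minimizer at `a`. On the other side `le_hi_of_char_le` approaches from
the right. -/
lemma le_char_iff {a s t : ℝ} (ha : 0 < a) : a ≤ g.char s t ↔ g.lo a t ≤ s := by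
  constructor
  · intro h
    rcases h.lt_or_eq with h | h
    · exact g.le_of_lt_char ha.le h (g.lo_mem ha.le)
    · obtain ⟨w, hw, hwa, hlim⟩ := exists_seq_strictMono_tendsto' ha
      obtain ⟨σ, hσ, k, hk, hk'⟩ := g.exists_subseq_argmin ordConnected_univ isClosed_univ trivial
        hlim (tendsto_const_nhds (x := t)) (fun n => (hwa n).1.le)
        (fun n => g.sel_mem (w n) t (hwa n).1)
      exact (g.lo_le ha.le hσ).trans (le_of_tendsto' hk' fun n =>
        g.le_of_lt_char (hwa _).1.le (h ▸ (hwa _).2) (g.sel_mem _ t (hwa _).1))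
  · intro h
    by_contra! h'
    exact (g.lt_of_char_lt h' (g.lo_mem ha.le)).not_ge h

lemma char_le_of_lt_hi {b s t : ℝ} (hb : 0 < b) (h : s < g.hi b t) : g.char s t ≤ b := by
  by_contra! h'
  exact (g.le_of_lt_char hb.le h' (g.hi_mem hb.le)).not_gt h

lemma le_hi_of_char_le {b s t : ℝ} (hb : 0 < b) (h : g.char s t ≤ b) : s ≤ g.hi b t := by
  obtain ⟨w, hw, hwa, hlim⟩ := exists_seq_strictAnti_tendsto b
  have hpos := fun n => hb.trans (hwa n)
  obtain ⟨σ, hσ, k, hk, hk'⟩ := g.exists_subseq_argmin ordConnected_univ isClosed_univ trivial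
    hlim (tendsto_const_nhds (x := t)) (fun n => (hpos n).le)
    (fun n => g.sel_mem (w n) t (hpos n))
  exact (ge_of_tendsto' hk' fun n =>
    (g.lt_of_char_lt (h.trans_lt (hwa _)) (g.sel_mem _ t (hpos _))).le).trans (g.le_hi hb.le hσ)

/-- One-sided limits forget the selection. They produce the right and left limits in the
Lebesgue-Stieltjes measures. -/
lemma tendsto_sel_right {b t : ℝ} (hb : 0 < b) :
    Tendsto (fun x => g.sel x t) (𝓝[>] b) (𝓝 (g.hi b t)) := by
  refine tendsto_order.2 ⟨fun c hc => ?_, fun c hc => ?_⟩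
  · filter_upwards [self_mem_nhdsWithin] with x hx
    exact hc.trans_le (g.argmin_mono_left (g.hi_mem hb.le) (g.sel_mem x t (hb.trans hx)) hx)
  · obtain ⟨c', hc', hcc⟩ := exists_between hc
    have h1 : b < g.char c' t := by
      by_contra! h
      exact (g.le_hi_of_char_le hb h).not_gt hc'
    filter_upwards [Ioo_mem_nhdsGT h1] with x hx
    exact (g.le_of_lt_char (hb.trans hx.1).le hx.2 (g.sel_mem x t (hb.trans hx.1))).trans_lt hcc

lemma tendsto_sel_left {a t : ℝ} (ha : 0 < a) :
    Tendsto (fun x => g.sel x t) (𝓝[<] a) (𝓝 (g.lo a t)) := by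
  refine tendsto_order.2 ⟨fun c hc => ?_, fun c hc => ?_⟩
  · have h1 : g.char c t < a := by
      by_contra! h
      exact ((g.le_char_iff ha).1 h).not_gt hc
    have h2 : max 0 (g.char c t) < a := max_lt ha h1
    filter_upwards [Ioo_mem_nhdsLT h2] with x hx
    exact g.lt_of_char_lt ((le_max_right _ _).trans_lt hx.1)
      (g.sel_mem x t ((le_max_left _ _).trans_lt hx.1))
  · filter_upwards [Ioo_mem_nhdsLT ha] with x hx
    exact (g.argmin_mono_left (g.sel_mem x t hx.1) (g.lo_mem ha.le) hx.2).trans_lt hc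

lemma sel_mono {x y t : ℝ} (hx : 0 < x) (hxy : x ≤ y) : g.sel x t ≤ g.sel y t := by
  rcases hxy.lt_or_eq with h | rfl
  · exact g.argmin_mono_left (g.sel_mem x t hx) (g.sel_mem y t (hx.trans h)) h
  · exact le_rfl

end Flow

end PressurelessGas

end

/-! ### The slope of the characteristics. -/

noncomputable section

namespace PressurelessGas

open scoped Topology

namespace LineGas

variable (g : LineGas)

/-- Turns a comparison of potentials into a bound on a mean velocity: the integral of `kern` over
`[a, b]` is nonnegative and is dominated by `c` times that of `vel - W`. -/
lemma le_mom_sub_of_kern_le {x t a b c W : ℝ} (hab : a < b) (hc : 0 < c)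
    (hk : ∀ s ∈ Icc a b, g.kern x t s ≤ c * (g.vel s - W)) (h : g.pot a x t ≤ g.pot b x t) :
    W * (g.mass b - g.mass a) ≤ g.mom b - g.mom a := by
  have h1 := intervalIntegral.integral_mono_on hab.le (g.intervalIntegrable_kern x t a b)
    (((g.intervalIntegrable_vel a b).sub ((g.intervalIntegrable_const 1 a b).const_mul W)).const_mul
      c) (fun s hs => by simpa using hk s hs)
  rw [← g.pot_sub, intervalIntegral.integral_const_mul, intervalIntegral.integral_sub
    (g.intervalIntegrable_vel a b) ((g.intervalIntegrable_const 1 a b).const_mul W),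
    intervalIntegral.integral_const_mul, ← g.mass_sub, ← g.mom_sub] at h1
  have : 0 ≤ c * (g.mom b - g.mom a - W * (g.mass b - g.mass a)) := by linarith
  linarith [nonneg_of_mul_nonneg_right this hc]

lemma mom_sub_le_of_le_kern {x t a b c W : ℝ} (hab : a < b) (hc : 0 < c)
    (hk : ∀ s ∈ Icc a b, c * (g.vel s - W) ≤ g.kern x t s) (h : g.pot b x t ≤ g.pot a x t) :
    g.mom b - g.mom a ≤ W * (g.mass b - g.mass a) := by
  have h1 := intervalIntegral.integral_mono_on hab.le
    (((g.intervalIntegrable_vel a b).sub ((g.intervalIntegrable_const 1 a b).const_mul W)).const_mul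
      c) (g.intervalIntegrable_kern x t a b) (fun s hs => by simpa using hk s hs)
  rw [← g.pot_sub, intervalIntegral.integral_const_mul, intervalIntegral.integral_sub
    (g.intervalIntegrable_vel a b) ((g.intervalIntegrable_const 1 a b).const_mul W),
    intervalIntegral.integral_const_mul, ← g.mass_sub, ← g.mom_sub] at h1
  have : 0 ≤ c * (W * (g.mass b - g.mass a) - (g.mom b - g.mom a)) := by linarith
  linarith [nonneg_of_mul_nonneg_right this hc]

/-- Aiming every particle in `[a, b]` from the later label `b` only raises its free position. This
survives `a < 0 ≤ b` because boundary velocities are positive. -/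
lemma ray_mul_le {x t a b : ℝ} (hx : 0 < x) (ht : 0 < t) (hab : a < b)
    (ha : a ∈ g.argmin univ x t) :
    ray x t b * (g.mass b - g.mass a) ≤ g.mom b - g.mom a := by
  have hta := g.add_pos_of_argmin hx ht ha
  unfold ray
  split_ifs with hb
  · refine g.le_mom_sub_of_kern_le hab ht (fun s hs => ?_) (ha.2 b trivial)
    rw [mul_sub, mul_div_cancel₀ _ ht.ne']
    simp only [kern, offset]
    split_ifs with h
    · linarith [hs.2]
    · nlinarith [g.vel_pos s (not_lt.1 h)]
  · have htb : 0 < t + b := by linarith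
    refine g.le_mom_sub_of_kern_le hab htb (fun s hs => ?_) (ha.2 b trivial)
    have hs0 : s < 0 := by linarith [hs.2]
    rw [mul_sub, mul_div_cancel₀ _ htb.ne']
    simp only [kern, offset, hs0.not_gt, if_false]
    nlinarith [g.vel_pos s hs0.le, hs.2]

/-- Mirror bound. An interval with `a < 0 < b` is excluded because initial velocities may be
negative, and then aiming from `a` need not lower the free position. -/
lemma mom_sub_le {x t a b : ℝ} (ht : 0 < t) (hab : a < b) (hta : 0 < t + a)
    (hb : b ∈ g.argmin univ x t) (h0 : 0 ≤ a ∨ b ≤ 0) :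
    g.mom b - g.mom a ≤ ray x t a * (g.mass b - g.mass a) := by
  unfold ray
  split_ifs with ha
  · refine g.mom_sub_le_of_le_kern hab ht (fun s hs => ?_) (hb.2 a trivial)
    rw [mul_sub, mul_div_cancel₀ _ ht.ne']
    simp only [kern, offset]
    split_ifs with h
    · linarith [hs.1]
    · have : s = 0 := by linarith [hs.1, not_lt.1 h]
      have : a = 0 := by linarith [hs.1]
      subst s a
      simp
  · have hb0 := h0.resolve_left ha
    refine g.mom_sub_le_of_le_kern hab hta (fun s hs => ?_) (hb.2 a trivial)
    have hs0 : s ≤ 0 := hs.2.trans hb0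
    rw [mul_sub, mul_div_cancel₀ _ hta.ne']
    simp only [kern, offset, hs0.not_gt, if_false]
    nlinarith [g.vel_pos s hs0, hs.1]

lemma tendsto_ray {xs ts σs : ℕ → ℝ} {x t σ : ℝ} (hx : Tendsto xs atTop (𝓝 x))
    (ht : Tendsto ts atTop (𝓝 t)) (hσ : Tendsto σs atTop (𝓝 σ)) (hle : ∀ n, σ ≤ σs n)
    (ht0 : 0 < t) (htσ : 0 < t + σ) :
    Tendsto (fun n => ray (xs n) (ts n) (σs n)) atTop (𝓝 (ray x t σ)) := by
  unfold ray
  split_ifs with h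
  · simp only [fun n => h.trans (hle n), if_true]
    exact (hx.sub hσ).div ht ht0.ne'
  · refine (hx.div (ht.add hσ) htσ.ne').congr' ?_
    filter_upwards [hσ.eventually (gt_mem_nhds (not_le.1 h))] with n hn
    simp [hn.not_ge]

/-- Exchange inequality for minimizers at two points. -/
lemma exchange {x t x' t' σ σ' : ℝ} (hσ : σ ∈ g.argmin univ x t)
    (hσ' : σ' ∈ g.argmin univ x' t') :
    (t' - t) * (g.mom σ' - g.mom σ) ≤ (x' - x) * (g.mass σ' - g.mass σ) := by
  have h1 := hσ.2 σ' trivial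
  have h2 := hσ'.2 σ trivial
  simp only [pot_eq] at h1 h2
  linarith

end LineGas

namespace Flow

open LineGas

variable (g : Flow)

/-- The shift `e * h²` puts the point strictly on one side of the characteristic, yet vanishes in
the difference quotient. -/
lemma tendsto_char_slope {s t c e : ℝ} (h : HasDerivAt (g.char s) c t) {hs : ℕ → ℝ}
    (h0 : Tendsto hs atTop (𝓝 0)) (hne : ∀ n, hs n ≠ 0) :
    Tendsto (fun n => (g.char s (t + hs n) + e * hs n ^ 2 - g.char s t) / hs n) atTop (𝓝 c) := by
  have h1 := (hasDerivAt_iff_tendsto_slope_zero.1 h).comp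
    (tendsto_nhdsWithin_iff.2 ⟨h0, Eventually.of_forall hne⟩)
  have h2 := h1.add (h0.const_mul e)
  simp only [mul_zero, add_zero] at h2
  refine h2.congr fun n => ?_
  have := hne n
  simp only [comp_apply, smul_eq_mul]
  field_simp
  ring

lemma tendsto_char {s t e : ℝ} {hs : ℕ → ℝ} (h0 : Tendsto hs atTop (𝓝 0)) :
    Tendsto (fun n => g.char s (t + hs n) + e * hs n ^ 2) atTop (𝓝 (g.char s t)) := by
  have h1 : Continuous fun h => g.char s (t + h) + e * h ^ 2 := by
    have := g.continuous_char s
    fun_prop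
  simpa [comp_def] using (h1.tendsto 0).comp h0

/-- Directional minimality: near a point of differentiability of a characteristic, minimizers on
one side of it accumulate at minimizers of `mom - c * mass`. -/
lemma exists_argmin_le {s t c e : ℝ} (h : HasDerivAt (g.char s) c t) {hs : ℕ → ℝ}
    (h0 : Tendsto hs atTop (𝓝 0)) (hpos : ∀ n, 0 < hs n)
    (hx : ∀ n, 0 < g.char s (t + hs n) + e * hs n ^ 2) :
    ∃ σ ∈ g.argmin univ (g.char s t) t,
      (∃ k : ℕ → ℕ, Tendsto (fun n => g.sel (g.char s (t + hs (k n)) + e * hs (k n) ^ 2)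
        (t + hs (k n))) atTop (𝓝 σ)) ∧
      ∀ σ' ∈ g.argmin univ (g.char s t) t, g.mom σ - c * g.mass σ ≤ g.mom σ' - c * g.mass σ' := by
  have ht : Tendsto (fun n => t + hs n) atTop (𝓝 t) := by simpa using h0.const_add t
  obtain ⟨σ, hσ, k, hk, hlim⟩ := g.exists_subseq_argmin ordConnected_univ isClosed_univ trivial
    (g.tendsto_char (s := s) (e := e) h0) ht (fun n => (hx n).le)
    (fun n => g.sel_mem _ (t + hs n) (hx n))
  refine ⟨σ, hσ, ⟨k, hlim⟩, fun σ' hσ' => ?_⟩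
  have hc := (g.tendsto_char_slope (e := e) h h0 (fun n => (hpos n).ne')).comp hk.tendsto_atTop
  have h1 := (g.continuous_mom.tendsto σ).comp hlim
  have h2 := (g.continuous_mass.tendsto σ).comp hlim
  have h3 := (h1.sub (tendsto_const_nhds (x := g.mom σ')))
  have h4 := hc.mul (h2.sub (tendsto_const_nhds (x := g.mass σ')))
  -- The exchange inequality divided by the positive time increment; its limit is the minimality of
  -- `mom - c * mass`.
  have h5 := le_of_tendsto_of_tendsto' h3 h4 fun n => by
    have := g.exchange hσ' (g.sel_mem _ (t + hs (k n)) (hx (k n)))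
    simp only [comp_apply]
    rw [div_mul_eq_mul_div, le_div_iff₀ (hpos _), mul_comm]
    simpa using this
  linarith

/-- The shift `e = 1` keeps the approximating points to the right of the characteristic, where
minimizers exceed `s`. -/
lemma exists_argmin_right {s t c : ℝ} (h : HasDerivAt (g.char s) c t) :
    ∃ σ ∈ g.argmin univ (g.char s t) t, s ≤ σ ∧
      ∀ σ' ∈ g.argmin univ (g.char s t) t, g.mom σ - c * g.mass σ ≤ g.mom σ' - c * g.mass σ' := by
  have hpos : ∀ n : ℕ, 0 < 1 / ((n : ℝ) + 1) := fun n => by positivity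
  have hx : ∀ n : ℕ, 0 < g.char s (t + 1 / ((n : ℝ) + 1)) + 1 * (1 / ((n : ℝ) + 1)) ^ 2 :=
    fun n => by have := g.char_nonneg s (t + 1 / ((n : ℝ) + 1)); positivity
  obtain ⟨σ, hσ, ⟨k, hk⟩, hmin⟩ := g.exists_argmin_le h tendsto_one_div_add_atTop_nhds_zero_nat
    hpos hx
  refine ⟨σ, hσ, ge_of_tendsto' hk fun n => ?_, hmin⟩
  refine (g.lt_of_char_lt ?_ (g.sel_mem _ _ (hx (k n)))).le
  have := hpos (k n)
  simp only [one_mul, lt_add_iff_pos_right]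
  positivity

/-- The shift `e = -1` keeps the points to the left. Positivity of the characteristic is needed to
stay in `x > 0`, which is why the sequence starts at a large index `N`. -/
lemma exists_argmin_left {s t c : ℝ} (h : HasDerivAt (g.char s) c t) (h0 : 0 < g.char s t) :
    ∃ σ ∈ g.argmin univ (g.char s t) t, σ ≤ s ∧
      ∀ σ' ∈ g.argmin univ (g.char s t) t, g.mom σ - c * g.mass σ ≤ g.mom σ' - c * g.mass σ' := by
  obtain ⟨N, hN⟩ := eventually_atTop.1 ((g.tendsto_char (s := s) (t := t) (e := -1)
    (tendsto_one_div_add_atTop_nhds_zero_nat (𝕜 := ℝ))).eventually (lt_mem_nhds h0))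
  have hpos : ∀ n : ℕ, 0 < 1 / (((n + N : ℕ) : ℝ) + 1) := fun n => by positivity
  have hx : ∀ n : ℕ, 0 < g.char s (t + 1 / (((n + N : ℕ) : ℝ) + 1)) +
    (-1) * (1 / (((n + N : ℕ) : ℝ) + 1)) ^ 2 := fun n => hN (n + N) (by simp)
  obtain ⟨σ, hσ, ⟨k, hk⟩, hmin⟩ := g.exists_argmin_le h
    ((tendsto_add_atTop_iff_nat (f := fun n : ℕ => 1 / ((n : ℝ) + 1)) N).2
      tendsto_one_div_add_atTop_nhds_zero_nat) hpos hx
  refine ⟨σ, hσ, le_of_tendsto' hk fun n => ?_, hmin⟩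
  refine g.le_of_lt_char (hx (k n)).le ?_ (g.sel_mem _ _ (hx (k n)))
  have := pow_pos (hpos (k n)) 2
  linarith

/-- The slope of a characteristic at a point with a single minimizer. -/
lemma deriv_char_of_unique {s t c : ℝ} (ht : 0 < t) (h : HasDerivAt (g.char s) c t)
    (h0 : 0 < g.char s t) (hs : g.argmin univ (g.char s t) t = {s}) :
    c = ray (g.char s t) t s := by
  have hsm : s ∈ g.argmin univ (g.char s t) t := hs ▸ rfl
  have hts := g.add_pos_of_argmin h0 ht hsm
  -- minimizers at points slightly to the right of the characteristic
  have key : ∀ hseq : ℕ → ℝ, Tendsto hseq atTop (𝓝 0) → (∀ n, hseq n ≠ 0) →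
      ∃ k : ℕ → ℕ, Tendsto k atTop atTop ∧ ∃ σs : ℕ → ℝ, Tendsto σs atTop (𝓝 s) ∧
        ∀ n, s < σs n ∧ σs n ∈ g.argmin univ (g.char s (t + hseq (k n)) + 1 * hseq (k n) ^ 2)
          (t + hseq (k n)) := by
    intro hseq hlim hne
    have hx : ∀ n, 0 < g.char s (t + hseq n) + 1 * hseq n ^ 2 := fun n => by
      have := g.char_nonneg s (t + hseq n)
      have := pow_pos (abs_pos.2 (hne n)) 2
      rw [sq_abs] at this
      positivity
    have ht' : Tendsto (fun n => t + hseq n) atTop (𝓝 t) := by simpa using hlim.const_add t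
    obtain ⟨σ, hσ, k, hk, hlim'⟩ := g.exists_subseq_argmin ordConnected_univ isClosed_univ trivial
      (g.tendsto_char (s := s) (e := 1) hlim) ht' (fun n => (hx n).le)
      (fun n => g.sel_mem _ (t + hseq n) (hx n))
    rw [hs, mem_singleton_iff] at hσ
    subst hσ
    refine ⟨k, hk.tendsto_atTop, _, hlim', fun n => ⟨?_, g.sel_mem _ _ (hx (k n))⟩⟩
    refine g.lt_of_char_lt ?_ (g.sel_mem _ _ (hx (k n)))
    have := pow_pos (abs_pos.2 (hne (k n))) 2
    rw [sq_abs] at this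
    linarith
  have hpos : ∀ n : ℕ, 0 < 1 / ((n : ℝ) + 1) := fun n => by positivity
  have hz := tendsto_one_div_add_atTop_nhds_zero_nat (𝕜 := ℝ)
  -- Upper bound: past times, with the ray from `s` to the moving point. Lower bound: future times,
  -- with the rays from the nearby minimizers to the fixed point. Both limits are the ray from `s`.
  apply le_antisymm
  · have hz' : Tendsto (fun n : ℕ => -(1 / ((n : ℝ) + 1))) atTop (𝓝 0) := by simpa using hz.neg
    have hne : ∀ n : ℕ, -(1 / ((n : ℝ) + 1)) ≠ 0 := fun n => (neg_neg_of_pos (hpos n)).ne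
    obtain ⟨k, hk, σs, hσ, hmem⟩ := key _ hz' hne
    have hc := (g.tendsto_char_slope (e := 1) h hz' hne).comp hk
    have hxk := (g.tendsto_char (s := s) (t := t) (e := 1) hz').comp hk
    have htk : Tendsto (fun n => t + -(1 / ((k n : ℝ) + 1))) atTop (𝓝 t) := by
      simpa using (hz'.comp hk).const_add t
    have hray := tendsto_ray hxk htk (tendsto_const_nhds (x := s)) (fun _ => le_rfl) ht hts
    refine le_of_tendsto_of_tendsto hc hray ?_
    -- The nearby minimizers converge to `s`, so for a negative `s` they do not straddle the origin,
    -- as `mom_sub_le` requires.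
    have hsign : ∀ᶠ n in atTop, 0 ≤ s ∨ σs n ≤ 0 := by
      rcases le_or_gt 0 s with h' | h'
      · exact Eventually.of_forall fun _ => Or.inl h'
      · exact (hσ.eventually (gt_mem_nhds h')).mono fun n hn => Or.inr hn.le
    have ht2 : Tendsto (fun n => t + -(1 / ((k n : ℝ) + 1)) + s) atTop (𝓝 (t + s)) :=
      htk.add_const s
    filter_upwards [hsign, htk.eventually (lt_mem_nhds ht), ht2.eventually (lt_mem_nhds hts)]
      with n h1 h2 h3
    have h4 := g.mom_sub_le h2 (hmem n).1 h3 (hmem n).2 h1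
    have h5 := g.exchange hsm (hmem n).2
    have h6 := sub_pos.2 (g.strictMono_mass (hmem n).1)
    have h7 := hpos (k n)
    simp only [comp_apply]
    set d := 1 / ((k n : ℝ) + 1)
    rw [div_neg, neg_le, le_div_iff₀ h7]
    have h8 := mul_le_mul_of_nonneg_left h4 h7.le
    by_contra! h9
    have h10 := mul_lt_mul_of_pos_right h9 h6
    nlinarith
  · obtain ⟨k, hk, σs, hσ, hmem⟩ := key _ hz (fun n => (hpos n).ne')
    have hc := (g.tendsto_char_slope (e := 1) h hz (fun n => (hpos n).ne')).comp hk
    have hray := tendsto_ray (tendsto_const_nhds (x := g.char s t)) (tendsto_const_nhds (x := t))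
      hσ (fun n => (hmem n).1.le) ht hts
    refine le_of_tendsto_of_tendsto' hray hc fun n => ?_
    have h4 := g.ray_mul_le h0 ht (hmem n).1 hsm
    have h5 := g.exchange hsm (hmem n).2
    have h6 := sub_pos.2 (g.strictMono_mass (hmem n).1)
    have h7 := hpos (k n)
    simp only [comp_apply]
    set d := 1 / ((k n : ℝ) + 1)
    rw [le_div_iff₀ h7]
    have h8 := mul_le_mul_of_nonneg_left h4 h7.le
    by_contra! h9
    have h10 := mul_lt_mul_of_pos_right h9 h6
    nlinarith

/-- The slope of a characteristic at a time at which the characteristics with rational labels are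
differentiable. -/
lemma deriv_char_of_differentiable_rat {s t c : ℝ} (ht : 0 < t)
    (hq : ∀ q : ℚ, DifferentiableAt ℝ (g.char q) t) (h : HasDerivAt (g.char s) c t)
    (h0 : 0 < g.char s t) : c = g.velo (g.char s t) t := by
  unfold velo
  split_ifs with hlt
  · set x := g.char s t with hx
    -- Characteristics with labels between the extreme minimizers all pass through this point.
    -- Ordered curves that touch have equal slopes where both are differentiable. Rational labels
    -- suffice and cost only a null set of times.
    have hqd : ∀ q : ℚ, g.lo x t < q → (q : ℝ) < g.hi x t → g.char q t = x ∧
        HasDerivAt (g.char q) c t := by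
      intro q h1 h2
      have h3 : g.char q t = x :=
        le_antisymm (g.char_le_of_lt_hi h0 h2) ((g.le_char_iff h0).2 h1.le)
      have h4 := (hq q).hasDerivAt
      have h5 : deriv (g.char q) t = c := by
        have h6 := h4.sub h
        rcases le_total s (q : ℝ) with h7 | h7
        · have : IsLocalMin (g.char q - g.char s) t := Eventually.of_forall fun τ => by
            simp only [Pi.sub_apply, h3, ← hx, sub_self, sub_nonneg]
            exact g.char_mono τ h7
          linarith [this.hasDerivAt_eq_zero h6]
        · have : IsLocalMax (g.char q - g.char s) t := Eventually.of_forall fun τ => by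
            simp only [Pi.sub_apply, h3, ← hx, sub_self, sub_nonpos]
            exact g.char_mono τ h7
          linarith [this.hasDerivAt_eq_zero h6]
      exact ⟨h3, h5 ▸ h4⟩
    have hcont : Continuous fun σ => g.mom σ - c * g.mass σ :=
      g.continuous_mom.sub (g.continuous_mass.const_mul c)
    have hle : g.mom (g.lo x t) - c * g.mass (g.lo x t) ≤
        g.mom (g.hi x t) - c * g.mass (g.hi x t) := by
      by_contra! hcon
      -- If the value at `lo` were larger, it would stay larger than the value at `hi` on a right
      -- neighbourhood of `lo`. A rational label there has, on its left, a minimizer of `mom - c *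
      -- mass` inside that neighbourhood: a contradiction. The reverse inequality is symmetric at
      -- `hi`.
      obtain ⟨b, hb, hb'⟩ := (mem_nhdsGE_iff_exists_Ico_subset' hlt).1
        (mem_nhdsWithin_of_mem_nhds ((hcont.tendsto (g.lo x t)).eventually (lt_mem_nhds hcon)))
      obtain ⟨q, hq1, hq2⟩ := exists_rat_btwn (lt_min (mem_Ioi.1 hb) hlt)
      obtain ⟨h3, h4⟩ := hqd q hq1 (hq2.trans_le (min_le_right _ _))
      obtain ⟨σ, hσ, hσq, hmin⟩ := g.exists_argmin_left h4 (h3 ▸ h0)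
      rw [h3] at hσ hmin
      exact (hmin _ (g.hi_mem h0.le)).not_gt
        (hb' ⟨g.lo_le h0.le hσ, hσq.trans_lt (hq2.trans_le (min_le_left _ _))⟩)
    have hge : g.mom (g.hi x t) - c * g.mass (g.hi x t) ≤
        g.mom (g.lo x t) - c * g.mass (g.lo x t) := by
      by_contra! hcon
      obtain ⟨b, hb, hb'⟩ := (mem_nhdsLE_iff_exists_Ioc_subset' hlt).1
        (mem_nhdsWithin_of_mem_nhds ((hcont.tendsto (g.hi x t)).eventually (lt_mem_nhds hcon)))
      obtain ⟨q, hq1, hq2⟩ := exists_rat_btwn (max_lt (mem_Iio.1 hb) hlt)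
      obtain ⟨h3, h4⟩ := hqd q ((le_max_right _ _).trans_lt hq1) hq2
      obtain ⟨σ, hσ, hσq, hmin⟩ := g.exists_argmin_right h4
      rw [h3] at hσ hmin
      exact (hmin _ (g.lo_mem h0.le)).not_gt
        (hb' ⟨((le_max_left _ _).trans_lt hq1).trans_le hσq, g.le_hi h0.le hσ⟩)
    rw [eq_div_iff (sub_pos.2 (g.strictMono_mass hlt)).ne']
    linarith
  · have h1 : g.lo (g.char s t) t ≤ s := (g.le_char_iff h0).1 le_rfl
    have h2 : s ≤ g.hi (g.char s t) t := g.le_hi_of_char_le h0 le_rfl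
    have h3 : g.lo (g.char s t) t = s := by linarith [not_lt.1 hlt]
    rw [h3]
    refine g.deriv_char_of_unique ht h h0 (Subset.antisymm (fun σ hσ => ?_) ?_)
    · exact le_antisymm ((g.le_hi h0.le hσ).trans (by linarith [not_lt.1 hlt]))
        (h3 ▸ g.lo_le h0.le hσ)
    · have := g.lo_mem (x := g.char s t) (t := t) h0.le
      rw [h3] at this
      exact singleton_subset_iff.2 this

/-- Characteristics follow the velocity field. -/
lemma ae_deriv_char (s : ℝ) : ∀ᵐ t : ℝ, 0 < t → 0 < g.char s t →
    HasDerivAt (g.char s) (g.u (g.char s t) t) t := by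
  have h1 : ∀ᵐ t : ℝ, ∀ q : ℚ, DifferentiableAt ℝ (g.char q) t :=
    ae_all_iff.2 fun q => (g.lipschitz_char q).ae_differentiableAt
  filter_upwards [h1, (g.lipschitz_char s).ae_differentiableAt] with t hq hs ht h0
  have h := hs.hasDerivAt
  rwa [g.deriv_char_of_differentiable_rat ht hq h h0, ← g.u_eq _ _ h0 ht] at h

end Flow

end PressurelessGas

end

/-! ### The velocity as a conditional mean of particle velocities. -/

noncomputable section

namespace PressurelessGas

open scoped Topology

namespace LineGas

variable (g : LineGas)

lemma locallyIntegrable_dens_mul_continuous {w : ℝ → ℝ} (hw : Measurable w) {c : ℝ → ℝ}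
    (hc : Continuous c) (h : ∀ s, |w s| ≤ c s) :
    LocallyIntegrable (fun s => g.dens s * w s) volume := by
  have h1 : LocallyIntegrable (fun s => c s * g.dens s) volume := by
    have := (locallyIntegrableOn_univ.2 g.dens_loc).continuousOn_mul hc.continuousOn
      isOpen_univ.isLocallyClosed
    exact locallyIntegrableOn_univ.1 this
  refine h1.mono (g.measurable_dens.mul hw).aestronglyMeasurable (Eventually.of_forall fun s => ?_)
  have h2 := g.dens_pos s
  rw [Real.norm_eq_abs, Real.norm_eq_abs, abs_mul, abs_mul, mul_comm |g.dens s|]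
  exact mul_le_mul_of_nonneg_right ((h s).trans (le_abs_self _)) (abs_nonneg _)

lemma ae_hasDerivAt_prim {w : ℝ → ℝ} (hw : Measurable w) {c : ℝ → ℝ}
    (hc : Continuous c) (h : ∀ s, |w s| ≤ c s) :
    ∀ᵐ s : ℝ, HasDerivAt (g.prim w) (g.dens s * w s) s := by
  filter_upwards [LocallyIntegrable.ae_hasDerivAt_integral
    (g.locallyIntegrable_dens_mul_continuous hw hc h)]
    with s hs
  have := hs 0
  simp only [← g.intervalIntegral_mu] at this
  exact this

/-- At almost every minimizer the free flight ends at the given point. -/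
lemma ae_vel_eq_ray : ∀ᵐ s : ℝ, ∀ x t : ℝ, 0 < x → 0 < t → s ∈ g.argmin univ x t →
    g.vel s = ray x t s := by
  filter_upwards [g.ae_hasDerivAt_prim measurable_const continuous_const (w := fun _ => 1)
      (c := fun _ => 1) (fun _ => by simp),
    g.ae_hasDerivAt_prim g.measurable_vel continuous_const g.abs_vel_le,
    g.ae_hasDerivAt_prim g.measurable_offset (by fun_prop) g.abs_offset_le]
    with s h1 h2 h3 x t hx ht hs
  -- The potential is a combination, with coefficients depending on `(x, t)`, of three fixed
  -- primitives; so one null set of labels serves all points at once.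
  have h4 := ((h2.const_mul t).add h3).sub (h1.const_mul x)
  have h5 : IsLocalMin (fun σ => g.pot σ x t) s := Eventually.of_forall fun σ => hs.2 σ trivial
  have h6 : HasDerivAt (fun σ => g.pot σ x t)
      (t * (g.dens s * g.vel s) + g.dens s * g.offset s - x * (g.dens s * 1)) s := by
    refine h4.congr_of_eventuallyEq (Eventually.of_forall fun σ => ?_)
    simp [pot_eq, mom, mass]
  have h7 := h5.hasDerivAt_eq_zero h6
  have h8 : g.dens s * g.kern x t s = 0 := by rw [← h7, kern]; ring
  have h9 : g.kern x t s = 0 := (mul_eq_zero.1 h8).resolve_left (g.dens_pos s).ne'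
  have h10 := g.add_pos_of_argmin hx ht hs
  unfold ray
  unfold kern offset at h9
  split_ifs with h
  · rw [eq_div_iff ht.ne']
    split_ifs at h9 with h'
    · linarith
    · have : s = 0 := le_antisymm (not_lt.1 h') h
      subst this
      linarith
  · rw [eq_div_iff h10.ne']
    rw [if_neg (fun h' => h (le_of_lt h'))] at h9
    linarith

end LineGas

namespace Flow

open LineGas

variable (g : Flow)

lemma measurable_char_left (t : ℝ) : Measurable fun s => g.char s t := (g.char_mono t).measurable

lemma measurable_u_char_left (t : ℝ) : Measurable fun s => g.u (g.char s t) t :=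
  g.measurable_u.comp ((g.measurable_char_left t).prodMk measurable_const)

lemma char_mem_Icc {a b s t : ℝ} (ha : 0 < a) (hab : a ≤ b) (h : g.char s t ∈ Icc a b) :
    s ∈ Icc (g.lo a t) (g.hi b t) :=
  ⟨(g.le_char_iff ha).1 h.1, g.le_hi_of_char_le (ha.trans_le hab) h.2⟩

lemma integrable_comp_char {a b t C D : ℝ} (ha : 0 < a) (hab : a ≤ b) {G w : ℝ → ℝ}
    (hG : Measurable G) (hw : Measurable w) (hGC : ∀ x, |G x| ≤ C) (hwD : ∀ s, |w s| ≤ D)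
    (hGs : ∀ x, x ∉ Icc a b → G x = 0) :
    Integrable (fun s => G (g.char s t) * w s) g.mu := by
  have hm : Measurable fun s => G (g.char s t) * w s :=
    (hG.comp (g.measurable_char_left t)).mul hw
  have h : IntegrableOn (fun s => G (g.char s t) * w s) (Icc (g.lo a t) (g.hi b t)) g.mu := by
    refine Measure.integrableOn_of_bounded (M := C * D) (isCompact_Icc.measure_lt_top).ne
      hm.aestronglyMeasurable (Eventually.of_forall fun s => ?_)
    rw [Real.norm_eq_abs, abs_mul]
    exact mul_le_mul (hGC _) (hwD _) (abs_nonneg _) ((abs_nonneg _).trans (hGC 0))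
  refine (integrableOn_iff_integrable_of_support_subset fun s hs => ?_).1 h
  refine g.char_mem_Icc ha hab ?_
  by_contra hc
  simp [hGs _ hc] at hs

lemma char_eq_of_mem_Ioo {x s t : ℝ} (hx : 0 < x) (hs : s ∈ Ioo (g.lo x t) (g.hi x t)) :
    g.char s t = x :=
  le_antisymm (g.char_le_of_lt_hi hx hs.2) ((g.le_char_iff hx).2 hs.1.le)

/-- The open label intervals of distinct shocks are disjoint, since the characteristic position is
constant on each of them. -/
lemma countable_atoms (t : ℝ) : {x | 0 < x ∧ g.lo x t < g.hi x t}.Countable := by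
  refine Set.PairwiseDisjoint.countable_of_isOpen (s := fun x => Ioo (g.lo x t) (g.hi x t))
    (fun x hx y hy hxy => Set.disjoint_left.2 fun s hs hs' => hxy ?_) (fun _ _ => isOpen_Ioo)
    fun x hx => nonempty_Ioo.2 hx.2
  rw [← g.char_eq_of_mem_Ioo hx.1 hs, g.char_eq_of_mem_Ioo hy.1 hs']

/-- The velocity of the gas is the conditional mean of the velocities of the particles. -/
lemma integral_vel_sub_u {a b t C : ℝ} (ht : 0 < t) (ha : 0 < a) (hab : a ≤ b) {G : ℝ → ℝ}
    (hG : Measurable G) (hGC : ∀ x, |G x| ≤ C) (hGs : ∀ x, x ∉ Icc a b → G x = 0) :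
    ∫ s, G (g.char s t) * (g.vel s - g.u (g.char s t) t) ∂g.mu = 0 := by
  set f := fun s => G (g.char s t) * (g.vel s - g.u (g.char s t) t) with hf
  have hint : Integrable f g.mu := by
    refine g.integrable_comp_char ha hab hG
      (g.measurable_vel.sub (g.measurable_u_char_left t)) hGC (D := g.speed + g.speed)
      (fun s => (abs_sub _ _).trans (add_le_add (g.abs_vel_le s) (g.abs_u_le _ _))) hGs
  set At : Set ℝ := {x | 0 < x ∧ g.lo x t < g.hi x t} with hAt
  have hc : At.Countable := g.countable_atoms t
  have : Countable At := hc
  set S : Set ℝ := ⋃ x : At, Ioo (g.lo x t) (g.hi x t) with hS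
  have hSm : MeasurableSet S := MeasurableSet.iUnion fun _ => measurableSet_Ioo
  -- On the labels of one shock `u` is by definition the average of `vel`.
  have hzero : ∀ x : At, ∫ s in Ioo (g.lo x t) (g.hi x t), f s ∂g.mu = 0 := by
    rintro ⟨x, hx, hlt⟩
    have h1 : ∫ s in Ioo (g.lo x t) (g.hi x t), f s ∂g.mu =
        ∫ s in Ioo (g.lo x t) (g.hi x t), G x * (g.vel s - g.u x t * 1) ∂g.mu := by
      refine setIntegral_congr_fun measurableSet_Ioo fun s hs => ?_
      simp only [hf, g.char_eq_of_mem_Ioo hx hs, mul_one]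
    rw [h1, ← integral_Ioc_eq_integral_Ioo, ← intervalIntegral.integral_of_le hlt.le,
      intervalIntegral.integral_const_mul, intervalIntegral.integral_sub
      (g.intervalIntegrable_vel _ _) ((g.intervalIntegrable_const 1 _ _).const_mul _),
      intervalIntegral.integral_const_mul, ← g.mass_sub, ← g.mom_sub, g.u_eq x t hx ht]
    unfold velo
    rw [if_pos hlt, div_mul_cancel₀ _ (sub_pos.2 (g.strictMono_mass hlt)).ne']
    simp
  have h1 : ∫ s in S, f s ∂g.mu = 0 := by
    have := hasSum_integral_iUnion (μ := g.mu) (f := f)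
      (s := fun x : At => Ioo (g.lo x t) (g.hi x t)) (fun _ => measurableSet_Ioo) ?_
      hint.integrableOn
    · simp only [hzero] at this
      exact this.unique hasSum_zero
    · intro x y hxy
      refine Set.disjoint_left.2 fun s hs hs' => hxy (Subtype.ext ?_)
      rw [← g.char_eq_of_mem_Ioo x.2.1 hs, g.char_eq_of_mem_Ioo y.2.1 hs']
  -- Off the shocks and their countably many endpoints, `s` is the only minimizer at its own
  -- characteristic wherever `G` does not vanish, so `vel s` is the ray velocity and the integrand
  -- is zero.
  have h2 : ∫ s in Sᶜ, f s ∂g.mu = 0 := by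
    have hnull : ∀ᵐ s ∂g.mu, s ∉ (fun x => g.lo x t) '' At ∪ (fun x => g.hi x t) '' At :=
      (Set.Countable.union (hc.image _) (hc.image _)).ae_notMem _
    rw [integral_eq_zero_of_ae]
    refine (ae_restrict_iff' hSm.compl).2 ?_
    filter_upwards [g.mu_ac.ae_le g.ae_vel_eq_ray, hnull] with s h3 h4 h5
    by_cases hG0 : G (g.char s t) = 0
    · simp [hf, hG0]
    have h6 : g.char s t ∈ Icc a b := by
      by_contra h
      exact hG0 (hGs _ h)
    have hx : 0 < g.char s t := ha.trans_le h6.1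
    have h7 : g.lo (g.char s t) t ≤ s := (g.le_char_iff hx).1 le_rfl
    have h8 : s ≤ g.hi (g.char s t) t := g.le_hi_of_char_le hx le_rfl
    have h9 : ¬ g.lo (g.char s t) t < g.hi (g.char s t) t := by
      intro h
      have hmem : g.char s t ∈ At := ⟨hx, h⟩
      rcases h7.lt_or_eq with h10 | h10
      · rcases h8.lt_or_eq with h11 | h11
        · exact h5 (mem_iUnion.2 ⟨⟨_, hmem⟩, h10, h11⟩)
        · exact h4 (Or.inr ⟨_, hmem, h11.symm⟩)
      · exact h4 (Or.inl ⟨_, hmem, h10⟩)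
    have h10 : g.lo (g.char s t) t = s := by linarith
    have h11 : s ∈ g.argmin univ (g.char s t) t := by
      have := g.lo_mem (x := g.char s t) (t := t) hx.le
      rwa [h10] at this
    simp only [hf, h3 _ _ hx ht h11, g.u_eq _ _ hx ht]
    unfold velo
    rw [if_neg h9, h10]
    simp
  rw [← integral_add_compl hSm hint, h1, h2, add_zero]

end Flow

end PressurelessGas

end

/-! ### The mass distribution and its Stieltjes densities. -/

noncomputable section

namespace PressurelessGas

open scoped Topology

namespace Flow

open LineGas

variable (g : Flow)

/-- The mass distribution of the gas at time `t`. -/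
def rho (t : ℝ) : Measure ℝ :=
  (g.mu.restrict {s | 0 < g.char s t}).map fun s => g.char s t

lemma measurableSet_char_preimage (t : ℝ) {A : Set ℝ} (hA : MeasurableSet A) :
    MeasurableSet {s | g.char s t ∈ A} := g.measurable_char_left t hA

lemma rho_Iic (t : ℝ) : g.rho t (Iic 0) = 0 := by
  unfold rho
  rw [Measure.map_apply (g.measurable_char_left t) measurableSet_Iic,
    Measure.restrict_apply (g.measurable_char_left t measurableSet_Iic)]
  convert measure_empty (μ := g.mu)
  ext s
  simp only [mem_inter_iff, mem_preimage, mem_Iic, mem_ofPred_eq, mem_empty_iff_false, iff_false]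
  intro h
  linarith [h.1, h.2]

lemma setIntegral_rho {a b t : ℝ} (ha : 0 < a) {f : ℝ → ℝ} (hf : Measurable f) :
    ∫ x in Icc a b, f x ∂g.rho t = ∫ s in {s | g.char s t ∈ Icc a b}, f (g.char s t) ∂g.mu := by
  unfold rho
  rw [setIntegral_map measurableSet_Icc hf.aestronglyMeasurable
    (g.measurable_char_left t).aemeasurable,
    Measure.restrict_restrict (g.measurable_char_left t measurableSet_Icc)]
  congr 2
  ext s
  simp only [mem_inter_iff, mem_preimage, mem_ofPred_eq, and_iff_left_iff_imp]
  exact fun h => ha.trans_le h.1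

lemma rho_Icc_lt_top {a b t : ℝ} (ha : 0 < a) (hab : a ≤ b) : g.rho t (Icc a b) < ⊤ := by
  unfold rho
  rw [Measure.map_apply (g.measurable_char_left t) measurableSet_Icc]
  refine (Measure.restrict_apply_le _ _).trans_lt ((measure_mono fun s hs => ?_).trans_lt
    (isCompact_Icc (a := g.lo a t) (b := g.hi b t)).measure_lt_top)
  exact g.char_mem_Icc ha hab hs

/-- Up to its two endpoints, which carry no mass, the set of labels with characteristic in `[a, b]`
is the interval from `lo` at `a` to `hi` at `b`. -/
lemma setIntegral_char_Icc {a b t : ℝ} (ha : 0 < a) (hab : a ≤ b) {w : ℝ → ℝ}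
    (hw : ∀ a b, IntervalIntegrable w g.mu a b) :
    ∫ s in {s | g.char s t ∈ Icc a b}, w s ∂g.mu =
      g.prim w (g.hi b t) - g.prim w (g.lo a t) := by
  have hb : 0 < b := ha.trans_le hab
  have hle : g.lo a t ≤ g.hi b t := by
    rcases hab.lt_or_eq with h | rfl
    · exact g.argmin_mono_left (g.lo_mem ha.le) (g.hi_mem hb.le) h
    · exact g.lo_le_hi ha.le
  rw [g.prim_sub hw, intervalIntegral.integral_of_le hle]
  refine setIntegral_congr_set ?_
  filter_upwards [Measure.ae_ne g.mu (g.lo a t), Measure.ae_ne g.mu (g.hi b t)] with s h1 h2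
  refine propext ⟨fun h => ?_, fun h => ?_⟩
  · have h3 := g.char_mem_Icc ha hab h
    exact ⟨lt_of_le_of_ne h3.1 h1.symm, h3.2⟩
  · exact ⟨(g.le_char_iff ha).2 (le_of_lt h.1), g.char_le_of_lt_hi hb (lt_of_le_of_ne h.2 h2)⟩

lemma locallyBoundedVariationOn_of_dist_le {n M : ℝ → ℝ} {A : Set ℝ}
    (hM : LocallyBoundedVariationOn M A) (h : ∀ x ∈ A, ∀ y ∈ A, dist (n x) (n y) ≤ dist (M x) (M y)) :
    LocallyBoundedVariationOn n A := fun a b ha hb => by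
  refine ne_top_of_le_ne_top (hM a b ha hb) (iSup_mono fun p => Finset.sum_le_sum fun i _ => ?_)
  rw [edist_dist, edist_dist]
  exact ENNReal.ofReal_le_ofReal (h _ (p.2.2.2 _).1 _ (p.2.2.2 _).1)

/-- Common core for mass, momentum and energy. Increments of `n` are dominated by those of the
monotone function `D * mass (sel x t)`, its one-sided limits are primitives at `hi` and `lo`, and
`hwf` says that `f` averages `w` over label sets of position intervals. -/
lemma hasStieltjesDensity {t D : ℝ} {w f n F : ℝ → ℝ} (hw : Measurable w) (hwD : ∀ s, |w s| ≤ D)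
    (hf : Measurable f) (hfD : ∀ x, |f x| ≤ D)
    (hwf : ∀ a b, 0 < a → a ≤ b → ∫ s in {s | g.char s t ∈ Icc a b}, w s ∂g.mu =
      ∫ s in {s | g.char s t ∈ Icc a b}, f (g.char s t) ∂g.mu)
    (hn : ∀ x, 0 < x → n x = g.prim w (g.sel x t)) (hF : ∀ x, 0 < x → F x = f x) :
    HasStieltjesDensity n F (g.rho t) := by
  have hwi := g.intervalIntegrable_bdd hw hwD
  refine ⟨?_, fun a b ha hab => ?_, fun a b ha hab => ?_⟩
  · have hD : 0 ≤ D := (abs_nonneg _).trans (hwD 0)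
    have h1 : MonotoneOn (fun x => D * g.mass (g.sel x t)) (Ioi 0) := fun x hx y _ hxy =>
      mul_le_mul_of_nonneg_left (g.strictMono_mass.monotone (g.sel_mono hx hxy)) hD
    refine locallyBoundedVariationOn_of_dist_le h1.locallyBoundedVariationOn fun x hx y hy => ?_
    wlog hxy : x ≤ y generalizing x y
    · rw [dist_comm (n x), dist_comm (D * _)]
      exact this y hy x hx (le_of_not_ge hxy)
    have h3 := intervalIntegral.norm_integral_le_integral_norm (μ := g.mu) (f := w)
      (g.sel_mono (t := t) hx hxy)
    have h4 := intervalIntegral.integral_mono_on (g.sel_mono (t := t) hx hxy)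
        (hwi (g.sel x t) (g.sel y t)).norm ((g.intervalIntegrable_const 1 _ _).const_mul D)
        fun s _ => by simpa using hwD s
    rw [intervalIntegral.integral_const_mul, ← g.mass_sub] at h4
    rw [← g.prim_sub hwi] at h3
    rw [hn x hx, hn y hy, dist_comm, Real.dist_eq, dist_comm, Real.dist_eq, ← mul_sub]
    exact (h3.trans h4).trans (le_abs_self _)
  · have h1 : IntegrableOn f (Icc a b) (g.rho t) :=
      Measure.integrableOn_of_bounded (M := D) (g.rho_Icc_lt_top ha hab).ne
        hf.aestronglyMeasurable (Eventually.of_forall hfD)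
    exact h1.congr_fun (fun x hx => (hF x (ha.trans_le hx.1)).symm) measurableSet_Icc
  · have hb : 0 < b := ha.trans_le hab
    rw [setIntegral_congr_fun measurableSet_Icc fun x hx => hF x (ha.trans_le hx.1),
      g.setIntegral_rho ha hf, ← hwf a b ha hab, g.setIntegral_char_Icc ha hab hwi]
    have hc := g.continuous_prim hwi
    congr 1
    · refine (rightLim_eq_of_tendsto (((hc.tendsto _).comp (g.tendsto_sel_right hb)).congr' ?_)).symm
      filter_upwards [self_mem_nhdsWithin] with x hx
      exact (hn x (hb.trans hx)).symm
    · refine (leftLim_eq_of_tendsto (((hc.tendsto _).comp (g.tendsto_sel_left ha)).congr' ?_)).symm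
      filter_upwards [Ioo_mem_nhdsLT ha] with x hx
      exact (hn x hx.1).symm

lemma setIntegral_mul_vel {a b t C : ℝ} (ht : 0 < t) (ha : 0 < a) (hab : a ≤ b) {G : ℝ → ℝ}
    (hG : Measurable G) (hGC : ∀ x, |G x| ≤ C) :
    ∫ s in {s | g.char s t ∈ Icc a b}, G (g.char s t) * g.vel s ∂g.mu =
      ∫ s in {s | g.char s t ∈ Icc a b}, G (g.char s t) * g.u (g.char s t) t ∂g.mu := by
  have hA := g.measurableSet_char_preimage t (measurableSet_Icc (a := a) (b := b))
  have hG' : Measurable ((Icc a b).indicator G) := hG.indicator measurableSet_Icc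
  have hGC' : ∀ x, |(Icc a b).indicator G x| ≤ C := fun x => by
    by_cases hx : x ∈ Icc a b
    · simpa [hx] using hGC x
    · simpa [hx] using (abs_nonneg _).trans (hGC 0)
  have hG0 : ∀ x, x ∉ Icc a b → (Icc a b).indicator G x = 0 := fun x hx => by simp [hx]
  have h := g.integral_vel_sub_u ht ha hab hG' hGC' hG0
  have h1 := g.integrable_comp_char (t := t) ha hab hG' g.measurable_vel hGC' g.abs_vel_le hG0
  have h2 := g.integrable_comp_char (t := t) ha hab hG' (g.measurable_u_char_left t) hGC'
    (fun s => g.abs_u_le _ _) hG0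
  simp only [mul_sub] at h
  rw [integral_sub h1 h2, sub_eq_zero] at h
  rw [← integral_indicator hA, ← integral_indicator hA]
  have e : ∀ k : ℝ → ℝ, {s | g.char s t ∈ Icc a b}.indicator (fun s => G (g.char s t) * k s) =
      fun s => (Icc a b).indicator G (g.char s t) * k s := fun k => by
    ext s
    by_cases hs : g.char s t ∈ Icc a b
    · rw [indicator_of_mem (show s ∈ {s | g.char s t ∈ Icc a b} from hs), indicator_of_mem hs]
    · rw [indicator_of_notMem (show s ∉ {s | g.char s t ∈ Icc a b} from hs),
        indicator_of_notMem hs, zero_mul]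
  rw [e g.vel, e fun s => g.u (g.char s t) t]
  exact h

lemma isStieltjesMeasure {t : ℝ} {n : ℝ → ℝ}
    (hn : ∀ x, 0 < x → n x = g.mass (g.sel x t)) : IsStieltjesMeasure n (g.rho t) :=
  ⟨g.hasStieltjesDensity (D := 1) measurable_const (by simp) measurable_const (by simp)
    (fun _ _ _ _ => rfl) hn (fun _ _ => rfl), g.rho_Iic t⟩

lemma hasStieltjesDensity_mom {t : ℝ} (ht : 0 < t) {n F : ℝ → ℝ}
    (hn : ∀ x, 0 < x → n x = g.mom (g.sel x t)) (hF : ∀ x, 0 < x → F x = g.u x t) :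
    HasStieltjesDensity n F (g.rho t) := by
  refine g.hasStieltjesDensity g.measurable_vel g.abs_vel_le
    (g.measurable_u.comp (measurable_id.prodMk measurable_const)) (fun x => g.abs_u_le x t)
    (fun a b ha hab => ?_) hn hF
  simpa using g.setIntegral_mul_vel ht ha hab (measurable_const (a := (1 : ℝ))) (C := 1) (by simp)

/-- The density of twice the energy in the particle label. -/
def flux (t s : ℝ) : ℝ := g.u (g.char s t) t * g.vel s

lemma measurable_flux_left (t : ℝ) : Measurable (g.flux t) :=
  (g.measurable_u_char_left t).mul g.measurable_vel

lemma abs_flux_le (t s : ℝ) : |g.flux t s| ≤ g.speed * g.speed := by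
  unfold flux
  rw [abs_mul]
  exact mul_le_mul (g.abs_u_le _ _) (g.abs_vel_le s) (abs_nonneg _) g.speed_pos.le

/-- The factor `u` in `flux` is a function of position only, so replacing `vel` by its conditional
mean turns `u * vel` into `u²`. -/
lemma hasStieltjesDensity_flux {t : ℝ} (ht : 0 < t) {n F : ℝ → ℝ}
    (hn : ∀ x, 0 < x → n x = 1 / 2 * g.prim (g.flux t) (g.sel x t))
    (hF : ∀ x, 0 < x → F x = 1 / 2 * g.u x t ^ 2) :
    HasStieltjesDensity n F (g.rho t) := by
  have hu : Measurable fun x => g.u x t := g.measurable_u.comp (measurable_id.prodMk measurable_const)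
  refine g.hasStieltjesDensity (w := fun s => 1 / 2 * g.flux t s) (D := g.speed * g.speed)
    (f := fun x => 1 / 2 * g.u x t ^ 2)
    ((g.measurable_flux_left t).const_mul _) (fun s => ?_) ((hu.pow_const 2).const_mul _)
    (fun x => ?_) (fun a b ha hab => ?_) (fun x hx => ?_) hF
  · rw [abs_mul, abs_of_pos (by norm_num : (0 : ℝ) < 1 / 2)]
    linarith [g.abs_flux_le t s, abs_nonneg (g.flux t s)]
  · rw [abs_mul, abs_of_pos (by norm_num : (0 : ℝ) < 1 / 2), abs_of_nonneg (sq_nonneg _)]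
    nlinarith [abs_le.1 (g.abs_u_le x t)]
  · rw [integral_const_mul, integral_const_mul]
    congr 1
    simp only [sq]
    exact g.setIntegral_mul_vel ht ha hab hu (fun x => g.abs_u_le x t)
  · rw [hn x hx, prim, prim, intervalIntegral.integral_const_mul]

end Flow

end PressurelessGas

end

noncomputable section

namespace PressurelessGas

open scoped Topology NNReal

/-! ### Test functions along Lipschitz curves -/

/-- The partial derivative in space of a function of space and time. -/
def pdx (φ : ℝ × ℝ → ℝ) (p : ℝ × ℝ) : ℝ := fderiv ℝ φ p (1, 0)

/-- The partial derivative in time of a function of space and time. -/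
def pdt (φ : ℝ × ℝ → ℝ) (p : ℝ × ℝ) : ℝ := fderiv ℝ φ p (0, 1)

section Curve

variable {φ : ℝ × ℝ → ℝ} {f : ℝ → ℝ} {K : ℝ≥0}

lemma continuous_pdx (hφ : ContDiff ℝ 1 φ) : Continuous (pdx φ) :=
  (hφ.continuous_fderiv one_ne_zero).clm_apply continuous_const

lemma continuous_pdt (hφ : ContDiff ℝ 1 φ) : Continuous (pdt φ) :=
  (hφ.continuous_fderiv one_ne_zero).clm_apply continuous_const

lemma pdx_eq_zero {p : ℝ × ℝ} (hp : p ∉ tsupport φ) : pdx φ p = 0 := by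
  have : fderiv ℝ φ p = 0 := by
    by_contra h
    exact hp (support_fderiv_subset ℝ h)
  simp [pdx, this]

lemma pdt_eq_zero {p : ℝ × ℝ} (hp : p ∉ tsupport φ) : pdt φ p = 0 := by
  have : fderiv ℝ φ p = 0 := by
    by_contra h
    exact hp (support_fderiv_subset ℝ h)
  simp [pdt, this]

lemma exists_tsupport_bound (hc : HasCompactSupport φ) :
    ∃ R : ℝ, ∀ p : ℝ × ℝ, R < |p.1| ∨ R < |p.2| → p ∉ tsupport φ := by
  obtain ⟨R, hR⟩ := hc.isCompact.isBounded.subset_closedBall 0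
  refine ⟨R, fun p hp h => ?_⟩
  have := hR h
  rw [mem_closedBall_zero_iff, Prod.norm_def, max_le_iff, Real.norm_eq_abs,
    Real.norm_eq_abs] at this
  rcases hp with hp | hp <;> linarith [this.1, this.2]

lemma hasDerivAt_comp_curve (hφ : ContDiff ℝ 1 φ) {t c : ℝ} (hf : HasDerivAt f c t) (η : ℝ) :
    HasDerivAt (fun t => φ (f t + η, t)) (pdt φ (f t + η, t) + pdx φ (f t + η, t) * c) t := by
  have h1 := (hφ.differentiable one_ne_zero (f t + η, t)).hasFDerivAt
  have h2 : HasDerivAt (fun t => (f t + η, t)) (c, (1 : ℝ)) t :=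
    (hf.add_const η).prodMk (hasDerivAt_id t)
  have h3 := HasFDerivAt.comp_hasDerivAt (f := fun t => (f t + η, t)) t h1 h2
  have h4 : fderiv ℝ φ (f t + η, t) (c, 1) = pdt φ (f t + η, t) + pdx φ (f t + η, t) * c := by
    have : ((c, 1) : ℝ × ℝ) = (0, 1) + c • (1, 0) := by simp
    rw [this, map_add, map_smul, pdt, pdx, smul_eq_mul, mul_comm]
  rw [← h4]
  exact h3

/-- The test function along a translated Lipschitz curve is Lipschitz, hence absolutely continuous,
and vanishes for large times. Differentiability of the curve is needed only almost everywhere. -/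
lemma integral_deriv_comp_curve (hφ : ContDiff ℝ 1 φ) (hc : HasCompactSupport φ)
    (hf : LipschitzWith K f) (η : ℝ) :
    ∫ t, (pdt φ (f t + η, t) + pdx φ (f t + η, t) * deriv f t) = 0 := by
  set ψ : ℝ → ℝ := fun t => φ (f t + η, t) with hψ
  obtain ⟨C, hC⟩ := hφ.lipschitzWith_of_hasCompactSupport hc one_ne_zero
  have hlip : LipschitzWith (C * max (K + 0) 1) ψ :=
    hC.comp ((hf.add (LipschitzWith.const η)).prodMk LipschitzWith.id)
  obtain ⟨R, hR⟩ := exists_tsupport_bound hc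
  have hψ0 : ∀ t, R < |t| → ψ t = 0 := fun t ht =>
    image_eq_zero_of_notMem_tsupport (f := φ) (hR (f t + η, t) (Or.inr ht))
  have hd0 : ∀ t, R < |t| → deriv ψ t = 0 := fun t ht => by
    have : ψ =ᶠ[𝓝 t] fun _ => 0 := by
      filter_upwards [(continuous_abs.tendsto t).eventually (lt_mem_nhds ht)] with τ hτ
      exact hψ0 τ hτ
    rw [this.deriv_eq, deriv_const]
  have h1 : ∫ t, (pdt φ (f t + η, t) + pdx φ (f t + η, t) * deriv f t) = ∫ t, deriv ψ t := by
    refine integral_congr_ae ?_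
    filter_upwards [hf.ae_differentiableAt] with t ht
    exact (hasDerivAt_comp_curve hφ ht.hasDerivAt η).deriv.symm
  have hT : R < |R| + 1 := by linarith [le_abs_self R]
  have hT1 : |(|R| + 1)| = |R| + 1 := abs_of_pos (by positivity)
  rw [h1, ← intervalIntegral.integral_eq_integral_of_support_subset
    (a := -(|R| + 1)) (b := |R| + 1),
    (hlip.lipschitzOnWith (s := uIcc (-(|R| + 1)) (|R| + 1))).absolutelyContinuousOnInterval.integral_deriv_eq_sub,
    hψ0 _ (by rwa [hT1]), hψ0 _ (by rwa [abs_neg, hT1]), sub_zero]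
  intro t ht
  have : |t| ≤ R := by
    by_contra! h
    exact ht (hd0 t h)
  have := abs_le.1 this
  exact ⟨by linarith [le_abs_self R], by linarith [le_abs_self R]⟩

lemma integrable_comp_curve (hc : HasCompactSupport φ) (hf : Continuous f) {D : ℝ × ℝ → ℝ}
    (hD : Continuous D) (h0 : ∀ p, p ∉ tsupport φ → D p = 0) :
    Integrable fun z : ℝ × ℝ => D (f z.1 + z.2, z.1) := by
  obtain ⟨R, hR⟩ := exists_tsupport_bound hc
  obtain ⟨M, hM⟩ := (isCompact_Icc (a := -R) (b := R)).exists_bound_of_continuousOn hf.continuousOn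
  refine Continuous.integrable_of_hasCompactSupport (by fun_prop)
    (HasCompactSupport.intro ((isCompact_Icc (a := -R) (b := R)).prod
      (isCompact_Icc (a := -R - M) (b := R + M))) fun z hz => h0 _ fun hs => hz ?_)
  have h2 : |z.1| ≤ R := by
    by_contra! h
    exact hR _ (Or.inr h) hs
  have h1 : |f z.1 + z.2| ≤ R := by
    by_contra! h
    exact hR _ (Or.inl h) hs
  have h3 := hM z.1 (abs_le.1 h2)
  rw [Real.norm_eq_abs] at h3
  rw [abs_le] at h1 h3
  exact ⟨abs_le.1 h2, by constructor <;> linarith⟩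

lemma integrable_comp_curve_slice (hc : HasCompactSupport φ) (hf : Continuous f) {D : ℝ × ℝ → ℝ}
    (hD : Continuous D) (h0 : ∀ p, p ∉ tsupport φ → D p = 0) (η : ℝ) :
    Integrable fun t : ℝ => D (f t + η, t) := by
  obtain ⟨R, hR⟩ := exists_tsupport_bound hc
  refine Continuous.integrable_of_hasCompactSupport (by fun_prop)
    (HasCompactSupport.intro (isCompact_Icc (a := -R) (b := R)) fun z hz => h0 _ fun hs => hz ?_)
  have h2 : |z| ≤ R := by
    by_contra! h
    exact hR _ (Or.inr h) hs
  exact abs_le.1 h2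

lemma Integrable.mul_deriv_lipschitz {α : Type*} [MeasurableSpace α] {μ : Measure α} {h : α → ℝ}
    {τ : α → ℝ} (hτ : Measurable τ) (hh : Integrable h μ) (hf : LipschitzWith K f) :
    Integrable (fun z => h z * deriv f (τ z)) μ := by
  refine (hh.mul_const (K : ℝ)).mono
    (hh.aestronglyMeasurable.mul ((measurable_deriv f).comp hτ).aestronglyMeasurable)
    (Eventually.of_forall fun z => ?_)
  rw [norm_mul, norm_mul]
  gcongr
  simpa using norm_deriv_le_of_lipschitz hf

/-- Green's formula to the right of a Lipschitz curve. -/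
lemma integral_pdt_right (hφ : ContDiff ℝ 1 φ) (hc : HasCompactSupport φ)
    (hf : LipschitzWith K f) :
    ∫ t, ∫ x in Ioi (f t), pdt φ (x, t) = ∫ t, φ (f t, t) * deriv f t := by
  have hpt := continuous_pdt hφ
  have hpx := continuous_pdx hφ
  have hres : (volume : Measure ℝ).prod ((volume : Measure ℝ).restrict (Ioi 0)) =
      (volume : Measure (ℝ × ℝ)).restrict (univ ×ˢ Ioi 0) := by
    rw [Measure.volume_eq_prod, ← Measure.prod_restrict, Measure.restrict_univ]
  -- The coordinate `η = x - f t` straightens the region into a half-plane. On each translate of the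
  -- curve the time derivative is traded for the space derivative, which then integrates out in `η`.
  have h1 : ∀ t, ∫ x in Ioi (f t), pdt φ (x, t) = ∫ η in Ioi (0 : ℝ), pdt φ (f t + η, t) := by
    intro t
    rw [← integral_indicator measurableSet_Ioi, ← integral_indicator measurableSet_Ioi,
      ← integral_add_left_eq_self _ (f t)]
    congr 1
    ext η
    by_cases hη : 0 < η <;> simp [indicator, hη]
  have i1 := integrable_comp_curve hc hf.continuous hpt fun p hp => pdt_eq_zero hp
  have i2 := integrable_comp_curve hc hf.continuous hpx fun p hp => pdx_eq_zero hp
  have i3 := Integrable.mul_deriv_lipschitz measurable_fst i2 hf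
  have h2 : ∀ η, ∫ t, pdt φ (f t + η, t) = -∫ t, pdx φ (f t + η, t) * deriv f t := by
    intro η
    have j1 := integrable_comp_curve_slice hc hf.continuous hpt (fun p hp => pdt_eq_zero hp) η
    have j2 : Integrable fun t => pdx φ (f t + η, t) * deriv f t :=
      Integrable.mul_deriv_lipschitz measurable_id
        (integrable_comp_curve_slice hc hf.continuous hpx (fun p hp => pdx_eq_zero hp) η) hf
    have := integral_deriv_comp_curve hφ hc hf η
    rw [integral_add j1 j2] at this
    linarith
  have h3 : ∀ t, ∫ η in Ioi (0 : ℝ), pdx φ (f t + η, t) = -φ (f t, t) := by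
    intro t
    have hline : ContDiff ℝ 1 fun η : ℝ => (f t + η, t) :=
      (contDiff_const.add contDiff_id).prodMk contDiff_const
    have hcs : HasCompactSupport fun η => φ (f t + η, t) := by
      obtain ⟨R, hR⟩ := exists_tsupport_bound hc
      refine HasCompactSupport.intro (isCompact_Icc (a := -R - f t) (b := R - f t)) fun η hη =>
        image_eq_zero_of_notMem_tsupport fun hs => hη ?_
      have : |f t + η| ≤ R := by
        by_contra! h
        exact hR _ (Or.inl h) hs
      rw [abs_le] at this
      constructor <;> linarith
    have := hcs.integral_Ioi_deriv_eq (hφ.comp hline) 0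
    rw [comp_apply, add_zero] at this
    rw [← this]
    refine integral_congr_ae (Eventually.of_forall fun η => ?_)
    have h4 := (hφ.differentiable one_ne_zero (f t + η, t)).hasFDerivAt
    have h5 : HasDerivAt (fun η => (f t + η, t)) ((1 : ℝ), (0 : ℝ)) η :=
      ((hasDerivAt_id η).const_add (f t)).prodMk (hasDerivAt_const η t)
    exact ((h4.comp_hasDerivAt η h5).deriv).symm
  simp only [h1]
  rw [integral_integral_swap (by rw [hres]; exact i1.integrableOn)]
  simp only [h2]
  rw [integral_neg, ← integral_integral_swap (by rw [hres]; exact i3.integrableOn), ← integral_neg]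
  congr 1
  ext t
  rw [integral_mul_const, h3]
  ring

end Curve

end PressurelessGas

end

/-! ### Testing primitives at the selected minimizer against derivatives of test functions. -/

noncomputable section

namespace PressurelessGas

open scoped Topology NNReal

/-- The function `D` vanishes outside of a compact box in the open quadrant. -/
structure BoxSupport (D : ℝ × ℝ → ℝ) (a b T : ℝ) : Prop where
  pos : 0 < a
  le : a ≤ b
  vanish : ∀ p : ℝ × ℝ, D p ≠ 0 → p.1 ∈ Icc a b ∧ p.2 ∈ Ioc 0 T

namespace Flow

open LineGas

variable (g : Flow)

lemma measurable_u_char : Measurable fun z : ℝ × ℝ => g.u (g.char z.2 z.1) z.1 :=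
  g.measurable_u.comp ((g.measurable_char.comp measurable_swap).prodMk measurable_fst)

lemma measurable_flux : Measurable (uncurry g.flux) :=
  g.measurable_u_char.mul (g.measurable_vel.comp measurable_snd)

lemma sel_bounds {x t b : ℝ} (hx : 0 < x) (hxb : x ≤ b) :
    -|t| ≤ g.sel x t ∧ g.sel x t ≤ b + g.speed * |t| := by
  have h := g.argmin_bound ordConnected_univ trivial hx.le (g.sel_mem x t hx)
  exact ⟨h.1, h.2.trans (by linarith)⟩

lemma char_bounds {a b s t : ℝ} (ha : 0 < a) (hab : a ≤ b) (h : g.char s t ∈ Icc a b) :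
    -|t| ≤ s ∧ s ≤ b + g.speed * |t| := by
  have h1 := g.char_mem_Icc ha hab h
  have hb := ha.trans_le hab
  exact ⟨(g.argmin_bound ordConnected_univ trivial ha.le (g.lo_mem ha.le)).1.trans h1.1,
    h1.2.trans (g.argmin_bound ordConnected_univ trivial hb.le (g.hi_mem hb.le)).2⟩

/-- Identifies `1_{s < sel}`, off the curve, with the indicator of the region to the right of the
characteristic, where Green's formula applies. -/
lemma lt_sel_iff {x s t : ℝ} (hx : 0 < x) (h : x ≠ g.char s t) :
    s < g.sel x t ↔ g.char s t < x := by
  constructor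
  · intro h1
    by_contra! h2
    exact (g.le_of_lt_char hx.le (lt_of_le_of_ne h2 h) (g.sel_mem x t hx)).not_gt h1
  · exact fun h1 => g.lt_of_char_lt h1 (g.sel_mem x t hx)

lemma integrable_box {Γ : ℝ × ℝ → ℝ} {a b T C D : ℝ} (hb : BoxSupport Γ a b T) (hΓ : Measurable Γ)
    (hC : ∀ p, |Γ p| ≤ C) {w : ℝ → ℝ → ℝ} (hw : Measurable (uncurry w))
    (hD : ∀ t s, |w t s| ≤ D) :
    Integrable (fun z : ℝ × ℝ => Γ (g.char z.2 z.1, z.1) * w z.1 z.2) (volume.prod g.mu) := by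
  have hm : Measurable fun z : ℝ × ℝ => Γ (g.char z.2 z.1, z.1) * w z.1 z.2 :=
    (hΓ.comp ((g.measurable_char.comp measurable_swap).prodMk measurable_fst)).mul hw
  have h : IntegrableOn (fun z : ℝ × ℝ => Γ (g.char z.2 z.1, z.1) * w z.1 z.2)
      (Icc 0 T ×ˢ Icc (-T) (b + g.speed * T)) (volume.prod g.mu) := by
    refine Measure.integrableOn_of_bounded (M := C * D)
      ((isCompact_Icc.prod isCompact_Icc).measure_lt_top).ne
      hm.aestronglyMeasurable (Eventually.of_forall fun z => ?_)
    rw [Real.norm_eq_abs, abs_mul]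
    exact mul_le_mul (hC _) (hD _ _) (abs_nonneg _) ((abs_nonneg _).trans (hC 0))
  refine (integrableOn_iff_integrable_of_support_subset fun z hz => ?_).1 h
  have h1 := hb.vanish _ (left_ne_zero_of_mul hz)
  have h2 := g.char_bounds hb.pos hb.le h1.1
  have h3 : |z.1| ≤ T := by rw [abs_of_pos h1.2.1]; exact h1.2.2
  have h4 := mul_le_mul_of_nonneg_left h3 g.speed_pos.le
  exact ⟨⟨h1.2.1.le, h1.2.2⟩, by linarith, by linarith⟩

/-- Over a fixed label window the endpoint `σ` enters only through an indicator, which prepares for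
Fubini. -/
lemma prim_sel_eq {w : ℝ → ℝ} (hw : ∀ a b, IntervalIntegrable w g.mu a b) {s0 s1 σ : ℝ}
    (h0 : s0 ≤ σ) (h1 : σ ≤ s1) :
    g.prim w σ = g.prim w s0 + ∫ s in Ioc s0 s1, (if s < σ then w s else 0) ∂g.mu := by
  have h2 : ∫ s in Ioc s0 s1, (if s < σ then w s else 0) ∂g.mu = ∫ s in Ioc s0 σ, w s ∂g.mu := by
    have : (fun s => if s < σ then w s else 0) = (Iio σ).indicator w := by
      ext s; simp [indicator]
    rw [this, setIntegral_indicator measurableSet_Iio]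
    refine setIntegral_congr_set ?_
    filter_upwards [Measure.ae_ne g.mu σ] with s hs
    refine propext ⟨fun h => ⟨h.1.1, le_of_lt h.2⟩, fun h => ⟨⟨h.1, h.2.trans h1⟩,
      lt_of_le_of_ne h.2 hs⟩⟩
  rw [h2, ← intervalIntegral.integral_of_le h0, ← g.prim_sub hw]
  ring

/-- Fubini's theorem for a primitive at the selected minimizer. -/
lemma integral_mul_prim_sel {Ω : Type*} [MeasurableSpace Ω] {ν : Measure Ω} [SFinite ν]
    {X T : Ω → ℝ} (hX : Measurable X) (hT : Measurable T) {D : Ω → ℝ} (hD : Integrable D ν)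
    (hD0 : ∫ y, D y ∂ν = 0) {s0 s1 : ℝ}
    (hs : ∀ y, D y ≠ 0 → s0 ≤ g.sel (X y) (T y) ∧ g.sel (X y) (T y) ≤ s1) {w : ℝ → ℝ} {C : ℝ}
    (hw : Measurable w) (hwC : ∀ s, |w s| ≤ C) :
    ∫ y, D y * g.prim w (g.sel (X y) (T y)) ∂ν =
      ∫ s in Ioc s0 s1, w s * ∫ y, D y * (if s < g.sel (X y) (T y) then 1 else 0) ∂ν ∂g.mu := by
  have hwi := g.intervalIntegrable_bdd hw hwC
  have hwI : IntegrableOn w (Ioc s0 s1) g.mu := by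
    refine Measure.integrableOn_of_bounded (M := C) ?_ hw.aestronglyMeasurable
      (Eventually.of_forall hwC)
    exact ((measure_mono Ioc_subset_Icc_self).trans_lt
      (isCompact_Icc (a := s0) (b := s1)).measure_lt_top).ne
  have hsel : Measurable fun y => g.sel (X y) (T y) := g.measurable_sel.comp (hX.prodMk hT)
  have hset : MeasurableSet {z : Ω × ℝ | z.2 < g.sel (X z.1) (T z.1)} :=
    measurableSet_lt measurable_snd (hsel.comp measurable_fst)
  have hprod : Integrable (uncurry fun y s => D y * (if s < g.sel (X y) (T y) then w s else 0))
      (ν.prod (g.mu.restrict (Ioc s0 s1))) := by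
    have := (hD.mul_prod hwI).indicator hset
    refine this.congr (Eventually.of_forall fun z => ?_)
    by_cases hz : z.2 < g.sel (X z.1) (T z.1) <;> simp [indicator, uncurry, hz]
  have h1 : ∀ y, D y * g.prim w (g.sel (X y) (T y)) = D y * g.prim w s0 +
      ∫ s in Ioc s0 s1, D y * (if s < g.sel (X y) (T y) then w s else 0) ∂g.mu := by
    intro y
    rw [integral_const_mul, ← mul_add]
    by_cases h : D y = 0
    · simp [h]
    · rw [← g.prim_sel_eq hwi (hs y h).1 (hs y h).2]
  have hleft : Integrable (fun y => ∫ s in Ioc s0 s1,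
      D y * (if s < g.sel (X y) (T y) then w s else 0) ∂g.mu) ν := hprod.integral_prod_left
  simp only [h1]
  -- The constant `prim w s0` drops out because `D` has zero integral.
  rw [integral_add (hD.mul_const _) hleft, integral_mul_const, hD0, zero_mul,
    zero_add, integral_integral_swap hprod]
  congr 1
  ext s
  rw [← integral_const_mul]
  congr 1
  ext y
  split_ifs <;> ring

section Test

variable {φ : ℝ × ℝ → ℝ} {a b T : ℝ}

lemma boxSupport_of_tsupport {D : ℝ × ℝ → ℝ} (hb : BoxSupport ((tsupport φ).indicator 1) a b T)
    (h : ∀ p, p ∉ tsupport φ → D p = 0) : BoxSupport D a b T := by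
  refine ⟨hb.pos, hb.le, fun p hp => hb.vanish p ?_⟩
  have : p ∈ tsupport φ := by
    by_contra hc
    exact hp (h p hc)
  simp [this]

lemma boxSupport_self (hb : BoxSupport ((tsupport φ).indicator 1) a b T) : BoxSupport φ a b T :=
  boxSupport_of_tsupport hb fun _ hp => image_eq_zero_of_notMem_tsupport hp

lemma boxSupport_pdx (hb : BoxSupport ((tsupport φ).indicator 1) a b T) :
    BoxSupport (pdx φ) a b T := boxSupport_of_tsupport hb fun _ => pdx_eq_zero

lemma boxSupport_pdt (hb : BoxSupport ((tsupport φ).indicator 1) a b T) :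
    BoxSupport (pdt φ) a b T := boxSupport_of_tsupport hb fun _ => pdt_eq_zero

lemma integrable_of_tsupport (hc : HasCompactSupport φ) {D : ℝ × ℝ → ℝ} (hD : Continuous D)
    (h : ∀ p, p ∉ tsupport φ → D p = 0) : Integrable D :=
  hD.integrable_of_hasCompactSupport (HasCompactSupport.intro hc.isCompact h)

lemma exists_bound_of_tsupport (hc : HasCompactSupport φ) {D : ℝ × ℝ → ℝ} (hD : Continuous D)
    (h : ∀ p, p ∉ tsupport φ → D p = 0) : ∃ C, ∀ p, |D p| ≤ C :=
  hD.bounded_above_of_compact_support (HasCompactSupport.intro hc.isCompact h)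

lemma hasCompactSupport_slice {D : ℝ × ℝ → ℝ} (hb : BoxSupport D a b T) (t : ℝ) :
    HasCompactSupport fun x => D (x, t) :=
  HasCompactSupport.intro (isCompact_Icc (a := a) (b := b)) fun x hx => by
    by_contra h
    exact hx (hb.vanish (x, t) h).1

lemma hasDerivAt_slice (hφ : ContDiff ℝ 1 φ) (x t : ℝ) :
    HasDerivAt (fun x => φ (x, t)) (pdx φ (x, t)) x := by
  have h4 := (hφ.differentiable one_ne_zero (x, t)).hasFDerivAt
  have h5 : HasDerivAt (fun x : ℝ => (x, t)) ((1 : ℝ), (0 : ℝ)) x :=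
    (hasDerivAt_id x).prodMk (hasDerivAt_const x t)
  exact h4.comp_hasDerivAt x h5

lemma integral_pdx_slice_Ioi (hφ : ContDiff ℝ 1 φ)
    (hb : BoxSupport ((tsupport φ).indicator 1) a b T) (c t : ℝ) :
    ∫ x in Ioi c, pdx φ (x, t) = -φ (c, t) := by
  have h1 : ContDiff ℝ 1 fun x : ℝ => φ (x, t) := hφ.comp (contDiff_id.prodMk contDiff_const)
  rw [← (hasCompactSupport_slice (boxSupport_self hb) t).integral_Ioi_deriv_eq h1 c]
  exact integral_congr_ae (Eventually.of_forall fun x => (hasDerivAt_slice hφ x t).deriv.symm)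

lemma integral_pdx_slice (hφ : ContDiff ℝ 1 φ)
    (hb : BoxSupport ((tsupport φ).indicator 1) a b T) (t : ℝ) :
    ∫ x, pdx φ (x, t) = 0 := by
  have h1 : Continuous fun x => pdx φ (x, t) :=
    (continuous_pdx hφ).comp (continuous_id.prodMk continuous_const)
  have h2 : Continuous fun x : ℝ => φ (x, t) :=
    hφ.continuous.comp (continuous_id.prodMk continuous_const)
  exact integral_eq_zero_of_hasDerivAt_of_integrable (fun x => hasDerivAt_slice hφ x t)
    (h1.integrable_of_hasCompactSupport (hasCompactSupport_slice (boxSupport_pdx hb) t))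
    (h2.integrable_of_hasCompactSupport (hasCompactSupport_slice (boxSupport_self hb) t))

lemma integral_pdt (hφ : ContDiff ℝ 1 φ) (hc : HasCompactSupport φ) :
    ∫ p, pdt φ p = 0 := by
  have h := integrable_of_tsupport hc (continuous_pdt hφ) fun _ => pdt_eq_zero
  rw [Measure.volume_eq_prod] at h ⊢
  rw [integral_prod _ h]
  have : ∀ x, ∫ t, pdt φ (x, t) = 0 := fun x => by
    have := integral_deriv_comp_curve hφ hc (LipschitzWith.const (0 : ℝ)) x
    simpa using this
  simp [this]

/-- Integration by parts in space. -/
lemma integral_pdx_mul_prim (hφ : ContDiff ℝ 1 φ)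
    (hb : BoxSupport ((tsupport φ).indicator 1) a b T) (t : ℝ) {w : ℝ → ℝ} {C : ℝ}
    (hw : Measurable w) (hwC : ∀ s, |w s| ≤ C) :
    ∫ x, pdx φ (x, t) * g.prim w (g.sel x t) = -∫ s, φ (g.char s t, t) * w s ∂g.mu := by
  have hbx := boxSupport_pdx hb
  have hcont : Continuous fun x => pdx φ (x, t) :=
    (continuous_pdx hφ).comp (continuous_id.prodMk continuous_const)
  have hint := hcont.integrable_of_hasCompactSupport (μ := volume) (hasCompactSupport_slice hbx t)
  -- Relevant labels are only known to satisfy `-|t| ≤ s`; subtracting one makes the half-open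
  -- window contain them all.
  rw [g.integral_mul_prim_sel (s0 := -|t| - 1) (s1 := b + g.speed * |t|) (X := fun x => x) measurable_id
       (measurable_const (a := t)) hint (integral_pdx_slice hφ hb t) (fun x hx => ?_) hw hwC]
  · have h1 : ∀ s, ∫ x, pdx φ (x, t) * (if s < g.sel x t then 1 else 0) =
        -φ (g.char s t, t) := by
      intro s
      rw [← integral_pdx_slice_Ioi hφ hb, ← integral_indicator measurableSet_Ioi]
      refine integral_congr_ae ?_
      filter_upwards [Measure.ae_ne volume (g.char s t)] with x hx
      by_cases h0 : pdx φ (x, t) = 0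
      · simp [h0, indicator]
      · have := g.lt_sel_iff (s := s) (t := t) (hb.pos.trans_le (hbx.vanish _ h0).1.1) hx
        by_cases h1 : g.char s t < x <;> simp [indicator, this, h1]
    simp only [h1]
    rw [← MeasureTheory.integral_neg, setIntegral_eq_integral_of_forall_compl_eq_zero]
    · congr 1
      ext s
      ring
    · intro s hs
      by_contra hne
      have h2 := neg_ne_zero.1 (right_ne_zero_of_mul hne)
      have h3 := g.char_bounds hb.pos hb.le ((boxSupport_self hb).vanish _ h2).1
      exact hs ⟨by linarith, h3.2⟩
  · have h2 := (hbx.vanish _ hx).1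
    have h3 := g.sel_bounds (t := t) (hb.pos.trans_le h2.1) h2.2
    exact ⟨by linarith, h3.2⟩

lemma integral_comp_char_deriv (hb : BoxSupport φ a b T) (s : ℝ) :
    ∫ t, φ (g.char s t, t) * deriv (g.char s) t =
      ∫ t, φ (g.char s t, t) * g.u (g.char s t) t := by
  refine integral_congr_ae ?_
  filter_upwards [g.ae_deriv_char s] with t ht
  by_cases h0 : φ (g.char s t, t) = 0
  · simp [h0]
  · have h1 := hb.vanish _ h0
    simp only [(ht h1.2.1 (hb.pos.trans_le h1.1.1)).deriv]

/-- Transport of the primitive of `w` along the characteristics. -/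
lemma integral_pdt_mul_prim (hφ : ContDiff ℝ 1 φ) (hc : HasCompactSupport φ)
    (hb : BoxSupport ((tsupport φ).indicator 1) a b T) {w : ℝ → ℝ} {C : ℝ}
    (hw : Measurable w) (hwC : ∀ s, |w s| ≤ C) :
    ∫ p : ℝ × ℝ, pdt φ p * g.prim w (g.sel p.1 p.2) =
      ∫ t, ∫ s, φ (g.char s t, t) * (g.u (g.char s t) t * w s) ∂g.mu := by
  have hbt := boxSupport_pdt hb
  have hint := integrable_of_tsupport hc (continuous_pdt hφ) fun _ => pdt_eq_zero
  obtain ⟨C', hC'⟩ := exists_bound_of_tsupport hc hφ.continuous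
    fun _ => image_eq_zero_of_notMem_tsupport
  rw [g.integral_mul_prim_sel (s0 := -T - 1) (s1 := b + g.speed * T) measurable_fst
    measurable_snd hint (integral_pdt hφ hc) (fun p hp => ?_) hw hwC]
  · have h1 : ∀ s, ∫ p : ℝ × ℝ, pdt φ p * (if s < g.sel p.1 p.2 then 1 else 0) =
        ∫ t, φ (g.char s t, t) * g.u (g.char s t) t := by
      intro s
      -- The region `s < sel` lies to the right of `char s`; Green's formula leaves `φ * char'` on
      -- the curve, and `char'` is the velocity there.
      rw [← g.integral_comp_char_deriv (boxSupport_self hb), ← integral_pdt_right hφ hc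
        (g.lipschitz_char s), Measure.volume_eq_prod, integral_prod_symm]
      · congr 1
        ext t
        rw [← integral_indicator measurableSet_Ioi]
        refine integral_congr_ae ?_
        filter_upwards [Measure.ae_ne volume (g.char s t)] with x hx
        by_cases h0 : pdt φ (x, t) = 0
        · simp [h0, indicator]
        · have := g.lt_sel_iff (s := s) (t := t) (hb.pos.trans_le (hbt.vanish _ h0).1.1) hx
          by_cases h1 : g.char s t < x <;> simp [indicator, this, h1]
      · have hset : MeasurableSet {p : ℝ × ℝ | s < g.sel p.1 p.2} :=
          measurableSet_lt measurable_const g.measurable_sel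
        rw [← Measure.volume_eq_prod]
        refine (hint.indicator hset).congr (Eventually.of_forall fun p => ?_)
        by_cases hz : s < g.sel p.1 p.2 <;> simp [indicator, hz]
    simp only [h1]
    rw [setIntegral_eq_integral_of_forall_compl_eq_zero, integral_integral_swap]
    · congr 1
      ext s
      rw [← integral_const_mul]
      congr 1
      ext t
      ring
    · exact g.integrable_box (boxSupport_self hb) hφ.continuous.measurable hC'
        (w := fun t s => g.u (g.char s t) t * w s) (D := g.speed * C)
        (g.measurable_u_char.mul (hw.comp measurable_snd)) fun t s => by
          rw [abs_mul]
          exact mul_le_mul (g.abs_u_le _ _) (hwC s) (abs_nonneg _) g.speed_pos.le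
    · intro s hs
      have : ∀ t, φ (g.char s t, t) = 0 := fun t => by
        by_contra hne
        have h2 := (boxSupport_self hb).vanish _ hne
        have h3 := g.char_bounds hb.pos hb.le h2.1
        have h4 : |t| ≤ T := by rw [abs_of_pos h2.2.1]; exact h2.2.2
        have h5 := mul_le_mul_of_nonneg_left h4 g.speed_pos.le
        exact hs ⟨by linarith, by linarith⟩
      simp [this]
  · have h2 := hbt.vanish _ hp
    have h3 := g.sel_bounds (t := p.2) (hb.pos.trans_le h2.1.1) h2.1.2
    have h4 : |p.2| ≤ T := by rw [abs_of_pos h2.2.1]; exact h2.2.2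
    have h5 := mul_le_mul_of_nonneg_left h4 g.speed_pos.le
    exact ⟨by linarith, by linarith⟩

end Test

end Flow

end PressurelessGas

end

/-! ### Measurability, local bounds and weak identities in label space. -/

noncomputable section

namespace PressurelessGas

open scoped Topology NNReal

lemma exists_box_of_isCompact {K : Set (ℝ × ℝ)} (hK : IsCompact K) (hq : K ⊆ quadrant) :
    ∃ a b T : ℝ, 0 < a ∧ a ≤ b ∧ ∀ p ∈ K, p.1 ∈ Icc a b ∧ p.2 ∈ Ioc 0 T := by
  rcases K.eq_empty_or_nonempty with rfl | hne
  · exact ⟨1, 1, 1, one_pos, le_rfl, by simp⟩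
  obtain ⟨p, hp, hpm⟩ := hK.exists_isMinOn hne continuous_fst.continuousOn
  obtain ⟨q, hqK, hqm⟩ := hK.exists_isMaxOn hne continuous_fst.continuousOn
  obtain ⟨r, hr, hrm⟩ := hK.exists_isMaxOn hne continuous_snd.continuousOn
  exact ⟨p.1, q.1, r.2, (hq hp).1, hpm hqK, fun z hz => ⟨⟨hpm hz, hqm hz⟩, (hq hz).2, hrm hz⟩⟩

namespace Flow

open LineGas

variable (g : Flow)

/-- The oriented integral is split by the sign of its endpoint into integrals of jointly measurable
indicators. -/
lemma measurable_prim_sel {w : ℝ → ℝ → ℝ} (hw : Measurable (uncurry w)) :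
    Measurable fun p : ℝ × ℝ => g.prim (w p.2) (g.sel p.1 p.2) := by
  have hsel : Measurable fun z : (ℝ × ℝ) × ℝ => g.sel z.1.1 z.1.2 :=
    g.measurable_sel.comp measurable_fst
  have hwm : Measurable fun z : (ℝ × ℝ) × ℝ => w z.1.2 z.2 :=
    hw.comp ((measurable_snd.comp measurable_fst).prodMk measurable_snd)
  have h1 : MeasurableSet {z : (ℝ × ℝ) × ℝ | 0 < z.2 ∧ z.2 ≤ g.sel z.1.1 z.1.2} :=
    (measurableSet_lt measurable_const measurable_snd).inter
      (measurableSet_le measurable_snd hsel)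
  have h2 : MeasurableSet {z : (ℝ × ℝ) × ℝ | g.sel z.1.1 z.1.2 < z.2 ∧ z.2 ≤ 0} :=
    (measurableSet_lt hsel measurable_snd).inter (measurableSet_le measurable_snd measurable_const)
  have h3 := ((hwm.indicator h1).stronglyMeasurable.integral_prod_right' (ν := g.mu)).measurable
  have h4 := ((hwm.indicator h2).stronglyMeasurable.integral_prod_right' (ν := g.mu)).measurable
  convert h3.sub h4 using 1
  ext p
  simp only [prim, intervalIntegral, Pi.sub_apply]
  rw [← integral_indicator measurableSet_Ioc, ← integral_indicator measurableSet_Ioc]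
  rfl

lemma abs_prim_le {w : ℝ → ℝ} {C : ℝ} (hwC : ∀ s, |w s| ≤ C) (σ : ℝ) :
    |g.prim w σ| ≤ C * |g.mass σ| := by
  have h := intervalIntegral.norm_integral_le_abs_of_norm_le (μ := g.mu) (f := w)
    (g := fun _ => C * 1) (a := 0) (b := σ) (Eventually.of_forall fun s => by simpa using hwC s)
    ((g.intervalIntegrable_const 1 _ _).const_mul C)
  rw [intervalIntegral.integral_const_mul, abs_mul,
    abs_of_nonneg ((abs_nonneg _).trans (hwC 0))] at h
  exact h

lemma exists_bound_prim_sel {a b T C : ℝ} (ha : 0 < a) {w : ℝ → ℝ → ℝ}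
    (hwC : ∀ t s, |w t s| ≤ C) :
    ∃ D, ∀ p : ℝ × ℝ, p.1 ∈ Icc a b → p.2 ∈ Ioc 0 T →
      |g.prim (w p.2) (g.sel p.1 p.2)| ≤ D := by
  obtain ⟨D, hD⟩ := (isCompact_Icc (a := -T) (b := b + g.speed * T)).exists_bound_of_continuousOn
    g.continuous_mass.continuousOn
  refine ⟨C * D, fun p hp1 hp2 => (g.abs_prim_le (hwC p.2) _).trans ?_⟩
  have h1 := g.sel_bounds (t := p.2) (ha.trans_le hp1.1) hp1.2
  rw [abs_of_pos hp2.1] at h1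
  have h2 := mul_le_mul_of_nonneg_left hp2.2 g.speed_pos.le
  have h3 := hp2.2
  exact mul_le_mul_of_nonneg_left (hD _ ⟨by linarith, by linarith⟩)
    ((abs_nonneg _).trans (hwC 0 0))

lemma isLocallyBoundedMeasurable_prim {w : ℝ → ℝ → ℝ} {C : ℝ} (hw : Measurable (uncurry w))
    (hwC : ∀ t s, |w t s| ≤ C) {n : ℝ → ℝ → ℝ}
    (hn : ∀ x t, 0 < x → 0 < t → n x t = g.prim (w t) (g.sel x t)) :
    IsLocallyBoundedMeasurable n := by
  constructor
  · convert (g.measurable_prim_sel hw).comp measurable_subtype_coe using 1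
    ext p
    exact hn _ _ p.2.1 p.2.2
  · intro K hK hq
    obtain ⟨a, b, T, ha, -, h⟩ := exists_box_of_isCompact hK hq
    obtain ⟨D, hD⟩ := g.exists_bound_prim_sel (b := b) (T := T) ha hwC
    refine ⟨D, fun p hp => ?_⟩
    rw [hn _ _ (hq hp).1 (hq hp).2]
    exact hD p (h p hp).1 (h p hp).2

lemma isLocallyBoundedMeasurable_velocity {u : ℝ → ℝ → ℝ}
    (hu : ∀ x t, 0 < x → 0 < t → u x t = g.u x t) : IsLocallyBoundedMeasurable u := by
  constructor
  · convert g.measurable_u.comp measurable_subtype_coe using 1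
    ext p
    exact hu _ _ p.2.1 p.2.2
  · refine fun K hK hq => ⟨g.speed, fun p hp => ?_⟩
    rw [hu _ _ (hq hp).1 (hq hp).2]
    exact g.abs_u_le _ _

lemma integral_rho {f : ℝ → ℝ} (hf : Measurable f) (h0 : ∀ x, x ≤ 0 → f x = 0) (t : ℝ) :
    ∫ x, f x ∂g.rho t = ∫ s, f (g.char s t) ∂g.mu := by
  unfold rho
  rw [integral_map (g.measurable_char_left t).aemeasurable hf.aestronglyMeasurable,
    setIntegral_eq_integral_of_forall_compl_eq_zero]
  exact fun s hs => h0 _ (not_lt.1 hs)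

lemma integrable_rho {f : ℝ → ℝ} (hf : Measurable f) {t : ℝ}
    (h : Integrable (fun s => f (g.char s t)) g.mu) : Integrable f (g.rho t) := by
  unfold rho
  rw [integrable_map_measure hf.aestronglyMeasurable (g.measurable_char_left t).aemeasurable]
  exact h.integrableOn

section Test

variable {φ : ℝ × ℝ → ℝ} {a b T : ℝ}

lemma slice_eq_zero {Γ : ℝ × ℝ → ℝ} (hb : BoxSupport Γ a b T) {t : ℝ} (ht : t ≤ 0) (x : ℝ) :
    Γ (x, t) = 0 := by
  by_contra h
  exact (hb.vanish _ h).2.1.not_ge ht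

lemma integral_vel_eq {Γ : ℝ × ℝ → ℝ} {C : ℝ} (hb : BoxSupport Γ a b T) (hΓ : Measurable Γ)
    (hC : ∀ p, |Γ p| ≤ C) (t : ℝ) :
    ∫ s, Γ (g.char s t, t) * g.vel s ∂g.mu =
      ∫ s, Γ (g.char s t, t) * g.u (g.char s t) t ∂g.mu := by
  rcases le_or_gt t 0 with ht | ht
  · simp [slice_eq_zero hb ht]
  have hG : Measurable fun x => Γ (x, t) := hΓ.comp (measurable_id.prodMk measurable_const)
  have hG0 : ∀ x, x ∉ Icc a b → Γ (x, t) = 0 := fun x hx => by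
    by_contra h
    exact hx (hb.vanish _ h).1
  have h := g.integral_vel_sub_u ht hb.pos hb.le hG (fun x => hC (x, t)) hG0
  have h1 := g.integrable_comp_char (t := t) hb.pos hb.le hG g.measurable_vel
    (fun x => hC (x, t)) g.abs_vel_le hG0
  have h2 := g.integrable_comp_char (t := t) hb.pos hb.le hG (g.measurable_u_char_left t)
    (fun x => hC (x, t)) (fun s => g.abs_u_le _ _) hG0
  simp only [mul_sub] at h
  rwa [integral_sub h1 h2, sub_eq_zero] at h

lemma integrable_mul_prim (hc : HasCompactSupport φ)
    (hb : BoxSupport ((tsupport φ).indicator 1) a b T) {D : ℝ × ℝ → ℝ} (hD : Continuous D)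
    (h0 : ∀ p, p ∉ tsupport φ → D p = 0) {w : ℝ → ℝ → ℝ} {C : ℝ} (hw : Measurable (uncurry w))
    (hwC : ∀ t s, |w t s| ≤ C) :
    Integrable fun p : ℝ × ℝ => D p * g.prim (w p.2) (g.sel p.1 p.2) := by
  obtain ⟨R, hR⟩ := g.exists_bound_prim_sel (b := b) (T := T) hb.pos hwC
  refine ((integrable_of_tsupport hc hD h0).mul_const R).mono
    (hD.measurable.mul (g.measurable_prim_sel hw)).aestronglyMeasurable
    (Eventually.of_forall fun p => ?_)
  rw [norm_mul, norm_mul]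
  by_cases h : D p = 0
  · simp [h]
  have h1 := (boxSupport_of_tsupport hb h0).vanish p h
  exact mul_le_mul_of_nonneg_left ((hR p h1.1 h1.2).trans (le_abs_self R)) (norm_nonneg _)

lemma integral_pdx_mul_prim_prod (hφ : ContDiff ℝ 1 φ) (hc : HasCompactSupport φ)
    (hb : BoxSupport ((tsupport φ).indicator 1) a b T) {w : ℝ → ℝ → ℝ} {C : ℝ}
    (hw : Measurable (uncurry w)) (hwC : ∀ t s, |w t s| ≤ C) :
    ∫ p : ℝ × ℝ, pdx φ p * g.prim (w p.2) (g.sel p.1 p.2) =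
      ∫ t, -∫ s, φ (g.char s t, t) * w t s ∂g.mu := by
  have h := g.integrable_mul_prim hc hb (continuous_pdx hφ) (fun _ => pdx_eq_zero) hw hwC
  rw [Measure.volume_eq_prod] at h ⊢
  rw [integral_prod_symm _ h]
  congr 1
  ext t
  exact g.integral_pdx_mul_prim hφ hb t (hw.comp (measurable_const.prodMk measurable_id))
    (fun s => hwC t s)

/-- The time term gives `φ * u`, the space term `-φ * vel`; they cancel because `u` is the
conditional mean of `vel`. -/
lemma weak_mass (hφ : ContDiff ℝ 1 φ) (hc : HasCompactSupport φ)
    (hb : BoxSupport ((tsupport φ).indicator 1) a b T) :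
    ∫ p : ℝ × ℝ, (pdt φ p * g.mass (g.sel p.1 p.2) + pdx φ p * g.mom (g.sel p.1 p.2)) = 0 := by
  obtain ⟨C, hC⟩ := exists_bound_of_tsupport hc hφ.continuous
    fun _ => image_eq_zero_of_notMem_tsupport
  have h1 := g.integrable_mul_prim hc hb (continuous_pdt hφ) (fun _ => pdt_eq_zero)
    (w := fun _ _ => 1) (C := 1) measurable_const (by simp)
  have h2 := g.integrable_mul_prim hc hb (continuous_pdx hφ) (fun _ => pdx_eq_zero)
    (w := fun _ => g.vel) (g.measurable_vel.comp measurable_snd) (fun _ => g.abs_vel_le)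
  have h3 := g.integral_pdt_mul_prim hφ hc hb (w := fun _ => 1) (C := 1) measurable_const (by simp)
  have h4 := g.integral_pdx_mul_prim_prod hφ hc hb
    (w := fun _ => g.vel) (g.measurable_vel.comp measurable_snd) (fun _ => g.abs_vel_le)
  simp only [LineGas.mass, LineGas.mom]
  rw [integral_add h1 h2, h3, h4]
  simp only [g.integral_vel_eq (boxSupport_self hb) hφ.continuous.measurable hC, mul_one]
  rw [MeasureTheory.integral_neg, add_neg_cancel]

/-- Here no averaging is needed: transport of `vel` along the characteristics produces exactly the
density `flux`. -/
lemma weak_momentum (hφ : ContDiff ℝ 1 φ) (hc : HasCompactSupport φ)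
    (hb : BoxSupport ((tsupport φ).indicator 1) a b T) :
    ∫ p : ℝ × ℝ, (pdt φ p * g.mom (g.sel p.1 p.2) +
      pdx φ p * g.prim (g.flux p.2) (g.sel p.1 p.2)) = 0 := by
  have h1 := g.integrable_mul_prim hc hb (continuous_pdt hφ) (fun _ => pdt_eq_zero)
    (w := fun _ => g.vel) (g.measurable_vel.comp measurable_snd) (fun _ => g.abs_vel_le)
  have h2 := g.integrable_mul_prim hc hb (continuous_pdx hφ) (fun _ => pdx_eq_zero)
    g.measurable_flux g.abs_flux_le
  have h3 := g.integral_pdt_mul_prim hφ hc hb g.measurable_vel g.abs_vel_le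
  have h4 := g.integral_pdx_mul_prim_prod hφ hc hb g.measurable_flux g.abs_flux_le
  simp only [LineGas.mom]
  rw [integral_add h1 h2, h3, h4]
  rw [MeasureTheory.integral_neg]
  exact add_neg_cancel _

/-- The velocity field transports test functions along the characteristics. -/
lemma integral_transport (hφ : ContDiff ℝ 1 φ) (hc : HasCompactSupport φ)
    (hb : BoxSupport ((tsupport φ).indicator 1) a b T) :
    ∫ t, ∫ s, (pdt φ (g.char s t, t) + pdx φ (g.char s t, t) * g.u (g.char s t) t) * g.vel s
      ∂g.mu = 0 := by
  obtain ⟨C1, hC1⟩ := exists_bound_of_tsupport hc (continuous_pdt hφ) fun _ => pdt_eq_zero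
  obtain ⟨C2, hC2⟩ := exists_bound_of_tsupport hc (continuous_pdx hφ) fun _ => pdx_eq_zero
  have i1 := g.integrable_box (boxSupport_pdt hb) (continuous_pdt hφ).measurable hC1
    (w := fun _ => g.vel) (g.measurable_vel.comp measurable_snd) (fun _ => g.abs_vel_le)
  have i2 := g.integrable_box (boxSupport_pdx hb) (continuous_pdx hφ).measurable hC2
    g.measurable_flux g.abs_flux_le
  have i3 : Integrable (uncurry fun t s => (pdt φ (g.char s t, t) +
      pdx φ (g.char s t, t) * g.u (g.char s t) t) * g.vel s) (volume.prod g.mu) := by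
    refine (i1.add i2).congr (Eventually.of_forall fun z => ?_)
    simp only [uncurry, Pi.add_apply, flux]
    ring
  rw [integral_integral_swap i3]
  have h : ∀ s, ∫ t, (pdt φ (g.char s t, t) + pdx φ (g.char s t, t) * g.u (g.char s t) t) *
      g.vel s = 0 := by
    intro s
    rw [integral_mul_const]
    have h1 := integral_deriv_comp_curve hφ hc (g.lipschitz_char s) 0
    simp only [add_zero] at h1
    have j1 := integrable_comp_curve_slice hc (g.continuous_char s) (continuous_pdt hφ)
      (fun _ => pdt_eq_zero) 0
    have j2 : Integrable fun t => pdx φ (g.char s t + 0, t) * deriv (g.char s) t :=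
      Integrable.mul_deriv_lipschitz measurable_id (integrable_comp_curve_slice hc
        (g.continuous_char s) (continuous_pdx hφ) (fun _ => pdx_eq_zero) 0) (g.lipschitz_char s)
    have h2 : ∫ t, (pdt φ (g.char s t, t) + pdx φ (g.char s t, t) * g.u (g.char s t) t) =
        ∫ t, (pdt φ (g.char s t, t) + pdx φ (g.char s t, t) * deriv (g.char s) t) := by
      refine integral_congr_ae ?_
      filter_upwards [g.ae_deriv_char s] with t ht
      by_cases h0 : pdx φ (g.char s t, t) = 0
      · simp [h0]
      · have h1 := (boxSupport_pdx hb).vanish _ h0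
        simp only [(ht h1.2.1 (hb.pos.trans_le h1.1.1)).deriv]
    rw [h2, h1, zero_mul]
  simp [h]

end Test

end Flow

end PressurelessGas

end

/-! ### The equations for a general flow. -/

noncomputable section

namespace PressurelessGas

open scoped Topology NNReal

lemma Test.contDiff_one (φ : Test) : ContDiff ℝ 1 φ := φ.contDiff.of_le (by simp)

lemma Test.exists_boxSupport (φ : Test) :
    ∃ a b T : ℝ, BoxSupport ((tsupport φ).indicator 1) a b T := by
  obtain ⟨a, b, T, ha, hab, h⟩ := exists_box_of_isCompact φ.hasCompactSupport.isCompact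
    φ.tsupport_subset
  exact ⟨a, b, T, ha, hab, fun p hp => h p (mem_of_indicator_ne_zero hp)⟩

lemma Test.setIntegral_quadrant (φ : Test) {F G : ℝ × ℝ → ℝ}
    (hFG : ∀ p : ℝ × ℝ, 0 < p.1 → 0 < p.2 → F p = G p) (h0 : ∀ p, p ∉ tsupport φ → G p = 0) :
    ∫ p in (quadrant : Set (ℝ × ℝ)), F p = ∫ p, G p := by
  rw [setIntegral_congr_fun quadrant.isOpen.measurableSet fun p hp => hFG p hp.1 hp.2,
    setIntegral_eq_integral_of_forall_compl_eq_zero]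
  exact fun p hp => h0 p fun h => hp (φ.tsupport_subset h)

namespace Flow

open LineGas

variable (g : Flow)

lemma integral_rho_box {Γ : ℝ × ℝ → ℝ} {a b T C : ℝ} (hb : BoxSupport Γ a b T)
    (hΓ : Measurable Γ) (hC : ∀ p, |Γ p| ≤ C) {F : ℝ → ℝ → ℝ}
    (hF : ∀ x t, 0 < t → F x t = Γ (x, t)) :
    ((∀ᵐ t : ℝ, 0 < t → Integrable (fun x => F x t) (g.rho t)) ∧
      IntegrableOn (fun t => ∫ x, F x t ∂g.rho t) (Ioi 0)) ∧
      ∫ t in Ioi (0 : ℝ), ∫ x, F x t ∂g.rho t = ∫ t, ∫ s, Γ (g.char s t, t) ∂g.mu := by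
  have hsl : ∀ t, Measurable fun x => Γ (x, t) := fun t =>
    hΓ.comp (measurable_id.prodMk measurable_const)
  have h0 : ∀ t x, x ≤ 0 → Γ (x, t) = 0 := fun t x hx => by
    by_contra h
    exact (hb.pos.trans_le (hb.vanish _ h).1.1).not_ge hx
  have h1 : ∀ t ∈ Ioi (0 : ℝ), ∫ x, F x t ∂g.rho t = ∫ s, Γ (g.char s t, t) ∂g.mu :=
    fun t ht => by
      rw [← g.integral_rho (hsl t) (h0 t) t]
      simp only [hF _ t ht]
  have h2 := g.integrable_box hb hΓ hC (w := fun _ _ => 1) (D := 1) measurable_const (by simp)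
  simp only [mul_one] at h2
  refine ⟨⟨Eventually.of_forall fun t ht => ?_, ?_⟩, ?_⟩
  · simp only [hF _ t ht]
    refine g.integrable_rho (hsl t) ?_
    have := g.integrable_comp_char (t := t) hb.pos hb.le (hsl t) (w := fun _ => 1) (D := 1)
      measurable_const (fun x => hC (x, t)) (by simp) fun x hx => by
        by_contra h
        exact hx (hb.vanish _ h).1
    simpa using this
  · have h3 : Integrable fun t => ∫ s, Γ (g.char s t, t) ∂g.mu := h2.integral_prod_left
    exact h3.integrableOn.congr_fun (fun t ht => (h1 t ht).symm) measurableSet_Ioi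
  · rw [setIntegral_congr_fun measurableSet_Ioi h1,
      setIntegral_eq_integral_of_forall_compl_eq_zero]
    intro t ht
    simp [slice_eq_zero hb (not_lt.1 ht)]

/-- The velocity and the primitives at the selected minimizers solve the equations of pressureless
gas dynamics. -/
theorem isSolution {u m q E : ℝ → ℝ → ℝ} (hu : ∀ x t, 0 < x → 0 < t → u x t = g.u x t)
    (hm : ∀ x t, 0 < x → 0 < t → m x t = g.mass (g.sel x t))
    (hq : ∀ x t, 0 < x → 0 < t → q x t = g.mom (g.sel x t))
    (hE : ∀ x t, 0 < x → 0 < t → E x t = 1 / 2 * g.prim (g.flux t) (g.sel x t)) :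
    (∀ t : ℝ, 0 < t → IsStieltjesMeasure (fun x => m x t) (g.rho t)) ∧
    IsGeneralizedSolution u m g.rho ∧
    IsWeakSolution m q ∧
    IsWeakSolution q (fun x t => 2 * E x t) ∧
    (∀ t : ℝ, 0 < t → HasStieltjesDensity (fun x => q x t) (fun x => u x t) (g.rho t)) ∧
    (∀ t : ℝ, 0 < t → HasStieltjesDensity (fun x => E x t)
      (fun x => 1 / 2 * u x t ^ 2) (g.rho t)) := by
  have hst : ∀ t : ℝ, 0 < t → IsStieltjesMeasure (fun x => m x t) (g.rho t) :=
    fun t ht => g.isStieltjesMeasure fun x hx => hm x t hx ht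
  have hml : IsLocallyBoundedMeasurable m := g.isLocallyBoundedMeasurable_prim
    (w := fun _ _ => 1) (C := 1) measurable_const (by simp) hm
  have hql : IsLocallyBoundedMeasurable q := g.isLocallyBoundedMeasurable_prim
    (w := fun _ => g.vel) (g.measurable_vel.comp measurable_snd) (fun _ => g.abs_vel_le) hq
  have hE2 : ∀ x t, 0 < x → 0 < t → 2 * E x t = g.prim (g.flux t) (g.sel x t) :=
    fun x t hx ht => by rw [hE x t hx ht]; ring
  have hmu : Measurable fun p : ℝ × ℝ => g.u p.1 p.2 := g.measurable_u
  refine ⟨hst, ⟨g.isLocallyBoundedMeasurable_velocity hu, hml, Eventually.of_forall hst,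
    fun φ => ?_, fun φ => ?_, fun φ => ?_, fun φ => ?_⟩, ⟨hml, hql, fun φ => ?_⟩,
    ⟨hql, g.isLocallyBoundedMeasurable_prim g.measurable_flux g.abs_flux_le hE2, fun φ => ?_⟩,
    fun t ht => g.hasStieltjesDensity_mom ht (fun x hx => hq x t hx ht) fun x hx => hu x t hx ht,
    fun t ht => g.hasStieltjesDensity_flux ht (fun x hx => hE x t hx ht)
      fun x hx => by rw [hu x t hx ht]⟩
  all_goals
    obtain ⟨a, b, T, hb⟩ := φ.exists_boxSupport
    have hφ := φ.contDiff_one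
    have hc := φ.hasCompactSupport
    obtain ⟨C, hC⟩ := exists_bound_of_tsupport hc hφ.continuous
      fun _ => image_eq_zero_of_notMem_tsupport
    obtain ⟨C1, hC1⟩ := exists_bound_of_tsupport hc (continuous_pdt hφ) fun _ => pdt_eq_zero
    obtain ⟨C2, hC2⟩ := exists_bound_of_tsupport hc (continuous_pdx hφ) fun _ => pdx_eq_zero
    have hb1 : BoxSupport (fun p => φ p * g.u p.1 p.2) a b T :=
      boxSupport_of_tsupport hb fun p hp => by simp [image_eq_zero_of_notMem_tsupport hp]
    have key1 := g.integral_rho_box hb1 (hφ.continuous.measurable.mul hmu) (C := C * g.speed)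
      (fun p => by
        rw [abs_mul]
        exact mul_le_mul (hC p) (g.abs_u_le _ _) (abs_nonneg _) ((abs_nonneg _).trans (hC p)))
      (F := fun x t => φ (x, t) * u x t) (fun x t ht => by
        rcases le_or_gt x 0 with hx | hx
        · have : φ (x, t) = 0 := by
            by_contra h
            exact (hb.pos.trans_le ((boxSupport_self hb).vanish _ h).1.1).not_ge hx
          simp [this]
        · simp only [hu x t hx ht])
    have hb2 : BoxSupport (fun p => pdt φ p + pdx φ p * g.u p.1 p.2) a b T :=
      boxSupport_of_tsupport hb fun p hp => by simp [pdt_eq_zero hp, pdx_eq_zero hp]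
    have hm2 : Measurable (fun p : ℝ × ℝ => pdt φ p + pdx φ p * g.u p.1 p.2) :=
      (continuous_pdt hφ).measurable.add ((continuous_pdx hφ).measurable.mul hmu)
    have hC3 : ∀ p : ℝ × ℝ, |pdt φ p + pdx φ p * g.u p.1 p.2| ≤ C1 + C2 * g.speed := fun p => by
      refine (abs_add_le _ _).trans (add_le_add (hC1 p) ?_)
      rw [abs_mul]
      exact mul_le_mul (hC2 p) (g.abs_u_le _ _) (abs_nonneg _) ((abs_nonneg _).trans (hC2 p))
    have hb3 : BoxSupport (fun p => (pdt φ p + pdx φ p * g.u p.1 p.2) * g.u p.1 p.2) a b T :=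
      boxSupport_of_tsupport hb fun p hp => by simp [pdt_eq_zero hp, pdx_eq_zero hp]
    have key2 := g.integral_rho_box hb3 (hm2.mul hmu) (C := (C1 + C2 * g.speed) * g.speed)
      (fun p => by
        rw [abs_mul]
        exact mul_le_mul (hC3 p) (g.abs_u_le _ _) (abs_nonneg _) ((abs_nonneg _).trans (hC3 p)))
      (F := fun x t => φ.dt (x, t) * u x t + φ.dx (x, t) * u x t ^ 2) (fun x t ht => by
        rcases le_or_gt x 0 with hx | hx
        · have : (x, t) ∉ tsupport φ := fun h => (φ.tsupport_subset h).1.not_ge hx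
          simp only [Test.dt, Test.dx]
          have h1 := pdt_eq_zero this
          have h2 := pdx_eq_zero this
          simp only [pdt, pdx] at h1 h2 ⊢
          simp [h1, h2]
        · simp only [hu x t hx ht, Test.dt, Test.dx, pdt, pdx]
          ring)
  · exact key1.1
  · rw [key1.2, φ.setIntegral_quadrant (G := fun p => pdt φ p * g.mass (g.sel p.1 p.2))
      (fun p h1 h2 => by rw [hm _ _ h1 h2]; rfl) (fun p hp => by simp [pdt_eq_zero hp])]
    have h3 := g.integral_pdt_mul_prim hφ hc hb (w := fun _ => 1) (C := 1) measurable_const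
      (by simp)
    simp only [mul_one] at h3
    simp only [LineGas.mass, h3, sub_self]
  · exact key2.1
  -- In `(φ_t + φ_x u) u` the last factor is replaced by `vel`, which is constant along each
  -- characteristic; what remains is a total time derivative.
  · rw [key2.2, ← g.integral_transport hφ hc hb]
    congr 1
    ext t
    exact (g.integral_vel_eq hb2 hm2 hC3 t).symm
  · rw [φ.setIntegral_quadrant (G := fun p => pdt φ p * g.mass (g.sel p.1 p.2) +
      pdx φ p * g.mom (g.sel p.1 p.2)) (fun p h1 h2 => by rw [hm _ _ h1 h2, hq _ _ h1 h2]; rfl)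
      (fun p hp => by simp [pdt_eq_zero hp, pdx_eq_zero hp])]
    exact g.weak_mass hφ hc hb
  · rw [φ.setIntegral_quadrant (G := fun p => pdt φ p * g.mom (g.sel p.1 p.2) +
      pdx φ p * g.prim (g.flux p.2) (g.sel p.1 p.2))
      (fun p h1 h2 => by rw [hE2 _ _ h1 h2, hq _ _ h1 h2]; rfl)
      (fun p hp => by simp [pdt_eq_zero hp, pdx_eq_zero hp])]
    exact g.weak_momentum hφ hc hb

end Flow

end PressurelessGas

end

/-! ### From the data to a gas on the line. -/

noncomputable section

namespace PressurelessGas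

open scoped Topology NNReal

lemma ae_comp_neg {p : ℝ → Prop} (h : ∀ᵐ s : ℝ, p s) : ∀ᵐ s : ℝ, p (-s) :=
  (Measure.measurePreserving_neg (volume : Measure ℝ)).quasiMeasurePreserving.ae h

/-- The line gas `g` carries the data `d`. -/
structure LineGas.Represents (g : LineGas) (d : GasData) : Prop where
  dens_pos : ∀ᵐ s : ℝ, 0 < s → g.dens s = d.rho0 s
  vel_pos : ∀ᵐ s : ℝ, 0 < s → g.vel s = d.u0 s
  dens_neg : ∀ᵐ s : ℝ, 0 < s → g.dens (-s) = d.rhoB s * d.uB s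
  vel_neg : ∀ᵐ s : ℝ, 0 < s → g.vel (-s) = d.uB s

/-- Changing the data on a null set gives Borel functions satisfying the bounds everywhere.
Integrals, hence potentials and minimizers, do not notice. -/
lemma exists_measurable_representative {f : ℝ → ℝ} (hf : AEMeasurable f (volume.restrict (Ioi 0)))
    {A : Set ℝ} (hA : A.Nonempty) (h : ∀ᵐ s : ℝ, 0 < s → f s ∈ A) :
    ∃ f' : ℝ → ℝ, Measurable f' ∧ (∀ s, f' s ∈ A) ∧ ∀ᵐ s : ℝ, 0 < s → f' s = f s := by
  obtain ⟨f', h1, h2, h3⟩ := hf.exists_ae_eq_range_subset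
    ((ae_restrict_iff' measurableSet_Ioi).2 h) hA
  refine ⟨f', h1, fun s => h2 (mem_range_self s), ?_⟩
  filter_upwards [(ae_restrict_iff' measurableSet_Ioi).1 h3] with s hs h0 using (hs h0).symm

theorem GasData.Admissible.exists_lineGas {d : GasData} (hd : d.Admissible) :
    ∃ g : LineGas, g.Represents d := by
  obtain ⟨hu0m, C0, hC0⟩ := hd.u0_bounded
  obtain ⟨huBm, CB, hCB⟩ := hd.uB_bounded
  obtain ⟨v0, v0m, v0b, v0e⟩ := exists_measurable_representative hu0m
    (A := Icc (-max C0 0) (max C0 0)) ⟨0, by simp, by simp⟩ (by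
      filter_upwards [hC0] with s hs h
      exact abs_le.1 ((hs h).trans (le_max_left _ _)))
  -- The maximum with `1` makes the range nonempty, since the given bound `CB` is not assumed
  -- positive.
  obtain ⟨vB, vBm, vBb, vBe⟩ := exists_measurable_representative huBm
    (A := Ioc 0 (max CB 1)) ⟨1, one_pos, le_max_right _ _⟩ (by
      filter_upwards [hCB, hd.uB_pos] with s hs h1 h
      exact ⟨h1 h, (le_abs_self _).trans ((hs h).trans (le_max_left _ _))⟩)
  obtain ⟨r0, r0m, r0b, r0e⟩ := exists_measurable_representative hd.rho0_bounded.1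
    (A := Ioi 0) ⟨1, mem_Ioi.2 one_pos⟩ hd.rho0_pos
  obtain ⟨rB, rBm, rBb, rBe⟩ := exists_measurable_representative hd.rhoB_bounded.1
    (A := Ioi 0) ⟨1, mem_Ioi.2 one_pos⟩ hd.rhoB_pos
  have hdm : Measurable fun s : ℝ => if 0 < s then r0 s else rB (-s) * vB (-s) :=
    Measurable.ite measurableSet_Ioi r0m ((rBm.comp measurable_neg).mul (vBm.comp measurable_neg))
  refine ⟨⟨fun s => if 0 < s then r0 s else rB (-s) * vB (-s),
    fun s => if 0 < s then v0 s else vB (-s), max (max C0 0) (max CB 1), hdm,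
    Measurable.ite measurableSet_Ioi v0m (vBm.comp measurable_neg), fun s => ?_, ?_, fun s => ?_,
    fun s hs => ?_⟩, ?_, ?_, ?_, ?_⟩
  · split_ifs
    · exact r0b s
    · exact mul_pos (rBb _) (vBb _).1
  · refine locallyIntegrable_iff.2 fun K hK => ?_
    obtain ⟨R, hR⟩ := hK.isBounded.subset_closedBall 0
    obtain ⟨A, hA⟩ := hd.rho0_bounded.2 R
    obtain ⟨B, hB⟩ := hd.rhoB_bounded.2 R
    refine Measure.integrableOn_of_bounded (M := max A (B * max CB 1)) hK.measure_lt_top.ne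
      hdm.aestronglyMeasurable ((ae_restrict_iff' hK.measurableSet).2 ?_)
    filter_upwards [hA, r0e, ae_comp_neg hB, ae_comp_neg rBe, Measure.ae_ne volume (0 : ℝ)]
      with s h1 h2 h3 h4 h5 hs
    have h6 : |s| ≤ R := by simpa using hR hs
    rw [abs_le] at h6
    split_ifs with h
    · rw [h2 h]
      exact (h1 h h6.2).trans (le_max_left _ _)
    · have h7 : 0 < -s := by
        have := lt_of_le_of_ne (not_lt.1 h) h5
        linarith
      rw [norm_mul, h4 h7]
      refine le_trans ?_ (le_max_right _ _)
      have h8 : ‖vB (-s)‖ ≤ max CB 1 := by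
        rw [Real.norm_eq_abs, abs_of_pos (vBb _).1]
        exact (vBb _).2
      have h9 := h3 h7 (by linarith)
      exact mul_le_mul h9 h8 (norm_nonneg _) ((abs_nonneg _).trans h9)
  · split_ifs
    · exact (abs_le.2 (v0b s)).trans (le_max_left _ _)
    · rw [abs_of_pos (vBb _).1]
      exact (vBb _).2.trans (le_max_right _ _)
  · simp only [hs.not_gt, if_false]
    exact (vBb _).1
  · filter_upwards [r0e] with s hs h
    simp only [h, if_true, hs h]
  · filter_upwards [v0e] with s hs h
    simp only [h, if_true, hs h]
  · filter_upwards [rBe, vBe] with s h1 h2 h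
    have : ¬ 0 < -s := by linarith
    simp only [this, if_false, neg_neg, h1 h, h2 h]
  · filter_upwards [vBe] with s h2 h
    have : ¬ 0 < -s := by linarith
    simp only [this, if_false, neg_neg, h2 h]

namespace LineGas

variable (g : LineGas)

lemma integral_eq_of_ae_pos {f w : ℝ → ℝ} {a b : ℝ} (hab : a ≤ b)
    (h : ∀ᵐ s : ℝ, s ∈ Ioc a b → f s = g.dens s * w s) :
    ∫ s in a..b, f s = ∫ s in a..b, w s ∂g.mu := by
  rw [g.intervalIntegral_mu]
  refine intervalIntegral.integral_congr_ae ?_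
  rwa [uIoc_of_le hab]

lemma integral_eq_of_ae_neg {f w : ℝ → ℝ} {a b : ℝ} (hab : a ≤ b)
    (h : ∀ᵐ s : ℝ, s ∈ Ioc a b → f s = g.dens (-s) * w (-s)) :
    ∫ s in a..b, f s = ∫ s in -b..-a, w s ∂g.mu := by
  rw [g.intervalIntegral_mu, ← intervalIntegral.integral_comp_neg fun s => g.dens s * w s]
  refine intervalIntegral.integral_congr_ae ?_
  rwa [uIoc_of_le hab]

lemma prim_eq_of_ae_pos {f w : ℝ → ℝ} {b : ℝ} (hb : 0 ≤ b)
    (h : ∀ᵐ s : ℝ, s ∈ Ioc 0 b → f s = g.dens s * w s) :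
    ∫ s in (0 : ℝ)..b, f s = g.prim w b := g.integral_eq_of_ae_pos hb h

lemma prim_eq_of_ae_neg {f w : ℝ → ℝ} {b : ℝ} (hb : 0 ≤ b)
    (h : ∀ᵐ s : ℝ, s ∈ Ioc 0 b → f s = g.dens (-s) * w (-s)) :
    ∫ s in (0 : ℝ)..b, f s = -g.prim w (-b) := by
  rw [g.integral_eq_of_ae_neg hb h, prim, neg_zero, intervalIntegral.integral_symm]

end LineGas

end PressurelessGas

end

/-! ### Half-line minimizers versus global minimizers. -/

noncomputable section

namespace PressurelessGas

open scoped Topology NNReal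

namespace LineGas.Represents

variable {g : LineGas} {d : GasData}

lemma potF_eq (h : g.Represents d) {y : ℝ} (hy : 0 ≤ y) (x t : ℝ) :
    d.potF y x t = g.pot y x t := by
  refine g.prim_eq_of_ae_pos hy ?_
  filter_upwards [h.dens_pos, h.vel_pos] with s h1 h2 hs
  rw [← h1 hs.1, ← h2 hs.1, kern, offset, if_pos hs.1]
  ring

/-- Two signs cancel: the integrand of `G` is minus `kern` times the density, and the interval is
traversed backwards. -/
lemma potG_eq (h : g.Represents d) {τ : ℝ} (hτ : 0 ≤ τ) (x t : ℝ) :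
    d.potG τ x t = g.pot (-τ) x t := by
  have h1 := g.prim_eq_of_ae_neg (f := fun η => (x - d.uB η * (t - η)) * d.rhoB η * d.uB η)
    (w := fun s => -g.kern x t s) hτ (by
      filter_upwards [h.dens_neg, h.vel_neg] with s h1 h2 hs
      have h3 : ¬ 0 < -s := by linarith [hs.1]
      rw [mul_assoc, ← h1 hs.1, ← h2 hs.1, kern, offset, if_neg h3]
      ring)
  rw [GasData.potG, h1, pot, prim, prim, intervalIntegral.integral_neg, neg_neg]

lemma argminF_eq (h : g.Represents d) (x t : ℝ) : d.argminF x t = g.argmin (Ici 0) x t := by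
  ext y
  refine ⟨fun hy => ⟨hy.1, fun z hz => ?_⟩, fun hy => ⟨hy.1, fun z hz => ?_⟩⟩
  · rw [← h.potF_eq hy.1, ← h.potF_eq hz]
    exact hy.2 z hz
  · rw [h.potF_eq hy.1, h.potF_eq hz]
    exact hy.2 z hz

lemma argminG_eq (h : g.Represents d) (x t : ℝ) : d.argminG x t = -g.argmin (Iic 0) x t := by
  ext y
  refine ⟨fun hy => ⟨neg_nonpos.2 hy.1, fun z hz => ?_⟩, fun hy => ?_⟩
  · have hz' : 0 ≤ -z := neg_nonneg.2 hz
    have := hy.2 (-z) hz'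
    rwa [h.potG_eq hy.1, h.potG_eq hz', neg_neg] at this
  · have hy0 : 0 ≤ y := neg_nonpos.1 hy.1
    refine ⟨hy0, fun z hz => ?_⟩
    rw [h.potG_eq hy0, h.potG_eq hz]
    exact hy.2 (-z) (neg_nonpos.2 hz)

lemma yLow_eq (h : g.Represents d) (x t : ℝ) : d.yLow x t = sInf (g.argmin (Ici 0) x t) := by
  rw [GasData.yLow, h.argminF_eq]

lemma yUp_eq (h : g.Represents d) (x t : ℝ) : d.yUp x t = sSup (g.argmin (Ici 0) x t) := by
  rw [GasData.yUp, h.argminF_eq]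

lemma tauLow_eq (h : g.Represents d) (x t : ℝ) :
    d.tauLow x t = -sSup (g.argmin (Iic 0) x t) := by
  rw [GasData.tauLow, h.argminG_eq, Real.sInf_neg]

lemma tauUp_eq (h : g.Represents d) (x t : ℝ) :
    d.tauUp x t = -sInf (g.argmin (Iic 0) x t) := by
  rw [GasData.tauUp, h.argminG_eq, Real.sSup_neg]

lemma yLow_mem (h : g.Represents d) {x t : ℝ} (hx : 0 ≤ x) :
    d.yLow x t ∈ g.argmin (Ici 0) x t :=
  h.yLow_eq x t ▸ g.sInf_argmin_mem ordConnected_Ici isClosed_Ici self_mem_Ici hx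

lemma yUp_mem (h : g.Represents d) {x t : ℝ} (hx : 0 ≤ x) :
    d.yUp x t ∈ g.argmin (Ici 0) x t :=
  h.yUp_eq x t ▸ g.sSup_argmin_mem ordConnected_Ici isClosed_Ici self_mem_Ici hx

lemma tauLow_mem (h : g.Represents d) {x t : ℝ} (hx : 0 ≤ x) :
    -d.tauLow x t ∈ g.argmin (Iic 0) x t := by
  rw [h.tauLow_eq, neg_neg]
  exact g.sSup_argmin_mem ordConnected_Iic isClosed_Iic self_mem_Iic hx

lemma tauUp_mem (h : g.Represents d) {x t : ℝ} (hx : 0 ≤ x) :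
    -d.tauUp x t ∈ g.argmin (Iic 0) x t := by
  rw [h.tauUp_eq, neg_neg]
  exact g.sInf_argmin_mem ordConnected_Iic isClosed_Iic self_mem_Iic hx

lemma minF_eq (h : g.Represents d) {x t y : ℝ} (hy : y ∈ g.argmin (Ici 0) x t) :
    d.minF x t = g.pot y x t := by
  refine IsLeast.csInf_eq ⟨⟨y, hy.1, h.potF_eq hy.1 x t⟩, ?_⟩
  rintro _ ⟨z, hz, rfl⟩
  simp only [h.potF_eq hz]
  exact hy.2 z hz

lemma minG_eq (h : g.Represents d) {x t σ : ℝ} (hσ : σ ∈ g.argmin (Iic 0) x t) :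
    d.minG x t = g.pot σ x t := by
  have h0 : 0 ≤ -σ := neg_nonneg.2 hσ.1
  refine IsLeast.csInf_eq ⟨⟨-σ, h0, by simp only [h.potG_eq h0, neg_neg]⟩, ?_⟩
  rintro _ ⟨z, hz, rfl⟩
  simp only [h.potG_eq hz]
  exact hσ.2 (-z) (show -z ≤ 0 from neg_nonpos.2 (mem_Ici.1 hz))

lemma mem_argmin_of_le (h : g.Represents d) {x t y : ℝ} (hx : 0 ≤ x)
    (hle : d.minF x t ≤ d.minG x t) (hy : y ∈ g.argmin (Ici 0) x t) : y ∈ g.argmin univ x t := by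
  refine ⟨trivial, fun z _ => ?_⟩
  rcases le_total 0 z with hz | hz
  · exact hy.2 z hz
  · have h1 := h.tauLow_mem (t := t) hx
    rw [h.minF_eq hy, h.minG_eq h1] at hle
    exact hle.trans (h1.2 z hz)

lemma mem_argmin_of_ge (h : g.Represents d) {x t σ : ℝ} (hx : 0 ≤ x)
    (hle : d.minG x t ≤ d.minF x t) (hσ : σ ∈ g.argmin (Iic 0) x t) : σ ∈ g.argmin univ x t := by
  refine ⟨trivial, fun z _ => ?_⟩
  rcases le_total 0 z with hz | hz
  · have h1 := h.yLow_mem (t := t) hx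
    rw [h.minG_eq hσ, h.minF_eq h1] at hle
    exact hle.trans (h1.2 z hz)
  · exact hσ.2 z hz

lemma le_of_mem_argmin (h : g.Represents d) {x t σ : ℝ} (hx : 0 ≤ x) (h0 : 0 ≤ σ)
    (hσ : σ ∈ g.argmin univ x t) : d.minF x t ≤ d.minG x t := by
  have h1 := h.tauLow_mem (t := t) hx
  rw [h.minF_eq ⟨h0, fun z _ => hσ.2 z trivial⟩, h.minG_eq h1]
  exact hσ.2 _ trivial

lemma ge_of_mem_argmin (h : g.Represents d) {x t σ : ℝ} (hx : 0 ≤ x) (h0 : σ ≤ 0)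
    (hσ : σ ∈ g.argmin univ x t) : d.minG x t ≤ d.minF x t := by
  have h1 := h.yLow_mem (t := t) hx
  rw [h.minG_eq ⟨h0, fun z _ => hσ.2 z trivial⟩, h.minF_eq h1]
  exact hσ.2 _ trivial

/-- Strictness matters: at a tie the leftmost global minimizer is `-tauUp`, whereas `hi_eq_yUp` also
holds at a tie. -/
lemma lo_eq_yLow (h : g.Represents d) {x t : ℝ} (hx : 0 ≤ x) (hlt : d.minF x t < d.minG x t) :
    g.lo x t = d.yLow x t := by
  have h1 := g.lo_mem (t := t) hx
  have h0 : 0 ≤ g.lo x t := by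
    by_contra! h2
    exact (h.ge_of_mem_argmin hx h2.le h1).not_gt hlt
  refine le_antisymm (g.lo_le hx (h.mem_argmin_of_le hx hlt.le (h.yLow_mem hx))) ?_
  rw [h.yLow_eq]
  exact csInf_le ⟨0, fun z hz => hz.1⟩ ⟨h0, fun z _ => h1.2 z trivial⟩

lemma hi_eq_yUp (h : g.Represents d) {x t : ℝ} (hx : 0 ≤ x) (hle : d.minF x t ≤ d.minG x t) :
    g.hi x t = d.yUp x t := by
  have h1 := g.hi_mem (t := t) hx
  have h2 := h.yUp_mem (t := t) hx
  have h3 := g.le_hi hx (h.mem_argmin_of_le hx hle h2)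
  refine le_antisymm ?_ h3
  rw [h.yUp_eq]
  exact le_csSup (g.isCompact_argmin ordConnected_Ici isClosed_Ici self_mem_Ici hx).bddAbove
    ⟨le_trans h2.1 h3, fun z _ => h1.2 z trivial⟩

lemma hi_eq_neg_tauLow (h : g.Represents d) {x t : ℝ} (hx : 0 ≤ x)
    (hlt : d.minG x t < d.minF x t) : g.hi x t = -d.tauLow x t := by
  have h1 := g.hi_mem (t := t) hx
  have h0 : g.hi x t ≤ 0 := by
    by_contra! h2
    exact (h.le_of_mem_argmin hx h2.le h1).not_gt hlt
  refine le_antisymm ?_ (g.le_hi hx (h.mem_argmin_of_ge hx hlt.le (h.tauLow_mem hx)))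
  rw [h.tauLow_eq, neg_neg]
  exact le_csSup ⟨0, fun z hz => hz.1⟩ ⟨h0, fun z _ => h1.2 z trivial⟩

lemma lo_eq_neg_tauUp (h : g.Represents d) {x t : ℝ} (hx : 0 ≤ x)
    (hle : d.minG x t ≤ d.minF x t) : g.lo x t = -d.tauUp x t := by
  have h1 := g.lo_mem (t := t) hx
  have h2 := h.tauUp_mem (t := t) hx
  have h3 := g.lo_le hx (h.mem_argmin_of_ge hx hle h2)
  refine le_antisymm h3 ?_
  rw [h.tauUp_eq, neg_neg]
  exact csInf_le (g.isCompact_argmin ordConnected_Iic isClosed_Iic self_mem_Iic hx).bddBelow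
    ⟨h3.trans h2.1, fun z _ => h1.2 z trivial⟩

lemma integral_rho0 (h : g.Represents d) {a b : ℝ} (ha : 0 ≤ a) (hab : a ≤ b) :
    ∫ η in a..b, d.rho0 η = g.mass b - g.mass a := by
  rw [g.mass_sub]
  refine g.integral_eq_of_ae_pos hab ?_
  filter_upwards [h.dens_pos] with s h1 hs
  rw [h1 (ha.trans_lt hs.1), mul_one]

lemma integral_rho0_u0 (h : g.Represents d) {a b : ℝ} (ha : 0 ≤ a) (hab : a ≤ b) :
    ∫ η in a..b, d.rho0 η * d.u0 η = g.mom b - g.mom a := by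
  rw [g.mom_sub]
  refine g.integral_eq_of_ae_pos hab ?_
  filter_upwards [h.dens_pos, h.vel_pos] with s h1 h2 hs
  rw [h1 (ha.trans_lt hs.1), h2 (ha.trans_lt hs.1)]

lemma integral_rhoB (h : g.Represents d) {a b : ℝ} (ha : 0 ≤ a) (hab : a ≤ b) :
    ∫ η in a..b, d.rhoB η * d.uB η = g.mass (-a) - g.mass (-b) := by
  rw [g.mass_sub]
  refine g.integral_eq_of_ae_neg hab ?_
  filter_upwards [h.dens_neg] with s h1 hs
  rw [h1 (ha.trans_lt hs.1), mul_one]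

lemma integral_rhoB_uB (h : g.Represents d) {a b : ℝ} (ha : 0 ≤ a) (hab : a ≤ b) :
    ∫ η in a..b, d.rhoB η * d.uB η ^ 2 = g.mom (-a) - g.mom (-b) := by
  rw [g.mom_sub]
  refine g.integral_eq_of_ae_neg hab ?_
  filter_upwards [h.dens_neg, h.vel_neg] with s h1 h2 hs
  rw [h1 (ha.trans_lt hs.1), h2 (ha.trans_lt hs.1)]
  ring

lemma mass_zero : g.mass 0 = 0 := by simp [LineGas.mass, prim]

lemma mom_zero : g.mom 0 = 0 := by simp [LineGas.mom, prim]

lemma tauLow_nonneg (h : g.Represents d) {x t : ℝ} (hx : 0 ≤ x) : 0 ≤ d.tauLow x t :=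
  neg_nonpos.1 (h.tauLow_mem hx).1

lemma tauUp_nonneg (h : g.Represents d) {x t : ℝ} (hx : 0 ≤ x) : 0 ≤ d.tauUp x t :=
  neg_nonpos.1 (h.tauUp_mem hx).1

/-- The velocity is the one given by the global minimizers. -/
lemma velocity_eq (h : g.Represents d) {x t : ℝ} (hx : 0 ≤ x)
    (hx' : 0 < x ∨ x = 0 ∧ d.minF x t = d.minG x t) : d.velocity x t = g.velo x t := by
  have hle := g.lo_le_hi (t := t) hx
  have e1 : ¬ (x = 0 ∧ d.minG x t < d.minF x t) := by
    rintro ⟨h1, h2⟩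
    rcases hx' with h3 | h3
    · exact h3.ne' h1
    · exact h2.ne' h3.2
  have e2 : ¬ (x = 0 ∧ d.minF x t < d.minG x t) := by
    rintro ⟨h1, h2⟩
    rcases hx' with h3 | h3
    · exact h3.ne' h1
    · exact h2.ne h3.2
  rw [GasData.velocity, if_neg e1, if_neg e2, velo]
  rcases lt_trichotomy (d.minF x t) (d.minG x t) with hlt | heq | hlt
  · have hlo := h.lo_eq_yLow hx hlt
    have hhi := h.hi_eq_yUp hx hlt.le
    have h0 : 0 ≤ d.yLow x t := (h.yLow_mem hx).1
    rw [hlo, hhi] at hle ⊢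
    rw [if_pos hlt]
    rcases hle.eq_or_lt with h1 | h1
    · rw [if_pos h1, if_neg h1.not_lt, ray, if_pos h0]
    · rw [if_neg h1.ne, if_pos h1, h.integral_rho0 h0 h1.le, h.integral_rho0_u0 h0 h1.le]
  · have hlo := h.lo_eq_neg_tauUp hx heq.ge
    have hhi := h.hi_eq_yUp hx heq.le
    have h0 : 0 ≤ d.yUp x t := (h.yUp_mem hx).1
    have h0' := h.tauUp_nonneg (t := t) hx
    rw [hlo, hhi] at hle ⊢
    rw [if_neg heq.not_lt, if_neg heq.not_gt]
    by_cases h1 : d.yUp x t = 0 ∧ d.tauUp x t = 0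
    · rw [if_pos h1, h1.1, h1.2]
      simp [ray]
    · have h2 : -d.tauUp x t < d.yUp x t := by
        rcases h0.eq_or_lt with h3 | h3
        · rcases h0'.eq_or_lt with h4 | h4
          · exact absurd ⟨h3.symm, h4.symm⟩ h1
          · linarith
        · linarith
      rw [if_neg h1, if_pos h2, h.integral_rho0 le_rfl h0, h.integral_rho0_u0 le_rfl h0,
        h.integral_rhoB le_rfl h0', h.integral_rhoB_uB le_rfl h0', neg_zero, mass_zero, mom_zero]
      congr 1 <;> ring
  · have hlo := h.lo_eq_neg_tauUp hx hlt.le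
    have hhi := h.hi_eq_neg_tauLow hx hlt
    have h0 := h.tauLow_nonneg (t := t) hx
    rw [hlo, hhi] at hle ⊢
    rw [if_neg hlt.not_gt, if_pos hlt]
    rcases hle.eq_or_lt with h1 | h1
    · have h2 : d.tauLow x t = d.tauUp x t := by linarith
      rw [if_pos h2, if_neg h1.not_lt, ray, ← h2]
      split_ifs with h3
      -- At the label zero the two formulas for the ray coincide.
      · have : d.tauLow x t = 0 := by linarith
        rw [this]
        simp
      · rw [sub_eq_add_neg]
    · have h2 : d.tauLow x t < d.tauUp x t := by linarith
      rw [if_neg h2.ne, if_pos h1, h.integral_rhoB h0 h2.le, h.integral_rhoB_uB h0 h2.le]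

end LineGas.Represents

end PressurelessGas

end

/-! ### The flow of the data, its characteristics and the energy. -/

noncomputable section

namespace PressurelessGas

open scoped Topology NNReal

lemma measurable_ite {α β : Type*} [MeasurableSpace α] [MeasurableSpace β] {p : α → Prop}
    [DecidablePred p] {f g : α → β} (hp : MeasurableSet {a | p a}) (hf : Measurable f)
    (hg : Measurable g) : Measurable fun a => if p a then f a else g a :=
  Measurable.ite hp hf hg

open Classical in
/-- The selected minimizer on the line: `y_*` where `F ≤ G` and `-τ_*` elsewhere. -/
def GasData.sel (d : GasData) (x t : ℝ) : ℝ :=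
  if 0 ≤ x then if d.minF x t ≤ d.minG x t then d.yLow x t else -d.tauLow x t else 0

open Classical in
/-- The velocity, replaced by zero at the points of the `t`-axis where it is prescribed. -/
def GasData.innerVelocity (d : GasData) (x t : ℝ) : ℝ :=
  if 0 < t ∧ (0 < x ∨ x = 0 ∧ d.minF x t = d.minG x t) then d.velocity x t else 0

namespace LineGas.Represents

variable {g : LineGas} {d : GasData}

lemma sel_mem (h : g.Represents d) {x : ℝ} (t : ℝ) (hx : 0 < x) :
    d.sel x t ∈ g.argmin univ x t := by
  rw [GasData.sel, if_pos hx.le]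
  split_ifs with h1
  · exact h.mem_argmin_of_le hx.le h1 (h.yLow_mem hx.le)
  · exact h.mem_argmin_of_ge hx.le (not_le.1 h1).le (h.tauLow_mem hx.le)

lemma measurable_yLow (h : g.Represents d) :
    Measurable fun p : ℝ × ℝ => if 0 ≤ p.1 then d.yLow p.1 p.2 else 0 := by
  simp only [h.yLow_eq]
  exact g.measurable_sInf_argmin ordConnected_Ici isClosed_Ici self_mem_Ici

lemma measurable_tauLow (h : g.Represents d) :
    Measurable fun p : ℝ × ℝ => if 0 ≤ p.1 then -d.tauLow p.1 p.2 else 0 := by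
  simp only [h.tauLow_eq, neg_neg]
  exact g.measurable_sSup_argmin ordConnected_Iic isClosed_Iic self_mem_Iic

lemma measurableSet_nonneg_fst : MeasurableSet {p : ℝ × ℝ | 0 ≤ p.1} :=
  measurableSet_le measurable_const measurable_fst

lemma measurable_minF (h : g.Represents d) :
    Measurable fun p : ℝ × ℝ => if 0 ≤ p.1 then d.minF p.1 p.2 else 0 := by
  have h1 := measurable_ite measurableSet_nonneg_fst (g.continuous_pot.measurable.comp
    (h.measurable_yLow.prodMk (measurable_fst.prodMk measurable_snd)))
    (measurable_const (a := (0 : ℝ)))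
  convert h1 using 2 with p
  split_ifs with hp
  · simp only [Function.comp, hp, if_true]
    exact h.minF_eq (h.yLow_mem hp)
  · rfl

lemma measurable_minG (h : g.Represents d) :
    Measurable fun p : ℝ × ℝ => if 0 ≤ p.1 then d.minG p.1 p.2 else 0 := by
  have h1 := measurable_ite measurableSet_nonneg_fst (g.continuous_pot.measurable.comp
    (h.measurable_tauLow.prodMk (measurable_fst.prodMk measurable_snd)))
    (measurable_const (a := (0 : ℝ)))
  convert h1 using 2 with p
  split_ifs with hp
  · simp only [Function.comp, hp, if_true]
    exact h.minG_eq (h.tauLow_mem hp)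
  · rfl

lemma measurable_sel (h : g.Represents d) : Measurable (uncurry d.sel) := by
  have h1 := measurable_ite (measurableSet_le h.measurable_minF h.measurable_minG)
    h.measurable_yLow h.measurable_tauLow
  convert h1 using 2 with p
  by_cases hp : 0 ≤ p.1 <;> simp [uncurry, GasData.sel, hp]

lemma innerVelocity_eq (h : g.Represents d) {x t : ℝ} (hx : 0 < x) (ht : 0 < t) :
    d.innerVelocity x t = g.velo x t := by
  rw [GasData.innerVelocity, if_pos ⟨ht, Or.inl hx⟩, h.velocity_eq hx.le (Or.inl hx)]

lemma measurable_velo (g : LineGas) :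
    Measurable fun p : ℝ × ℝ => if 0 ≤ p.1 then g.velo p.1 p.2 else 0 := by
  have hlo := g.measurable_sInf_argmin ordConnected_univ isClosed_univ (mem_univ 0)
  have hhi := g.measurable_sSup_argmin ordConnected_univ isClosed_univ (mem_univ 0)
  have h1 := measurable_ite (measurableSet_lt hlo hhi)
    (((g.continuous_mom.measurable.comp hhi).sub (g.continuous_mom.measurable.comp hlo)).div
      ((g.continuous_mass.measurable.comp hhi).sub (g.continuous_mass.measurable.comp hlo)))
    (measurable_ite (measurableSet_le (measurable_const (a := (0 : ℝ))) hlo)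
      ((measurable_fst.sub hlo).div measurable_snd)
      (measurable_fst.div (measurable_snd.add hlo)))
  convert measurable_ite measurableSet_nonneg_fst h1 (measurable_const (a := (0 : ℝ))) using 2
    with p
  by_cases hp : 0 ≤ p.1
  · simp only [velo, ray, lo, hi, hp, if_true, Function.comp, Pi.div_apply, Pi.sub_apply,
      Pi.add_apply]
    congr
  · rw [if_neg hp, if_neg hp]

open Classical in
-- The prescribed `uB` on the axis is bounded and measurable only up to null sets, hence its
-- replacement by zero there.
lemma measurable_innerVelocity (h : g.Represents d) : Measurable (uncurry d.innerVelocity) := by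
  have hS : MeasurableSet {p : ℝ × ℝ | 0 < p.2 ∧ 0 ≤ p.1 ∧ (0 < p.1 ∨ p.1 = 0 ∧
      (if 0 ≤ p.1 then d.minF p.1 p.2 else 0) = if 0 ≤ p.1 then d.minG p.1 p.2 else 0)} :=
    (measurableSet_lt measurable_const measurable_snd).inter
      (measurableSet_nonneg_fst.inter ((measurableSet_lt measurable_const measurable_fst).union
        ((measurableSet_eq_fun measurable_fst measurable_const).inter
          (measurableSet_eq_fun h.measurable_minF h.measurable_minG))))
  convert measurable_ite hS (measurable_velo g) (measurable_const (a := (0 : ℝ))) using 2 with p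
  obtain ⟨x, t⟩ := p
  simp only [uncurry, GasData.innerVelocity]
  rcases lt_or_ge x 0 with hx | hx
  · have h1 : ¬ (0 < x ∨ x = 0 ∧ d.minF x t = d.minG x t) := by
      rintro (h1 | h1) <;> linarith
    simp [h1, hx.not_ge]
  · simp only [hx, if_true, true_and]
    split_ifs with h1
    · exact h.velocity_eq hx h1.2
    · rfl

lemma abs_innerVelocity_le (h : g.Represents d) (x t : ℝ) : |d.innerVelocity x t| ≤ g.speed := by
  unfold GasData.innerVelocity
  split_ifs with h1
  · obtain ⟨ht, hx⟩ := h1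
    rcases hx with hx | ⟨rfl, heq⟩
    · rw [h.velocity_eq hx.le (Or.inl hx)]
      exact g.abs_velo_le hx ht
    · rw [h.velocity_eq le_rfl (Or.inr ⟨rfl, heq⟩), velo]
      split_ifs with h2
      · exact g.abs_slope_le h2.le
      · have h3 := h.lo_eq_neg_tauUp le_rfl heq.ge
        have h4 := h.hi_eq_yUp le_rfl heq.le
        have h5 : 0 ≤ d.yUp 0 t := (h.yUp_mem le_rfl).1
        have h6 := h.tauUp_nonneg (t := t) le_rfl
        have h7 : g.lo 0 t = 0 := by linarith
        simpa [h7, ray] using g.speed_pos.le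
  · simpa using g.speed_pos.le

/-- The flow of the data. -/
def flow (h : g.Represents d) : Flow where
  toLineGas := g
  sel := d.sel
  sel_mem _ t hx := h.sel_mem t hx
  measurable_sel := h.measurable_sel
  u := d.innerVelocity
  measurable_u := h.measurable_innerVelocity
  abs_u_le := h.abs_innerVelocity_le
  u_eq _ _ hx ht := h.innerVelocity_eq hx ht

lemma sel_of_le {x t : ℝ} (hx : 0 < x) (hle : d.minF x t ≤ d.minG x t) :
    d.sel x t = d.yLow x t := by
  rw [GasData.sel, if_pos hx.le, if_pos hle]

lemma sel_of_lt {x t : ℝ} (hx : 0 < x) (hlt : d.minG x t < d.minF x t) :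
    d.sel x t = -d.tauLow x t := by
  rw [GasData.sel, if_pos hx.le, if_neg hlt.not_ge]

lemma mass_eq (h : g.Represents d) {x : ℝ} (t : ℝ) (hx : 0 < x) :
    d.mass x t = g.mass (d.sel x t) := by
  unfold GasData.mass
  rcases le_or_gt (d.minF x t) (d.minG x t) with h1 | h1
  · rw [if_pos ⟨h1, hx⟩, sel_of_le hx h1, h.integral_rho0 le_rfl (h.yLow_mem hx.le).1, mass_zero,
      sub_zero]
  · rw [if_neg fun h2 => h1.not_ge h2.1, sel_of_lt hx h1,
      h.integral_rhoB le_rfl (h.tauLow_nonneg hx.le), neg_zero, mass_zero, zero_sub, neg_neg]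

lemma momentum_eq (h : g.Represents d) {x : ℝ} (t : ℝ) (hx : 0 < x) :
    d.momentum x t = g.mom (d.sel x t) := by
  unfold GasData.momentum
  rcases le_or_gt (d.minF x t) (d.minG x t) with h1 | h1
  · rw [if_pos h1, sel_of_le hx h1, h.integral_rho0_u0 le_rfl (h.yLow_mem hx.le).1, mom_zero,
      sub_zero]
  · rw [if_neg h1.not_ge, sel_of_lt hx h1,
      h.integral_rhoB_uB le_rfl (h.tauLow_nonneg hx.le), neg_zero, mom_zero, zero_sub, neg_neg]

/-- For `η ≥ 0` the condition `F ≤ G` is automatic: where it fails the selected label is at most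
zero. -/
lemma charX_eq (h : g.Represents d) {η : ℝ} (hη : 0 ≤ η) (t : ℝ) :
    d.charX η t = h.flow.char η t := by
  unfold GasData.charX Flow.char
  congr 1
  ext x
  refine and_congr_right fun hx => ?_
  change _ ↔ η < d.sel x t
  rcases le_or_gt (d.minF x t) (d.minG x t) with h1 | h1
  · rw [sel_of_le hx h1]
    exact and_iff_right h1
  · rw [sel_of_lt hx h1]
    have := h.tauLow_nonneg (t := t) hx.le
    exact ⟨fun h2 => absurd h2.1 h1.not_ge, fun h2 => by linarith⟩

/-- If the characteristic sits on the axis, a minimizer there is at least `η > 0`, so `F ≤ G` and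
the prescribed `uB` never enters. -/
lemma velocity_char (h : g.Represents d) {η t : ℝ} (hη : 0 < η) (ht : 0 < t) :
    d.velocity (h.flow.char η t) t = h.flow.u (h.flow.char η t) t := by
  change _ = d.innerVelocity _ t
  unfold GasData.innerVelocity
  rcases (h.flow.char_nonneg η t).eq_or_lt with h0 | h0
  · rw [← h0]
    obtain ⟨w, -, hw, hlim⟩ := exists_seq_strictAnti_tendsto (0 : ℝ)
    obtain ⟨σ, hσ, k, -, hk⟩ := g.exists_subseq_argmin ordConnected_univ isClosed_univ trivial
      hlim (tendsto_const_nhds (x := t)) (fun n => (hw n).le) (fun n => h.sel_mem t (hw n))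
    have h1 : η ≤ σ := ge_of_tendsto' hk fun n =>
      (h.flow.lt_of_char_lt (h0 ▸ hw _) (h.sel_mem t (hw _))).le
    rcases (h.le_of_mem_argmin le_rfl (hη.le.trans h1) hσ).lt_or_eq with h2 | h2
    · rw [if_neg (by simp [h2.ne]), GasData.velocity, if_neg fun h3 => h3.2.not_gt h2,
        if_pos ⟨rfl, h2⟩]
    · rw [if_pos ⟨ht, Or.inr ⟨rfl, h2⟩⟩]
  · rw [if_pos ⟨ht, Or.inl h0⟩]

/-- The supremum uses `η < tauLow` strictly, whereas the characteristic of `-η` only gives `η ≤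
tauLow` to its left. If they differed, a rational position strictly between them would have `tauLow
= η`, which `hr` rules out. -/
lemma charY_eq (h : g.Represents d) {x t η : ℝ} (hx : 0 < x)
    (hlt : d.minG x t < d.minF x t) (hη : 0 < η) (hηx : η < d.tauLow x t)
    (hr : ∀ r : ℚ, η ≠ d.tauLow r t) :
    x ≤ d.charY η t ∧ d.charY η t = h.flow.char (-η) t := by
  have hub : ∀ y ∈ {y | 0 ≤ y ∧ d.minG y t ≤ d.minF y t ∧ η < d.tauLow y t},
      y ≤ h.flow.char (-η) t := by
    rintro y ⟨hy, h1, h2⟩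
    by_contra! h3
    have := h.flow.lt_of_char_lt h3 (h.mem_argmin_of_ge hy h1 (h.tauLow_mem hy))
    linarith
  have hxY : x ≤ d.charY η t := le_csSup ⟨_, hub⟩ ⟨hx.le, hlt.le, hηx⟩
  refine ⟨hxY, le_antisymm (csSup_le ⟨x, hx.le, hlt.le, hηx⟩ hub) ?_⟩
  by_contra! h1
  obtain ⟨r, hr1, hr2⟩ := exists_rat_btwn h1
  have hr0 : (0 : ℝ) < r := hx.trans_le (hxY.trans hr1.le)
  have h2 := h.flow.le_of_lt_char hr0.le hr2 (h.sel_mem t hr0)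
  have h3 := h.ge_of_mem_argmin hr0.le (by linarith) (h.sel_mem t hr0)
  have h4 := h.flow.le_of_lt_char hr0.le hr2 (h.mem_argmin_of_ge hr0.le h3 (h.tauLow_mem hr0.le))
  exact hr1.not_ge (le_csSup ⟨_, hub⟩
    ⟨hr0.le, h3, lt_of_le_of_ne (by linarith) (hr r)⟩)

lemma energy_eq (h : g.Represents d) {x t : ℝ} (hx : 0 < x) (ht : 0 < t) :
    d.energy x t = 1 / 2 * g.prim (h.flow.flux t) (d.sel x t) := by
  unfold GasData.energy
  rcases le_or_gt (d.minF x t) (d.minG x t) with h1 | h1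
  · rw [if_pos h1, sel_of_le hx h1, g.prim_eq_of_ae_pos (h.yLow_mem hx.le).1]
    filter_upwards [h.dens_pos, h.vel_pos] with s h2 h3 hs
    rw [h.charX_eq hs.1.le, h.velocity_char hs.1 ht, ← h2 hs.1, ← h3 hs.1]
    change _ = g.dens s * (_ * g.vel s)
    ring
  · rw [if_neg h1.not_ge, sel_of_lt hx h1,
      g.prim_eq_of_ae_neg (w := h.flow.flux t) (h.tauLow_nonneg hx.le), mul_neg, neg_neg]
    -- Only countably many labels are discarded here for `charY_eq`: the endpoint and the values of
    -- `tauLow` at rational positions.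
    filter_upwards [h.dens_neg, h.vel_neg, Measure.ae_ne volume (d.tauLow x t),
      ae_all_iff.2 fun r : ℚ => Measure.ae_ne volume (d.tauLow r t)] with s h2 h3 h4 h5 hs
    obtain ⟨h6, h7⟩ := h.charY_eq hx h1 hs.1 (lt_of_le_of_ne hs.2 h4) h5
    have h8 : h.flow.u (d.charY s t) t = d.velocity (d.charY s t) t :=
      if_pos ⟨ht, Or.inl (hx.trans_le h6)⟩
    rw [Flow.flux, ← h7, h8]
    change _ = g.dens (-s) * (_ * g.vel (-s))
    rw [h2 hs.1, h3 hs.1]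
    ring

end LineGas.Represents

end PressurelessGas

end

theorem theorem3p7 (d : PressurelessGas.GasData) (hd : d.Admissible) :
    ∃ ρ : ℝ → MeasureTheory.Measure ℝ,
      (∀ t : ℝ, 0 < t → PressurelessGas.IsStieltjesMeasure (fun x => d.mass x t) (ρ t)) ∧
      PressurelessGas.IsGeneralizedSolution d.velocity d.mass ρ ∧
      PressurelessGas.IsWeakSolution d.mass d.momentum ∧
      PressurelessGas.IsWeakSolution d.momentum (fun x t => 2 * d.energy x t) ∧
      (∀ t : ℝ, 0 < t → PressurelessGas.HasStieltjesDensity (fun x => d.momentum x t)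
        (fun x => d.velocity x t) (ρ t)) ∧
      (∀ t : ℝ, 0 < t → PressurelessGas.HasStieltjesDensity (fun x => d.energy x t)
        (fun x => 1 / 2 * d.velocity x t ^ 2) (ρ t)) := by
  obtain ⟨g, h⟩ := hd.exists_lineGas
  exact ⟨h.flow.rho, h.flow.isSolution
    (fun x t hx ht => (h.velocity_eq hx.le (Or.inl hx)).trans (h.innerVelocity_eq hx ht).symm)
    (fun x t hx _ => h.mass_eq t hx) (fun x t hx _ => h.momentum_eq t hx)
    fun x t hx ht => h.energy_eq hx ht⟩
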